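/- **Model.** A space-$s$ streaming algorithm has $s$ bits of memory, which it updates (using fresh randomness, in arbitrary time, and possibly in a way that depends on the position in the stream) on each symbol of a stream that it reads once. A two-stage streaming interactive proof (SIP) for a language $L$, with messages over an alphabet $\Gamma$, consists of a fixed schedule, a computationally unbounded prover $P$ and a space-$s$ streaming verifier $V$. In the *setup* $P$ sends symbols; then the input $x$ is streamed, and is observed by both parties; in the *interactive stage* $P$ and $V$ send symbols in an order fixed by the schedule; finally $V$ accepts or rejects. It is required that $V$ accepts with probability at least $2/3$ when interacting with $P$ on $x\in L$, and with probability at most $1/3$ when interacting with any prover on $x\notin L$. Communication is counted in bits, $\lceil\log_2|\Gamma|\rceil$ per symbol. The *view* of a verifier $\widetilde V$ is the stream, in the order of the execution, of the symbols of $P$, of the input, and of the random symbols consumed by $\widetilde V$. A *zkSIP* for $L$ is a triplet $(P,V,S)$ where $(P,V)$ is an SIP with a space-$s$ verifier and $S$ is a $\operatorname{poly}(s)$-space streaming simulator. The simulator has white-box access to the verifier (it may be any function of the strategy of $\widetilde V$), streaming access to the input and to the randomness of $\widetilde V$, and query access to a uniformly random string $t$ over $\Gamma$ that is independent of the input; it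 outputs a simulated view. The zkSIP is secure against space-$s'$ distinguishers if, for all space-$s$ verifiers $\widetilde V$, all space-$s'$ streaming algorithms $D$ and all $x\in L$, the probabilities that $D$ accepts the view of $\widetilde V$ when it interacts with $P$ on $x$, and that $D$ accepts the view simulated by $S$ for $\widetilde V$ on $x$, differ by $o(1)$ as $n\to\infty$ (uniformly in $\widetilde V$, $D$, $x$). For a finite field $\mathbb F$, $n \in\mathbb N$ and $\alpha\in\mathbb F$, $\mathrm{DECISION\text{-}INDEX}(\alpha)$ is the language of pairs $(x,j)\in\mathbb F^n\times[n]$ with $x_j=\alpha$; the string $x$ is streamed symbol by symbol and is followed by $j$. **Statement.** Fix $\delta\in(0,1]$, and for each $n$ let $\mathbb F=\mathbb F_{q(n)}$ be a finite field, where $q(n)=\Theta\big(\log^{1+2/\delta} n\big)$. Then for every $\alpha\in\mathbb F_{q(n)}$ there is a zkSIP for $\mathrm{DECISION\text{-}INDEX}(\alpha)$, with messages over $\mathbb F_{q(n)}$, whose verifier has space complexity $s = O(\log n)$, and whose communication complexity is $O(n^{1+\delta})$ in the setup and $\operatorname{polylog}(n)$ in the interactive stage. For every function $s'(n)=\tilde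 O\big(\log^{2+2/\delta} n\big)$, that is, $s'(n)=O\big(\log^{2+2/\delta} n\cdot(\log\log n)^k\big)$ for some $k$, this zkSIP is secure against space-$s'$ distinguishers. All bounds are uniform in $\alpha$. -/

import Mathlib

open Filter Asymptotics Topology

universe u

noncomputable section

/-! ### Streaming interactive proofs

`Γ` is the alphabet of the messages, `A` is the alphabet of the input stream.  A protocol is run
symbol by symbol along a fixed schedule; the position of the current symbol in the schedule is
called the tick. -/

/-- The memory of a space-`s` algorithm: `s` bits. -/
abbrev Memory (s : ℕ) : Type := Fin s → Bool

/-- The two parties of the protocol. -/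
inductive Party where
  | prover
  | verifier

/-- What happens at a tick: the prover sends a symbol, all parties see the input symbol `a`,
or the verifier sends a symbol. -/
inductive Slot (A : Type u) where
  | prover
  | input (a : A)
  | verifier

/-- A two-stage schedule.  In the setup, before the input, the prover sends `setup` symbols.
Then the input is streamed.  In the interactive stage, the parties send one symbol each time it
is their turn in the list `interactive`. -/
structure Schedule where
  setup : ℕ
  interactive : List Party

/-- The ticks of an execution in which the input stream is `xs`. -/
def Schedule.slots {A : Type u} (c : Schedule) (xs : List A) : List (Slot A) :=
  List.replicate c.setup Slot.prover ++ xs.map Slot.input ++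
    c.interactive.map fun
      | Party.prover => Slot.prover
      | Party.verifier => Slot.verifier

/-- Number of bits communicated in the setup (each symbol of `Γ` takes `⌈log₂ |Γ|⌉` bits). -/
def Schedule.setupBits (c : Schedule) (Γ : Type u) [Fintype Γ] : ℕ :=
  c.setup * Nat.clog 2 (Fintype.card Γ)

/-- Number of bits communicated, in both directions, in the interactive stage. -/
def Schedule.interactiveBits (c : Schedule) (Γ : Type u) [Fintype Γ] : ℕ :=
  c.interactive.length * Nat.clog 2 (Fintype.card Γ)

/-- What the prover observes at a tick. -/
inductive Event (Γ A : Type u) where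
  | prover (g : Γ)
  | input (a : A)
  | verifier (g : Γ)

/-- A computationally unbounded randomised prover: the law of its next symbol, as a function of
everything it has observed so far in chronological order (its own symbols, those of the verifier,
and the part of the input that has already been streamed). -/
def Prover (Γ A : Type u) : Type u := List (Event Γ A) → PMF Γ

/-- A space-`s` streaming verifier.  At each tick it draws a fresh symbol of its internal
randomness, uniformly from `Fin (coins + 1)`, and updates its memory; it can retain a random
symbol only in its memory.  There is no restriction on the time taken by an update, and updates
may depend on the tick. -/
structure Verifier (Γ A : Type u) (s : ℕ) where
  coins : ℕ
  init : Memory s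
  /-- update on receiving a symbol from the prover -/
  hear : ℕ → Memory s → Fin (coins + 1) → Γ → Memory s
  /-- update on reading a symbol of the input -/
  read : ℕ → Memory s → Fin (coins + 1) → A → Memory s
  /-- symbol sent to the prover, and the update of the memory -/
  send : ℕ → Memory s → Fin (coins + 1) → Γ × Memory s
  /-- decision at the end of the protocol -/
  accept : Memory s → Bool

/-- One symbol of the view of the verifier: the symbol `r` of its internal randomness that it
consumes at the tick, together with the prover's symbol or the input symbol, if any.  (The symbols
that the verifier itself sends are determined by its view.) -/
inductive ViewSymbol (Γ A : Type u) where
  | hear (r : ℕ) (g : Γ)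
  | read (r : ℕ) (a : A)
  | send (r : ℕ)

variable {Γ A : Type u}

/-- Execution of the interaction from tick `i`, with current memory `m` of the verifier and
history `h`: joint law of the (remaining) view and of the final memory of the verifier. -/
def runFrom {s : ℕ} (P : Prover Γ A) (V : Verifier Γ A s) :
    ℕ → Memory s → List (Event Γ A) → List (Slot A) →
      PMF (List (ViewSymbol Γ A) × Memory s)
  | _, m, _, [] => PMF.pure ([], m)
  | i, m, h, Slot.prover :: l =>
      (P h).bind fun g =>
        (PMF.uniformOfFintype (Fin (V.coins + 1))).bind fun r =>
          (runFrom P V (i + 1) (V.hear i m r g) (h ++ [Event.prover g]) l).map fun o =>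
            (ViewSymbol.hear r g :: o.1, o.2)
  | i, m, h, Slot.input a :: l =>
      (PMF.uniformOfFintype (Fin (V.coins + 1))).bind fun r =>
        (runFrom P V (i + 1) (V.read i m r a) (h ++ [Event.input a]) l).map fun o =>
          (ViewSymbol.read r a :: o.1, o.2)
  | i, m, h, Slot.verifier :: l =>
      (PMF.uniformOfFintype (Fin (V.coins + 1))).bind fun r =>
        (runFrom P V (i + 1) (V.send i m r).2 (h ++ [Event.verifier (V.send i m r).1]) l).map
          fun o => (ViewSymbol.send r :: o.1, o.2)

/-- The interaction of `P` and `V` along the schedule `c` on the input stream `xs`. -/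
def interaction {s : ℕ} (c : Schedule) (P : Prover Γ A) (V : Verifier Γ A s) (xs : List A) :
    PMF (List (ViewSymbol Γ A) × Memory s) :=
  runFrom P V 0 V.init [] (c.slots xs)

/-- Probability that `V` accepts after interacting with `P` on the input stream `xs`. -/
def acceptProb {s : ℕ} (c : Schedule) (P : Prover Γ A) (V : Verifier Γ A s) (xs : List A) : ℝ :=
  (((interaction c P V xs).map fun o => V.accept o.2) true).toReal

/-- Law of the view of `V` in its interaction with `P` on the input stream `xs`. -/
def view {s : ℕ} (c : Schedule) (P : Prover Γ A) (V : Verifier Γ A s) (xs : List A) :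
    PMF (List (ViewSymbol Γ A)) :=
  (interaction c P V xs).map Prod.fst

/-- `(P, V)` is a streaming interactive proof, with schedule `c`, for the language `L`; the
instances are the elements of `X`, and the instance `x` is streamed as `stream x`. -/
structure IsSIP {X : Type u} {s : ℕ} (stream : X → List A) (L : Set X)
    (c : Schedule) (P : Prover Γ A) (V : Verifier Γ A s) : Prop where
  complete : ∀ x ∈ L, 2 / 3 ≤ acceptProb c P V (stream x)
  sound : ∀ x ∉ L, ∀ P' : Prover Γ A, acceptProb c P' V (stream x) ≤ 1 / 3

/-! ### Zero knowledge -/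

/-- A randomised space-`s` streaming algorithm that reads a view and accepts or rejects. -/
structure Distinguisher (Γ A : Type u) (s : ℕ) where
  init : Memory s
  step : ℕ → Memory s → ViewSymbol Γ A → PMF (Memory s)
  accept : Memory s → Bool

/-- Law of the final memory of a distinguisher, from tick `i` and memory `m`. -/
def Distinguisher.runFrom {s : ℕ} (D : Distinguisher Γ A s) :
    ℕ → Memory s → List (ViewSymbol Γ A) → PMF (Memory s)
  | _, m, [] => PMF.pure m
  | i, m, v :: l => (D.step i m v).bind fun m' => D.runFrom (i + 1) m' l

/-- Probability that `D` accepts a view of law `μ`. -/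
def Distinguisher.acceptProb {s : ℕ} (D : Distinguisher Γ A s)
    (μ : PMF (List (ViewSymbol Γ A))) : ℝ :=
  (((μ.bind fun l => D.runFrom 0 D.init l).map D.accept) true).toReal

/-- A randomised space-`s` streaming simulator with query access to a random string `t` of
`len + 1` symbols.  At each tick, it first makes `work` queries to `t`, the address of a query and
the update of its memory being determined by its memory (so that the position in this computation
also has to be kept in memory); at the ticks of the prover it then outputs the symbol `out`, and
finally it observes the symbol of the view of that tick. -/
structure Simulator (Γ A : Type u) (s : ℕ) where
  len : ℕ
  work : ℕ
  init : Memory s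
  addr : ℕ → Memory s → Fin (len + 1)
  query : ℕ → Memory s → Γ → PMF (Memory s)
  out : ℕ → Memory s → Γ
  observe : ℕ → Memory s → ViewSymbol Γ A → PMF (Memory s)

/-- `k` queries to the string `t` at tick `i`. -/
def Simulator.compute {s : ℕ} (S : Simulator Γ A s) (t : Fin (S.len + 1) → Γ) (i : ℕ) :
    ℕ → Memory s → PMF (Memory s)
  | 0, m => PMF.pure m
  | k + 1, m => (S.query i m (t (S.addr i m))).bind fun m' => S.compute t i k m'

/-- The view produced by the simulator from tick `i` and memory `m`, when its random string is `t`.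
The symbols of the input and of the verifier's randomness (uniform in `Fin (coins + 1)`) are
streamed to the simulator; it chooses the symbols of the prover, each of them before it sees the
verifier's random symbol of the same tick. -/
def Simulator.viewFrom {s : ℕ} (S : Simulator Γ A s) (coins : ℕ) (t : Fin (S.len + 1) → Γ) :
    ℕ → Memory s → List (Slot A) → PMF (List (ViewSymbol Γ A))
  | _, _, [] => PMF.pure []
  | i, m, b :: l =>
      (S.compute t i S.work m).bind fun m₁ =>
        (PMF.uniformOfFintype (Fin (coins + 1))).bind fun r =>
          let v : ViewSymbol Γ A := match b with
            | Slot.prover => ViewSymbol.hear r (S.out i m₁)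
            | Slot.input a => ViewSymbol.read r a
            | Slot.verifier => ViewSymbol.send r
          (S.observe i m₁ v).bind fun m₂ =>
            (S.viewFrom coins t (i + 1) m₂ l).map fun vs => v :: vs

/-- Law of the simulated view on the input stream `xs`, over a uniformly random string `t`. -/
def Simulator.view [Fintype Γ] [Nonempty Γ] {s : ℕ} (S : Simulator Γ A s) (coins : ℕ)
    (c : Schedule) (xs : List A) : PMF (List (ViewSymbol Γ A)) :=
  (PMF.uniformOfFintype (Fin (S.len + 1) → Γ)).bind fun t =>
    S.viewFrom coins t 0 S.init (c.slots xs)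

/-- A triplet `(P, V, S)` with a space-`s` verifier and a space-`σ` simulator.  White-box access
of `S` to the (possibly malicious) verifier means that the simulator is an arbitrary function of the
strategy of the verifier; it gets the input only as a stream. -/
structure Triplet (Γ A : Type u) (s σ : ℕ) where
  schedule : Schedule
  prover : Prover Γ A
  verifier : Verifier Γ A s
  simulator : Verifier Γ A s → Simulator Γ A σ

/-- No space-`s'` distinguisher tells, with bias more than `ε`, the view of a space-`s` verifier
interacting with the prover on an instance in `L` from the simulated view. -/
def Triplet.ZeroKnowledge [Fintype Γ] [Nonempty Γ] {X : Type u} {s σ : ℕ} (Z : Triplet Γ A s σ)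
    (stream : X → List A) (L : Set X) (s' : ℕ) (ε : ℝ) : Prop :=
  ∀ (V' : Verifier Γ A s) (D : Distinguisher Γ A s'), ∀ x ∈ L,
    |D.acceptProb (view Z.schedule Z.prover V' (stream x)) -
      D.acceptProb ((Z.simulator V').view V'.coins Z.schedule (stream x))| ≤ ε

/-! ### The index problem -/

/-- Instances of the index problem: a string `x ∈ Γⁿ` and a coordinate `j`. -/
abbrev IndexInstance (Γ : Type u) (n : ℕ) : Type u := (Fin n → Γ) × Fin n

/-- Symbols of the stream `(x, j)`: those of `x`, and coordinates. -/
abbrev IndexSymbol (Γ : Type u) (n : ℕ) : Type u := Γ ⊕ Fin n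

/-- The string `x` is streamed first, symbol by symbol, followed by the coordinate `j`. -/
def indexStream (Γ : Type u) (n : ℕ) (p : IndexInstance Γ n) : List (IndexSymbol Γ n) :=
  List.ofFn (fun i => Sum.inl (p.1 i)) ++ [Sum.inr p.2]

/-- The language of pairs `(x, j)` with `x_j = α`. -/
def decisionIndex {Γ : Type u} (n : ℕ) (α : Γ) : Set (IndexInstance Γ n) :=
  {p | p.1 p.2 = α}

end

-- Arrange `x` on a grid of `d ^ m` points in `F ^ m` and let `x̂` be its low-degree extension
-- (`lde`). In the setup the prover sends a random key `y r` for every point `r` of `F ^ m`, and a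
-- random mask for every grid point `κ`, that is, a polynomial `H κ` of degree at most `m * d`
-- without constant term. The verifier retains, for secret `r`, `r'` and nonzero `ρ`, `τ`, the key
-- `y r`, the value `x̂ r`, and the low-degree extension of the masks, with parameter `ρ`, at `r'`.
-- Let `a` be the grid point of the announced coordinate. The verifier sends the direction `w = ρ⁻¹
-- • (r - a)`. The prover picks a random grid point `k` and sends the nonconstant coefficients of
-- the restriction of `x̂` to the line `a + X w`, padded by the mask at `k`. The verifier then
-- reveals `ρ`, the key as evidence that it really held `r`, and the direction `τ⁻¹ • (r' - k)`. If
-- the key is right, the prover opens the extended masks, at parameter `ρ`, along the line through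
-- `k` in that direction.
--
-- Soundness. A direction carries no information about its parameter (`ev_direction`). Hence the
-- opening is correct except with probability `deg / (q - 1)` over `τ` (`ev_reply_le`). If it is
-- correct, the final check is a polynomial equation in `ρ`, fixed before `ρ` is revealed, whose two
-- sides differ at `0` by `target - x_j`; it holds with probability at most `deg / (q - 1)`
-- (`ev_commit_le`).
--
-- Zero knowledge. The simulator has the same keys and masks but cannot store `x`. A memory of `s`
-- bits allows the key to be guessed at few points only: up to an exceptional event, at most `s`
-- points have a key that can be guessed with probability more than `ε` (`exists_guess_cover`).
-- These points depend only on the verifier's memory after the keys, so the simulator knows them in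
-- time to record `x̂` there as the input streams by. It commits to any polynomial that takes the
-- value `target` at `0` and agrees with `x̂` at the recorded points of the line, and it opens only
-- at recorded points. Two hybrids compare this with the honest prover. Refusing to open elsewhere
-- is noticed only if a key was guessed. Replacing the polynomial changes it by a multiple of a
-- polynomial that vanishes at the parameter opened, so the opening does not reveal the change; and
-- the pad sits at a random one of at least `n` grid points, of which verifier and distinguisher
-- remember too little to notice a shift at that single place (`hiding_bound`).
--
-- Both information-theoretic bounds come from `sum_mul_le_log`: a quantity selected by a memory
-- state exceeds its typical size only by the logarithm of an exponential moment summed over all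
-- states. The error obtained is `3 / √(log q) + (3 s + s' + 1) / √n`, which tends to `0` for every
-- `s' = o(√n)`.
--
-- Parameters. With `β = 2 / δ`, take `d ≈ log ^ β n` and `m ≈ log n / (β log log n)`. Then `m * d`
-- is smaller than `q` by a factor of order `log log n`, and `q ^ m` is about `n ^ (1 + δ / 2)`. The
-- finitely many `n` for which this fails are served by a trivial protocol.

universe v

noncomputable section

set_option linter.unusedSectionVars false

namespace Streaming
variable {Γ A : Type u} {Q : Type} {S : Type v}

/-! ### Games

A `Player` is a randomised machine on the verifier's side of the interaction (a verifier, possibly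
together with a distinguisher); a `Strategy` is a machine on the side of the prover, which may
peek at the state of the player. -/

/-- A randomised machine with states in `Q` that hears, reads, and sends symbols. -/
structure Player (Γ A : Type u) (Q : Type) where
  hear : ℕ → Q → Γ → PMF Q
  read : ℕ → Q → A → PMF Q
  send : ℕ → Q → PMF (Γ × Q)

/-- A prover with states in `S` that may look at the state of the player. -/
structure Strategy (Γ A : Type u) (Q : Type) (S : Type v) where
  law : ℕ → S → PMF Γ
  upd : ℕ → Q → S → Event Γ A → S

/-- The interaction of a player and a strategy: joint law of the final states. -/
def game (B : Player Γ A Q) (T : Strategy Γ A Q S) : ℕ → Q → S → List (Slot A) → PMF (Q × S)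
  | _, q, σ, [] => PMF.pure (q, σ)
  | i, q, σ, Slot.prover :: l =>
      (T.law i σ).bind fun g => (B.hear i q g).bind fun q' =>
        game B T (i + 1) q' (T.upd i q' σ (Event.prover g)) l
  | i, q, σ, Slot.input a :: l =>
      (B.read i q a).bind fun q' => game B T (i + 1) q' (T.upd i q' σ (Event.input a)) l
  | i, q, σ, Slot.verifier :: l =>
      (B.send i q).bind fun o => game B T (i + 1) o.2 (T.upd i o.2 σ (Event.verifier o.1)) l

theorem game_append (B : Player Γ A Q) (T : Strategy Γ A Q S) (l₁ l₂ : List (Slot A)) (i : ℕ)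
    (q : Q) (σ : S) :
    game B T i q σ (l₁ ++ l₂) =
      (game B T i q σ l₁).bind fun o => game B T (i + l₁.length) o.1 o.2 l₂ := by
  induction l₁ generalizing i q σ with
  | nil => simp [game]
  | cons b l ih =>
    have h : i + 1 + l.length = i + (b :: l).length := by simp; omega
    cases b <;> simp only [List.cons_append, game, ih, PMF.bind_bind, h]

/-- A verifier as a player. -/
def verifierPlayer {s : ℕ} (V : Verifier Γ A s) : Player Γ A (Memory s) where
  hear i m g := (PMF.uniformOfFintype (Fin (V.coins + 1))).map fun r => V.hear i m r g
  read i m a := (PMF.uniformOfFintype (Fin (V.coins + 1))).map fun r => V.read i m r a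
  send i m := (PMF.uniformOfFintype (Fin (V.coins + 1))).map fun r => V.send i m r

/-- A verifier together with a distinguisher that reads its view. -/
def viewPlayer {s s' : ℕ} (V : Verifier Γ A s) (D : Distinguisher Γ A s') :
    Player Γ A (Memory s × Memory s') where
  hear i q g := (PMF.uniformOfFintype (Fin (V.coins + 1))).bind fun r =>
    (D.step i q.2 (ViewSymbol.hear r g)).map fun z => (V.hear i q.1 r g, z)
  read i q a := (PMF.uniformOfFintype (Fin (V.coins + 1))).bind fun r =>
    (D.step i q.2 (ViewSymbol.read r a)).map fun z => (V.read i q.1 r a, z)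
  send i q := (PMF.uniformOfFintype (Fin (V.coins + 1))).bind fun r =>
    (D.step i q.2 (ViewSymbol.send r)).map fun z =>
      ((V.send i q.1 r).1, ((V.send i q.1 r).2, z))

/-- A prover as a strategy, whose state is the history. -/
def proverStrategy (P : Prover Γ A) : Strategy Γ A Q (List (Event Γ A)) where
  law _ h := P h
  upd _ _ h e := h ++ [e]

theorem proverStrategy_law (P : Prover Γ A) (i : ℕ) (h : List (Event Γ A)) :
    (proverStrategy P : Strategy Γ A Q _).law i h = P h := rfl

theorem proverStrategy_upd (P : Prover Γ A) (i : ℕ) (q : Q) (h : List (Event Γ A))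
    (e : Event Γ A) : (proverStrategy P : Strategy Γ A Q _).upd i q h e = h ++ [e] := rfl

theorem verifierPlayer_hear {s : ℕ} (V : Verifier Γ A s) (i : ℕ) (m : Memory s) (g : Γ) :
    (verifierPlayer V).hear i m g =
      (PMF.uniformOfFintype (Fin (V.coins + 1))).map fun r => V.hear i m r g := rfl

theorem verifierPlayer_read {s : ℕ} (V : Verifier Γ A s) (i : ℕ) (m : Memory s) (a : A) :
    (verifierPlayer V).read i m a =
      (PMF.uniformOfFintype (Fin (V.coins + 1))).map fun r => V.read i m r a := rfl

theorem verifierPlayer_send {s : ℕ} (V : Verifier Γ A s) (i : ℕ) (m : Memory s) :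
    (verifierPlayer V).send i m =
      (PMF.uniformOfFintype (Fin (V.coins + 1))).map fun r => V.send i m r := rfl

theorem viewPlayer_hear {s s' : ℕ} (V : Verifier Γ A s) (D : Distinguisher Γ A s') (i : ℕ)
    (q : Memory s × Memory s') (g : Γ) :
    (viewPlayer V D).hear i q g = (PMF.uniformOfFintype (Fin (V.coins + 1))).bind fun r =>
      (D.step i q.2 (ViewSymbol.hear r g)).map fun z => (V.hear i q.1 r g, z) := rfl

theorem viewPlayer_read {s s' : ℕ} (V : Verifier Γ A s) (D : Distinguisher Γ A s') (i : ℕ)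
    (q : Memory s × Memory s') (a : A) :
    (viewPlayer V D).read i q a = (PMF.uniformOfFintype (Fin (V.coins + 1))).bind fun r =>
      (D.step i q.2 (ViewSymbol.read r a)).map fun z => (V.read i q.1 r a, z) := rfl

theorem viewPlayer_send {s s' : ℕ} (V : Verifier Γ A s) (D : Distinguisher Γ A s') (i : ℕ)
    (q : Memory s × Memory s') :
    (viewPlayer V D).send i q = (PMF.uniformOfFintype (Fin (V.coins + 1))).bind fun r =>
      (D.step i q.2 (ViewSymbol.send r)).map fun z =>
        ((V.send i q.1 r).1, ((V.send i q.1 r).2, z)) := rfl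

theorem runFrom_map_snd {s : ℕ} (P : Prover Γ A) (V : Verifier Γ A s) (l : List (Slot A)) (i : ℕ)
    (m : Memory s) (h : List (Event Γ A)) :
    (runFrom P V i m h l).map (fun o => o.2) =
      (game (verifierPlayer V) (proverStrategy P) i m h l).map fun o => o.1 := by
  induction l generalizing i m h with
  | nil => simp [game, runFrom, PMF.pure_map]
  | cons b l ih =>
    cases b <;>
      simp only [runFrom, game, proverStrategy_law, proverStrategy_upd, verifierPlayer_hear,
        verifierPlayer_read, verifierPlayer_send, PMF.map_bind, PMF.map_comp,
        PMF.bind_map] <;>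
      simp only [Function.comp_def] <;>
      simp only [← ih]

/-- The view is read online, so the distinguisher can run in lockstep with the verifier: each of its
steps is independent of the rest of the interaction and commutes with it. -/
theorem runFrom_distinguisher {s s' : ℕ} (P : Prover Γ A) (V : Verifier Γ A s)
    (D : Distinguisher Γ A s') (l : List (Slot A)) (i : ℕ) (m : Memory s) (z : Memory s')
    (h : List (Event Γ A)) :
    (runFrom P V i m h l).bind (fun o => D.runFrom i z o.1) =
      (game (viewPlayer V D) (proverStrategy P) i (m, z) h l).map fun o => o.1.2 := by
  induction l generalizing i m z h with
  | nil => simp [game, runFrom, PMF.pure_map, Distinguisher.runFrom]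
  | cons b l ih =>
    cases b <;>
      simp only [runFrom, game, proverStrategy_law, proverStrategy_upd, viewPlayer_hear,
        viewPlayer_read, viewPlayer_send, PMF.map_bind,
        PMF.bind_map, PMF.bind_bind, Function.comp_def, Distinguisher.runFrom] <;>
      simp only [← ih] <;>
      [(congr 1; ext1 g; congr 1; ext1 r); (congr 1; ext1 r); (congr 1; ext1 r)] <;>
      rw [PMF.bind_comm]

theorem acceptProb_eq_game {s : ℕ} (c : Schedule) (P : Prover Γ A) (V : Verifier Γ A s)
    (xs : List A) :
    acceptProb c P V xs =
      (((game (verifierPlayer V) (proverStrategy P) 0 V.init [] (c.slots xs)).map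
        fun o => V.accept o.1) true).toReal := by
  have := runFrom_map_snd P V (c.slots xs) 0 V.init []
  have h2 := congrArg (PMF.map V.accept) this
  rw [PMF.map_comp, PMF.map_comp] at h2
  rw [acceptProb, interaction]
  exact congrArg (fun μ : PMF Bool => (μ true).toReal) h2

theorem distinguisher_acceptProb_view {s s' : ℕ} (c : Schedule) (P : Prover Γ A)
    (V : Verifier Γ A s) (D : Distinguisher Γ A s') (xs : List A) :
    D.acceptProb (view c P V xs) =
      (((game (viewPlayer V D) (proverStrategy P) 0 (V.init, D.init) [] (c.slots xs)).map
        fun o => D.accept o.1.2) true).toReal := by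
  have := runFrom_distinguisher P V D (c.slots xs) 0 V.init D.init []
  have h2 := congrArg (PMF.map D.accept) this
  rw [PMF.map_comp] at h2
  rw [Distinguisher.acceptProb, view, interaction, PMF.bind_map]
  exact congrArg (fun μ : PMF Bool => (μ true).toReal) h2

/-! ### Simulators with a prescribed output law -/

/-- A fixed injection into memory, with a left inverse. -/
theorem exists_encoding {T : Type u} {U : Type v} [Nonempty T] [Fintype U] (f : T → U)
    (hf : f.Injective) {s : ℕ} (h : Fintype.card U ≤ 2 ^ s) :
    ∃ (enc : T → Memory s) (dec : Memory s → T), ∀ x, dec (enc x) = x := by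
  have h1 : Fintype.card U ≤ Fintype.card (Memory s) := by simpa [Memory] using h
  obtain ⟨g⟩ := Function.Embedding.nonempty_of_card_le h1
  exact ⟨g ∘ f, Function.invFun (g ∘ f), Function.leftInverse_invFun (g.injective.comp hf)⟩

/-- Description of a simulator that tracks the memory of the verifier: at each tick, the law of
its output is a function of its state and of a sum over the random string. -/
structure SimSpec (Γ A : Type u) (s : ℕ) (S R : Type u) where
  len : ℕ
  init : S
  contrib : ℕ → S → Fin (len + 1) → Γ → R
  law : ℕ → S → R → PMF Γ
  upd : ℕ → Memory s → S → Event Γ A → S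

variable {S R : Type u} {s σ : ℕ} [AddCommMonoid R]

/-- State of the simulator: the verifier's memory, the state of the description, the position in
the random string, the accumulated sum, and the next output. -/
abbrev SimState (s : ℕ) (S R Γ : Type u) (len : ℕ) : Type u :=
  Memory s × S × Fin (len + 1) × R × Γ

/-- The verifier's memory after a symbol of its view. -/
def memoryUpdate (V : Verifier Γ A s) (i : ℕ) (m : Memory s) : ViewSymbol Γ A → Memory s
  | .hear r g => V.hear i m (Fin.ofNat (V.coins + 1) r) g
  | .read r a => V.read i m (Fin.ofNat (V.coins + 1) r) a
  | .send r => (V.send i m (Fin.ofNat (V.coins + 1) r)).2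

/-- The event that corresponds to a symbol of the view. -/
def eventOf (V : Verifier Γ A s) (i : ℕ) (m : Memory s) : ViewSymbol Γ A → Event Γ A
  | .hear _ g => .prover g
  | .read _ a => .input a
  | .send r => .verifier (V.send i m (Fin.ofNat (V.coins + 1) r)).1

/-- The sum restarts whenever the position is `0`. An output is drawn at every query and overwritten
by the next one, so only the draw made with the complete sum survives. -/
def SimSpec.queryState (Z : SimSpec Γ A s S R) (i : ℕ) (x : SimState s S R Γ Z.len) (g : Γ) :
    PMF (SimState s S R Γ Z.len) :=
  let acc := (if x.2.2.1 = 0 then 0 else x.2.2.2.1) + Z.contrib i x.2.1 x.2.2.1 g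
  (Z.law i x.2.1 acc).map fun o => (x.1, x.2.1, x.2.2.1 + 1, acc, o)

def SimSpec.observeState (Z : SimSpec Γ A s S R) (V : Verifier Γ A s) (i : ℕ)
    (x : SimState s S R Γ Z.len) (v : ViewSymbol Γ A) : SimState s S R Γ Z.len :=
  let m' := memoryUpdate V i x.1 v
  (m', Z.upd i m' x.2.1 (eventOf V i x.1 v), x.2.2)

/-- The simulator with a given description, with respect to an encoding of its states. -/
abbrev SimSpec.toSimulator [Inhabited Γ] (Z : SimSpec Γ A s S R) (V : Verifier Γ A s)
    (enc : SimState s S R Γ Z.len → Memory σ) (dec : Memory σ → SimState s S R Γ Z.len) :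
    Simulator Γ A σ where
  len := Z.len
  work := Z.len + 1
  init := enc (V.init, Z.init, 0, 0, default)
  addr _ M := (dec M).2.2.1
  query i M g := (Z.queryState i (dec M) g).map enc
  out _ M := (dec M).2.2.2.2
  observe i M v := PMF.pure (enc (Z.observeState V i (dec M) v))

/-- The strategy that a simulator realises when its random string is `t`. -/
def SimSpec.strategy {s' : ℕ} (Z : SimSpec Γ A s S R) (t : Fin (Z.len + 1) → Γ) :
    Strategy Γ A (Memory s × Memory s') S where
  law i x := Z.law i x (∑ k, Z.contrib i x k (t k))
  upd i q x e := Z.upd i q.1 x e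

/-- The `len + 1` queries of a tick sweep the string exactly once, and the position wraps around to
`0`, ready for the next tick. The accumulator and output left from earlier are irrelevant. -/
theorem SimSpec.compute_eq [Inhabited Γ] (Z : SimSpec Γ A s S R) (V : Verifier Γ A s)
    (enc : SimState s S R Γ Z.len → Memory σ) (dec : Memory σ → SimState s S R Γ Z.len)
    (hdec : ∀ x, dec (enc x) = x) (t : Fin (Z.len + 1) → Γ) (i : ℕ) (m : Memory s) (x : S)
    (acc : R) (o : Γ) :
    (Z.toSimulator V enc dec).compute t i (Z.len + 1) (enc (m, x, 0, acc, o)) =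
      (Z.law i x (∑ k, Z.contrib i x k (t k))).map fun o' =>
        enc (m, x, 0, ∑ k, Z.contrib i x k (t k), o') := by
  set c : ℕ → R := fun k => if h : k < Z.len + 1 then Z.contrib i x ⟨k, h⟩ (t ⟨k, h⟩) else 0
  have hc : ∑ k, Z.contrib i x k (t k) = ∑ k ∈ Finset.range (Z.len + 1), c k := by
    rw [Finset.sum_range]
    exact Finset.sum_congr rfl fun k _ => by simp only [c]; rw [dif_pos k.2]
  -- Induction on the number of queries that remain after the current one, which is made at position
  -- `Z.len - n`.
  have key : ∀ (n : ℕ) (hn : n ≤ Z.len) (acc : R) (o : Γ),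
      (if Z.len - n = 0 then 0 else acc) = ∑ k ∈ Finset.range (Z.len - n), c k →
      (Z.toSimulator V enc dec).compute t i (n + 1)
        (enc (m, x, (⟨Z.len - n, by omega⟩ : Fin (Z.len + 1)), acc, o)) =
      (Z.law i x (∑ k, Z.contrib i x k (t k))).map fun o' =>
        enc (m, x, 0, ∑ k, Z.contrib i x k (t k), o') := by
    intro n
    induction n with
    | zero =>
      intro hn acc o hacc
      have e1 : (⟨Z.len, by omega⟩ : Fin (Z.len + 1)) + 1 = 0 := by
        exact Fin.last_add_one _
      have e2 : ((⟨Z.len, by omega⟩ : Fin (Z.len + 1)) = 0) ↔ Z.len = 0 := by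
        simp [Fin.ext_iff]
      have e3 : (if Z.len = 0 then 0 else acc) +
          Z.contrib i x ⟨Z.len, by omega⟩ (t ⟨Z.len, by omega⟩) =
          ∑ k, Z.contrib i x k (t k) := by
        rw [hc, Finset.sum_range_succ]
        have : c Z.len = Z.contrib i x ⟨Z.len, by omega⟩ (t ⟨Z.len, by omega⟩) :=
          dif_pos (Nat.lt_succ_self _)
        rw [this]
        exact congrArg (· + _) hacc
      simp only [Simulator.compute, hdec, SimSpec.queryState, Nat.sub_zero,
        e1, e2, e3, PMF.map_comp, PMF.bind_pure]
      rfl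
    | succ n ih =>
      intro hn acc o hacc
      have e1 : (⟨Z.len - (n + 1), by omega⟩ : Fin (Z.len + 1)) + 1 =
          ⟨Z.len - n, by omega⟩ := by
        apply Fin.ext
        rw [Fin.val_add_one_of_lt]
        · simp only; omega
        · rw [Fin.lt_def]; simp; omega
      have e2 : ((⟨Z.len - (n + 1), by omega⟩ : Fin (Z.len + 1)) = 0) ↔
          Z.len - (n + 1) = 0 := by
        simp [Fin.ext_iff]
      have e3 : (if Z.len - (n + 1) = 0 then 0 else acc) +
          Z.contrib i x ⟨Z.len - (n + 1), by omega⟩ (t ⟨Z.len - (n + 1), by omega⟩) =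
          ∑ k ∈ Finset.range (Z.len - n), c k := by
        have : Z.len - n = Z.len - (n + 1) + 1 := by omega
        rw [this, Finset.sum_range_succ, ← hacc]
        congr 1
        simp only [c]
        rw [dif_pos (by omega)]
      rw [Simulator.compute]
      have : ∀ o', (Z.toSimulator V enc dec).compute t i (n + 1) (enc (m, x,
          (⟨Z.len - n, by omega⟩ : Fin (Z.len + 1)), ∑ k ∈ Finset.range (Z.len - n), c k, o')) =
          (Z.law i x (∑ k, Z.contrib i x k (t k))).map fun o' =>
            enc (m, x, 0, ∑ k, Z.contrib i x k (t k), o') := by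
        intro o'
        apply ih (by omega)
        rw [if_neg (by omega)]
      simp only [SimSpec.toSimulator, hdec, SimSpec.queryState, e1, e2, e3, PMF.map_comp,
        PMF.bind_map, Function.comp_def] at this ⊢
      simp only [this, PMF.bind_const]
  have := key Z.len le_rfl acc o (by simp)
  simpa using this

theorem SimSpec.viewFrom_distinguisher [Inhabited Γ] {s' : ℕ} (Z : SimSpec Γ A s S R)
    (V : Verifier Γ A s)
    (enc : SimState s S R Γ Z.len → Memory σ) (dec : Memory σ → SimState s S R Γ Z.len)
    (hdec : ∀ x, dec (enc x) = x) (t : Fin (Z.len + 1) → Γ) (D : Distinguisher Γ A s')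
    (l : List (Slot A)) (i : ℕ) (m : Memory s) (x : S) (acc : R) (o : Γ) (z : Memory s') :
    ((Z.toSimulator V enc dec).viewFrom V.coins t i (enc (m, x, 0, acc, o)) l).bind
        (fun l => D.runFrom i z l) =
      (game (viewPlayer V D) (Z.strategy t) i (m, z) x l).map fun o => o.1.2 := by
  induction l generalizing i m x acc o z with
  | nil => simp [game, Simulator.viewFrom, PMF.pure_map, Distinguisher.runFrom]
  | cons b l ih =>
    have hr : ∀ r : Fin (V.coins + 1), Fin.ofNat (V.coins + 1) (r : ℕ) = r := fun r => by
      ext; simp [Fin.ofNat, Nat.mod_eq_of_lt r.2]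
    rw [Simulator.viewFrom]
    simp only [Z.compute_eq V enc dec hdec, PMF.bind_map, Function.comp_def, hdec,
      PMF.pure_bind, PMF.bind_bind, Distinguisher.runFrom]
    cases b
    · simp only [game, viewPlayer_hear, PMF.map_bind, PMF.bind_map, PMF.bind_bind,
        Function.comp_def, SimSpec.strategy, SimSpec.observeState, memoryUpdate, eventOf, hr]
      congr 1; ext1 g; congr 1; ext1 r
      rw [PMF.bind_comm]
      congr 1; ext1 z'
      rw [ih]; rfl
    all_goals
      -- An output is computed at the other ticks too, but it enters neither the view nor the later
      -- state.
      refine Eq.trans (congrArg _ (funext fun a => ?_)) (PMF.bind_const (Z.law i x _) _)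
      simp only [game, viewPlayer_read, viewPlayer_send, PMF.map_bind, PMF.bind_map,
        PMF.bind_bind, Function.comp_def, SimSpec.observeState, memoryUpdate, eventOf, hr]
      congr 1; ext1 r
      rw [PMF.bind_comm]
      congr 1; ext1 z'
      rw [ih]; rfl

theorem SimSpec.acceptProb_view [Inhabited Γ] [Fintype Γ] {s' : ℕ} (Z : SimSpec Γ A s S R)
    (V : Verifier Γ A s)
    (enc : SimState s S R Γ Z.len → Memory σ) (dec : Memory σ → SimState s S R Γ Z.len)
    (hdec : ∀ x, dec (enc x) = x) (D : Distinguisher Γ A s') (c : Schedule) (xs : List A) :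
    D.acceptProb ((Z.toSimulator V enc dec).view V.coins c xs) =
      (((PMF.uniformOfFintype (Fin (Z.len + 1) → Γ)).bind fun t =>
        (game (viewPlayer V D) (Z.strategy t) 0 (V.init, D.init) Z.init (c.slots xs)).map
          fun o => D.accept o.1.2) true).toReal := by
  rw [Distinguisher.acceptProb, Simulator.view, PMF.bind_bind, PMF.map_bind]
  congr 3
  ext1 t
  have := Z.viewFrom_distinguisher V enc dec hdec t D (c.slots xs) 0 V.init Z.init 0 default D.init
  have h2 := congrArg (PMF.map D.accept) this
  rw [PMF.map_comp] at h2
  exact h2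

end Streaming

namespace Streaming
variable {Γ A : Type u} {Q Q' : Type} {S : Type v}

/-! ### Blocks of ticks -/

/-- The player hears a list of symbols. -/
def hears (B : Player Γ A Q) : ℕ → Q → List Γ → PMF Q
  | _, q, [] => PMF.pure q
  | i, q, g :: gs => (B.hear i q g).bind fun q' => hears B (i + 1) q' gs

/-- The player reads a list of symbols. -/
def reads (B : Player Γ A Q) : ℕ → Q → List A → PMF Q
  | _, q, [] => PMF.pure q
  | i, q, a :: as => (B.read i q a).bind fun q' => reads B (i + 1) q' as

/-- The player sends `n` symbols. -/
def sends (B : Player Γ A Q) : ℕ → Q → (n : ℕ) → PMF ((Fin n → Γ) × Q)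
  | _, q, 0 => PMF.pure (Fin.elim0, q)
  | i, q, n + 1 => (B.send i q).bind fun o =>
      (sends B (i + 1) o.2 n).map fun p => (Fin.cons o.1 p.1, p.2)

/-- Law of `n` symbols, when `μ l` is the law of the next symbol after `l`. -/
def blockLaw : (List Γ → PMF Γ) → (n : ℕ) → PMF (Fin n → Γ)
  | _, 0 => PMF.pure Fin.elim0
  | μ, n + 1 => (μ []).bind fun g => (blockLaw (fun l => μ (g :: l)) n).map (Fin.cons g)

theorem hears_append (B : Player Γ A Q) (l₁ l₂ : List Γ) (i : ℕ) (q : Q) :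
    hears B i q (l₁ ++ l₂) = (hears B i q l₁).bind fun q' => hears B (i + l₁.length) q' l₂ := by
  induction l₁ generalizing i q with
  | nil => simp [hears]
  | cons g l ih =>
    have h : i + 1 + l.length = i + (g :: l).length := by simp; omega
    simp only [List.cons_append, hears, ih, PMF.bind_bind, h]

/-- Within the block the law of the next symbol ignores the player's state, so the whole block can
be drawn before it is heard. The strategy's state may still follow the player's state: the simulator
needs this while it tracks the verifier's memory. -/
theorem game_hear (B : Player Γ A Q) (T : Strategy Γ A Q S) (n i : ℕ) (st : List Γ → Q → S)
    (μ : List Γ → PMF Γ)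
    (hlaw : ∀ gs q, gs.length < n → T.law (i + gs.length) (st gs q) = μ gs)
    (hupd : ∀ gs g q q', gs.length < n →
      T.upd (i + gs.length) q' (st gs q) (.prover g) = st (gs ++ [g]) q') (q : Q) :
    game B T i q (st [] q) (List.replicate n Slot.prover) =
      (blockLaw μ n).bind fun gs => (hears B i q (List.ofFn gs)).map fun q' =>
        (q', st (List.ofFn gs) q') := by
  induction n generalizing i st μ q with
  | zero => simp [game, blockLaw, hears, PMF.pure_map]
  | succ n ih =>
    have h1 := hlaw [] q (Nat.succ_pos _)
    have h2 := fun g q' => hupd [] g q q' (Nat.succ_pos _)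
    simp only [List.length_nil, add_zero, List.nil_append] at h1 h2
    have h3 := fun (g : Γ) (q' : Q) => ih (i + 1) (fun l => st (g :: l)) (fun l => μ (g :: l))
      (fun gs q hgs => by
        have := hlaw (g :: gs) q (by simpa using hgs)
        rwa [List.length_cons, ← add_assoc, add_right_comm] at this)
      (fun gs g' q q' hgs => by
        have := hupd (g :: gs) g' q q' (by simpa using hgs)
        rwa [List.length_cons, ← add_assoc, add_right_comm] at this) q'
    simp only [List.replicate_succ, game, h1, h2, blockLaw, PMF.bind_bind, PMF.bind_map,
      Function.comp_def, List.ofFn_cons, hears, PMF.map_bind, h3]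
    congr 1; ext1 g
    rw [PMF.bind_comm]

theorem game_read (B : Player Γ A Q) (T : Strategy Γ A Q S) (as : List A) (i : ℕ)
    (st : List A → Q → S)
    (hupd : ∀ l a q q', l.length < as.length →
      T.upd (i + l.length) q' (st l q) (.input a) = st (l ++ [a]) q') (q : Q) :
    game B T i q (st [] q) (as.map Slot.input) =
      (reads B i q as).map fun q' => (q', st as q') := by
  induction as generalizing i st q with
  | nil => simp [game, reads, PMF.pure_map]
  | cons a as ih =>
    have h2 := fun q' => hupd [] a q q' (Nat.succ_pos _)
    simp only [List.length_nil, add_zero, List.nil_append] at h2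
    have h3 := fun (q' : Q) => ih (i + 1) (fun l => st (a :: l))
      (fun gs g' q q' hgs => by
        have := hupd (a :: gs) g' q q' (by simpa using hgs)
        rwa [List.length_cons, ← add_assoc, add_right_comm] at this) q'
    simp only [List.map_cons, game, h2, reads, PMF.map_bind, h3]

theorem game_send (B : Player Γ A Q) (T : Strategy Γ A Q S) (n i : ℕ) (st : List Γ → S)
    (hupd : ∀ gs g q, gs.length < n →
      T.upd (i + gs.length) q (st gs) (.verifier g) = st (gs ++ [g])) (q : Q) :
    game B T i q (st []) (List.replicate n Slot.verifier) =
      (sends B i q n).map fun o => (o.2, st (List.ofFn o.1)) := by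
  induction n generalizing i st q with
  | zero => simp [game, sends, PMF.pure_map]
  | succ n ih =>
    have h2 := fun g q => hupd [] g q (Nat.succ_pos _)
    simp only [List.length_nil, add_zero, List.nil_append] at h2
    have h3 := fun (g : Γ) (q' : Q) => ih (i + 1) (fun l => st (g :: l))
      (fun gs g' q hgs => by
        have := hupd (g :: gs) g' q (by simpa using hgs)
        rwa [List.length_cons, ← add_assoc, add_right_comm] at this) q'
    simp only [List.replicate_succ, game, h2, sends, PMF.map_bind, PMF.map_comp,
      Function.comp_def, List.ofFn_cons, h3]

theorem blockLaw_pure (f : ℕ → Γ) (n : ℕ) :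
    blockLaw (fun l => PMF.pure (f l.length)) n = PMF.pure fun k : Fin n => f k := by
  induction n generalizing f with
  | zero => simp [blockLaw]; congr 1; ext k; exact k.elim0
  | succ n ih =>
    simp only [blockLaw, PMF.pure_bind, List.length_nil, List.length_cons]
    rw [ih fun k => f (k + 1), PMF.pure_map]
    congr 1
    ext k
    refine Fin.cases ?_ (fun k => ?_) k <;> simp

theorem uniform_cons {C : Type v} [Fintype C] [Nonempty C] (n : ℕ) :
    ((PMF.uniformOfFintype C).bind fun c =>
      (PMF.uniformOfFintype (Fin n → C)).map fun f => (Fin.cons c f : Fin (n + 1) → C)) =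
      PMF.uniformOfFintype (Fin (n + 1) → C) := by
  classical
  ext x
  simp only [PMF.bind_apply, PMF.map_apply, PMF.uniformOfFintype_apply]
  rw [tsum_fintype, Finset.sum_eq_single (x 0)]
  · rw [tsum_fintype, Finset.sum_eq_single (Fin.tail x)]
    · rw [if_pos (Fin.cons_self_tail x).symm]
      simp only [Fintype.card_fun, Fintype.card_fin, pow_succ, Nat.cast_mul]
      rw [mul_comm, ENNReal.mul_inv] <;> simp
    · intro y _ hy
      rw [if_neg]
      intro h
      exact hy (by simpa using (congrArg Fin.tail h).symm)
    · simp
  · intro c _ hc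
    rw [ENNReal.tsum_eq_zero.2, mul_zero]
    intro y
    rw [if_neg]
    rintro rfl
    exact hc (by simp)
  · simp

theorem blockLaw_uniform {C : Type v} [Fintype C] [Nonempty C] (e : C → Γ) (n : ℕ) :
    blockLaw (fun _ => (PMF.uniformOfFintype C).map e) n =
      (PMF.uniformOfFintype (Fin n → C)).map fun c => e ∘ c := by
  induction n with
  | zero =>
    have : ∀ c : Fin 0 → C, e ∘ c = Fin.elim0 := fun c => by ext k; exact k.elim0
    simp only [blockLaw, this]
    exact (PMF.map_const _ _).symm
  | succ n ih =>
    rw [← uniform_cons]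
    simp only [blockLaw, ih, PMF.bind_map, PMF.map_bind, PMF.map_comp, Function.comp_def]
    congr 1; ext1 c; congr 1; ext1 f; ext k
    refine Fin.cases ?_ (fun k => ?_) k <;> simp

/-- Used with the projection that forgets the distinguisher, when only the behaviour of the verifier
matters. -/
theorem hears_bind_congr (B : Player Γ A Q) (B' : Player Γ A Q') (π : Q → Q')
    (h : ∀ i q g, (B.hear i q g).map π = B'.hear i (π q) g) {α : Type v} (i : ℕ) (q : Q)
    (gs : List Γ) (f : Q → PMF α) (f' : Q' → PMF α) (hf : ∀ q, f q = f' (π q)) :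
    (hears B i q gs).bind f = (hears B' i (π q) gs).bind f' := by
  induction gs generalizing i q with
  | nil => simp [hears, hf]
  | cons g gs ih =>
    simp only [hears, PMF.bind_bind, ih, ← h, PMF.bind_map, Function.comp_def]

theorem reads_bind_congr (B : Player Γ A Q) (B' : Player Γ A Q') (π : Q → Q')
    (h : ∀ i q a, (B.read i q a).map π = B'.read i (π q) a) {α : Type v} (i : ℕ) (q : Q)
    (as : List A) (f : Q → PMF α) (f' : Q' → PMF α) (hf : ∀ q, f q = f' (π q)) :
    (reads B i q as).bind f = (reads B' i (π q) as).bind f' := by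
  induction as generalizing i q with
  | nil => simp [reads, hf]
  | cons g gs ih =>
    simp only [reads, PMF.bind_bind, ih, ← h, PMF.bind_map, Function.comp_def]

theorem sends_bind_congr (B : Player Γ A Q) (B' : Player Γ A Q') (π : Q → Q')
    (h : ∀ i q, (B.send i q).map (fun o => (o.1, π o.2)) = B'.send i (π q)) {α : Type v}
    (n i : ℕ) (q : Q) (f : (Fin n → Γ) × Q → PMF α) (f' : (Fin n → Γ) × Q' → PMF α)
    (hf : ∀ w q, f (w, q) = f' (w, π q)) :
    (sends B i q n).bind f = (sends B' i (π q) n).bind f' := by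
  induction n generalizing i q with
  | zero => simp [sends, hf]
  | succ n ih =>
    simp only [sends, PMF.bind_bind, ← h, PMF.bind_map, Function.comp_def]
    congr 1; ext1 o
    exact ih _ _ _ _ fun w q => hf _ _

/-! ### The interactive stage -/

section interactive

variable {C : Type} [Fintype C] [Nonempty C]

/-- The symbols at positions `a, …, a + n - 1`. -/
def slice (τ : ℕ → Γ) (a n : ℕ) : Fin n → Γ := fun i => τ (a + i)

/-- Law of the prover's symbol at position `k` of the interactive stage, given the symbols `τ` sent
so far: the verifier sends `m` symbols `w`, the prover sends `m` random symbols `κ` and the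
symbols `cf w κ`, the verifier sends a message `b` and the prover replies with `uf w κ b`. -/
def interLaw (m D : ℕ) (e : C → Γ) (cf : (Fin m → Γ) → (Fin m → Γ) → ℕ → Γ)
    (uf : (Fin m → Γ) → (Fin m → Γ) → (Fin (m + 2) → Γ) → ℕ → Γ) (k : ℕ) (τ : ℕ → Γ) : PMF Γ :=
  -- Positions below `m` belong to the verifier, so the value of the law there is irrelevant.
  if k < m + m then (PMF.uniformOfFintype C).map e
  else if k < m + m + D then PMF.pure (cf (slice τ 0 m) (slice τ m m) (k - (m + m)))
  else PMF.pure (uf (slice τ 0 m) (slice τ m m) (slice τ (m + m + D) (m + 2))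
    (k - (m + m + D + (m + 2))))

/-- The order of the messages in the interactive stage. -/
def interSchedule (m D : ℕ) : List Party :=
  List.replicate m Party.verifier ++ (List.replicate m Party.prover ++
    (List.replicate D Party.prover ++ (List.replicate (m + 2) Party.verifier ++
      List.replicate (D + 1) Party.prover)))

/-- The interactive stage, from tick `i`. -/
def inter (B : Player Γ A Q) (m D : ℕ) (e : C → Γ)
    (cf : (Fin m → Γ) → (Fin m → Γ) → ℕ → Γ)
    (uf : (Fin m → Γ) → (Fin m → Γ) → (Fin (m + 2) → Γ) → ℕ → Γ) (i : ℕ) (q : Q) : PMF Q :=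
  (sends B i q m).bind fun o₁ =>
    (PMF.uniformOfFintype (Fin m → C)).bind fun κ =>
      (hears B (i + m) o₁.2 (List.ofFn (e ∘ κ))).bind fun q₁ =>
        (hears B (i + m + m) q₁ (List.ofFn fun k : Fin D => cf o₁.1 (e ∘ κ) k)).bind fun q₂ =>
          (sends B (i + m + m + D) q₂ (m + 2)).bind fun o₂ =>
            hears B (i + m + m + D + (m + 2)) o₂.2
              (List.ofFn fun k : Fin (D + 1) => uf o₁.1 (e ∘ κ) o₂.1 k)

/-- The tape with the symbols of a list. -/
def tape [Zero Γ] (l : List Γ) : ℕ → Γ := fun k => l.getD k 0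

theorem slice_tape_append [Zero Γ] {n : ℕ} (l : List Γ) (w : Fin n → Γ) (l' : List Γ) (a : ℕ)
    (ha : a = l.length) : slice (tape (l ++ (List.ofFn w ++ l'))) a n = w := by
  subst ha
  ext k
  simp [slice, tape, List.getD_eq_getElem?_getD, List.getElem?_append]

theorem interLaw_challenge (m D : ℕ) (e : C → Γ) (cf) (uf) (k : ℕ) (τ : ℕ → Γ) (h : k < m + m) :
    interLaw m D e cf uf k τ = (PMF.uniformOfFintype C).map e := if_pos h

theorem interLaw_commit (m D : ℕ) (e : C → Γ) (cf) (uf) (k : ℕ) (τ : ℕ → Γ) (h : k < D) :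
    interLaw m D e cf uf (m + m + k) τ = PMF.pure (cf (slice τ 0 m) (slice τ m m) k) := by
  rw [interLaw, if_neg (by omega), if_pos (by omega)]
  simp

theorem interLaw_reply (m D : ℕ) (e : C → Γ) (cf) (uf) (k : ℕ) (τ : ℕ → Γ) :
    interLaw m D e cf uf (m + m + D + (m + 2) + k) τ =
      PMF.pure (uf (slice τ 0 m) (slice τ m m) (slice τ (m + m + D) (m + 2)) k) := by
  rw [interLaw, if_neg (by omega), if_neg (by omega)]
  simp

/-- Stated for any strategy whose state is a function of the symbols exchanged so far by both
parties, so that it applies to the honest prover and to the simulator alike. -/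
theorem game_inter [Zero Γ] (B : Player Γ A Q) (T : Strategy Γ A Q S) (m D : ℕ) (e : C → Γ)
    (cf) (uf)
    (i : ℕ) (st : List Γ → S)
    (hlaw : ∀ gs, gs.length < m + m + D + (m + 2) + (D + 1) → T.law (i + gs.length) (st gs) =
      interLaw m D e cf uf gs.length (tape gs))
    (hprover : ∀ gs g q, gs.length < m + m + D + (m + 2) + (D + 1) →
      T.upd (i + gs.length) q (st gs) (.prover g) = st (gs ++ [g]))
    (hverifier : ∀ gs g q, gs.length < m + m + D + (m + 2) + (D + 1) →
      T.upd (i + gs.length) q (st gs) (.verifier g) = st (gs ++ [g])) (q : Q) :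
    (game B T i q (st []) ((interSchedule m D).map fun
        | Party.prover => Slot.prover
        | Party.verifier => Slot.verifier)).map (fun o => o.1) =
      inter B m D e cf uf i q := by
  have hs : ∀ (n : ℕ) (q : Q) (l : List Γ), l.length + n ≤ m + m + D + (m + 2) + (D + 1) →
      game B T (i + l.length) q (st l) (List.replicate n Slot.verifier) =
        (sends B (i + l.length) q n).map fun o => (o.2, st (l ++ List.ofFn o.1)) := by
    intro n q l hl
    have := game_send B T n (i + l.length) (fun l' => st (l ++ l')) (fun gs g q hgs => by
      rw [add_assoc, ← List.length_append, hverifier _ _ _ (by simp; omega), List.append_assoc]) q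
    simpa using this
  have hp : ∀ (n : ℕ) (μ : List Γ → PMF Γ) (q : Q) (l : List Γ),
      l.length + n ≤ m + m + D + (m + 2) + (D + 1) →
      (∀ gs, gs.length < n → T.law (i + (l ++ gs).length) (st (l ++ gs)) = μ gs) →
      game B T (i + l.length) q (st l) (List.replicate n Slot.prover) =
        (blockLaw μ n).bind fun gs => (hears B (i + l.length) q (List.ofFn gs)).map fun q' =>
          (q', st (l ++ List.ofFn gs)) := by
    intro n μ q l hl hμ
    have := game_hear B T n (i + l.length) (fun l' _ => st (l ++ l')) μ
      (fun gs q hgs => by rw [add_assoc, ← List.length_append, hμ _ hgs])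
      (fun gs g q q' hgs => by
        rw [add_assoc, ← List.length_append, hprover _ _ _ (by simp; omega),
          List.append_assoc]) q
    simpa using this
  simp only [interSchedule, List.map_append, List.map_replicate, game_append,
    List.length_replicate, PMF.map_bind]
  have h0 := hs m q [] (by simp; omega)
  simp only [List.length_nil, add_zero, List.nil_append] at h0
  rw [h0, PMF.bind_map, inter]
  congr 1; ext1 ⟨w, q₁⟩
  simp only [Function.comp_apply]
  have h1 := hp m (fun _ => (PMF.uniformOfFintype C).map e) q₁ (List.ofFn w) (by simp; omega)
    (fun gs hgs => by
      rw [hlaw _ (by simp; omega), interLaw_challenge]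
      simpa using hgs)
  rw [List.length_ofFn] at h1
  rw [h1, blockLaw_uniform, PMF.bind_map, PMF.bind_bind]
  congr 1; ext1 κ
  rw [Function.comp_apply, PMF.bind_map]
  congr 1; ext1 q₂
  rw [Function.comp_apply]
  have h2 := hp D (fun l => PMF.pure (cf w (e ∘ κ) l.length)) q₂ (List.ofFn w ++ List.ofFn (e ∘ κ))
    (by simp; omega)
    (fun gs hgs => by
      rw [hlaw _ (by simp; omega)]
      have : (List.ofFn w ++ List.ofFn (e ∘ κ) ++ gs).length = m + m + gs.length := by
        simp; omega
      rw [this, interLaw_commit _ _ _ _ _ _ _ hgs]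
      have e1 := slice_tape_append [] w (List.ofFn (e ∘ κ) ++ gs) 0 rfl
      have e2 := slice_tape_append (List.ofFn w) (e ∘ κ) gs m (by simp)
      rw [List.nil_append] at e1
      rw [List.append_assoc, e1, e2])
  rw [blockLaw_pure, PMF.pure_bind, List.length_append, List.length_ofFn, List.length_ofFn,
    ← add_assoc] at h2
  rw [h2, PMF.bind_map]
  congr 1; ext1 q₃
  rw [Function.comp_apply]
  set c : Fin D → Γ := fun k => cf w (e ∘ κ) k
  have h3 := hs (m + 2) q₃ (List.ofFn w ++ List.ofFn (e ∘ κ) ++ List.ofFn c) (by simp; omega)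
  simp only [List.length_append, List.length_ofFn, ← add_assoc] at h3
  rw [← add_assoc, h3, PMF.bind_map]
  congr 1; ext1 ⟨b, q₄⟩
  rw [Function.comp_apply]
  have h4 := hp (D + 1) (fun l => PMF.pure (uf w (e ∘ κ) b l.length)) q₄
    (List.ofFn w ++ List.ofFn (e ∘ κ) ++ List.ofFn c ++ List.ofFn b)
    (by simp; omega)
    (fun gs hgs => by
      rw [hlaw _ (by simp; omega)]
      have : (List.ofFn w ++ List.ofFn (e ∘ κ) ++ List.ofFn c ++ List.ofFn b ++ gs).length =
        m + m + D + (m + 2) + gs.length := by simp; omega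
      rw [this, interLaw_reply]
      have e1 := slice_tape_append [] w (List.ofFn (e ∘ κ) ++ (List.ofFn c ++ (List.ofFn b ++ gs)))
        0 rfl
      have e2 := slice_tape_append (List.ofFn w) (e ∘ κ) (List.ofFn c ++ (List.ofFn b ++ gs)) m
        (by simp)
      have e3 := slice_tape_append (List.ofFn w ++ (List.ofFn (e ∘ κ) ++ List.ofFn c)) b gs
        (m + m + D) (by simp; omega)
      simp only [List.append_assoc, List.nil_append] at e1 e2 e3 ⊢
      rw [e1, e2, e3])
  rw [blockLaw_pure, PMF.pure_bind] at h4
  simp only [List.length_append, List.length_ofFn, ← add_assoc] at h4 ⊢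
  rw [h4, PMF.map_comp]
  exact PMF.map_id _

end interactive

end Streaming

namespace Streaming

/-! ### Low-degree extensions -/

section lde

open Polynomial

variable {F : Type u} [Field F] {m d : ℕ}

/-- The polynomial on `F ^ m` that is `1` at the grid point `κ` and `0` at the others. -/
def lag (node : Fin d ↪ F) (κ : Fin m → Fin d) (a : Fin m → F) : F :=
  ∏ i, (Lagrange.basis Finset.univ node (κ i)).eval (a i)

/-- Restriction of `lag` to the line `a + X b`. -/
def lagLine (node : Fin d ↪ F) (κ : Fin m → Fin d) (a b : Fin m → F) : F[X] :=
  ∏ i, (Lagrange.basis Finset.univ node (κ i)).comp (C (a i) + X * C (b i))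

theorem lag_node (node : Fin d ↪ F) (κ κ' : Fin m → Fin d) :
    lag node κ (node ∘ κ') = if κ = κ' then 1 else 0 := by
  split_ifs with h
  · subst h
    exact Finset.prod_eq_one fun i _ =>
      Lagrange.eval_basis_self node.injective.injOn (Finset.mem_univ _)
  · obtain ⟨i, hi⟩ := Function.ne_iff.1 h
    exact Finset.prod_eq_zero (Finset.mem_univ i)
      (Lagrange.eval_basis_of_ne hi (Finset.mem_univ _))

theorem eval_lagLine (node : Fin d ↪ F) (κ : Fin m → Fin d) (a b : Fin m → F) (t : F) :
    (lagLine node κ a b).eval t = lag node κ (a + t • b) := by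
  simp only [lagLine, lag, eval_prod, eval_comp, eval_add, eval_mul, eval_C, eval_X, Pi.add_apply,
    Pi.smul_apply, smul_eq_mul]

theorem natDegree_lagLine (node : Fin d ↪ F) (κ : Fin m → Fin d) (a b : Fin m → F) :
    (lagLine node κ a b).natDegree ≤ m * d := by
  refine (natDegree_prod_le _ _).trans ?_
  calc _ ≤ ∑ _i : Fin m, d := Finset.sum_le_sum fun i _ => ?_
    _ = m * d := by simp
  rw [natDegree_comp]
  have h1 : (Lagrange.basis Finset.univ node (κ i)).natDegree ≤ d := by
    refine natDegree_le_of_degree_le ?_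
    rw [Lagrange.degree_basis node.injective.injOn (Finset.mem_univ _)]
    simp
  have h2 : (C (a i) + X * C (b i)).natDegree ≤ 1 := by compute_degree
  calc _ ≤ d * 1 := Nat.mul_le_mul h1 h2
    _ = d := mul_one d

variable {ι : Type*} [Fintype ι]

/-- The low-degree extension of the values `v` at the grid points `pts`. -/
def lde (node : Fin d ↪ F) (pts : ι → Fin m → Fin d) (v : ι → F) (a : Fin m → F) : F :=
  ∑ i, v i * lag node (pts i) a

/-- Restriction of a low-degree extension to the line `a + X b`. -/
def ldeLine (node : Fin d ↪ F) (pts : ι → Fin m → Fin d) (v : ι → F) (a b : Fin m → F) : F[X] :=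
  ∑ i, C (v i) * lagLine node (pts i) a b

theorem lde_node (node : Fin d ↪ F) {pts : ι → Fin m → Fin d} (h : pts.Injective) (v : ι → F)
    (i : ι) : lde node pts v (node ∘ pts i) = v i := by
  classical
  simp [lde, lag_node, h.eq_iff]

theorem eval_ldeLine (node : Fin d ↪ F) (pts : ι → Fin m → Fin d) (v : ι → F) (a b : Fin m → F)
    (t : F) : (ldeLine node pts v a b).eval t = lde node pts v (a + t • b) := by
  simp [ldeLine, lde, eval_finsetSum, eval_lagLine]

theorem natDegree_ldeLine (node : Fin d ↪ F) (pts : ι → Fin m → Fin d) (v : ι → F)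
    (a b : Fin m → F) : (ldeLine node pts v a b).natDegree ≤ m * d :=
  natDegree_sum_le_of_forall_le _ _ fun _ _ =>
    (natDegree_C_mul_le _ _).trans (natDegree_lagLine _ _ _ _)

theorem eval_eq_coeff_sum {D : ℕ} {p : F[X]} (h : p.natDegree ≤ D) (t : F) :
    p.eval t = ∑ k : Fin (D + 1), p.coeff k * t ^ (k : ℕ) := by
  rw [eval_eq_sum_range' (Nat.lt_succ_of_le h), Finset.sum_range]

theorem eval_eq_coeff_zero_add {D : ℕ} {p : F[X]} (h : p.natDegree ≤ D) (t : F) :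
    p.eval t = p.coeff 0 + ∑ k : Fin D, p.coeff (k + 1) * t ^ ((k : ℕ) + 1) := by
  rw [eval_eq_coeff_sum h, Fin.sum_univ_succ]
  simp

end lde

/-! ### Exponential moments -/

section moments

open Real

/-- Convexity of the exponential gives `X ≤ exp X / M + log M - 1`. The weight `p ≤ 1` is dropped
from the exponential term, which amounts to a union bound over `a`; in the applications `log M`
therefore contains `log |A|`, the size of the memory. -/
theorem sum_mul_le_log {Ω A : Type*} [Fintype Ω] [Fintype A] (p : Ω → A → ℝ)
    (hp : ∀ ω a, 0 ≤ p ω a) (hp1 : ∀ ω, ∑ a, p ω a = 1) (X : A → Ω → ℝ) {M : ℝ} (hM : 0 < M)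
    (hX : ∑ a, ∑ ω, exp (X a ω) ≤ M * Fintype.card Ω) :
    ∑ ω, ∑ a, p ω a * X a ω ≤ Fintype.card Ω * log M := by
  have h1 : ∀ ω a, p ω a * X a ω ≤ exp (X a ω) / M + p ω a * (log M - 1) := by
    intro ω a
    have hle : p ω a ≤ 1 := hp1 ω ▸ Finset.single_le_sum (fun a _ => hp ω a) (Finset.mem_univ a)
    have h2 : X a ω ≤ exp (X a ω) / M + (log M - 1) := by
      have := add_one_le_exp (X a ω - log M)
      rw [exp_sub, exp_log hM] at this
      linarith
    have h3 : 0 ≤ exp (X a ω) / M := by positivity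
    calc p ω a * X a ω ≤ p ω a * (exp (X a ω) / M + (log M - 1)) :=
          mul_le_mul_of_nonneg_left h2 (hp ω a)
      _ = p ω a * (exp (X a ω) / M) + p ω a * (log M - 1) := mul_add _ _ _
      _ ≤ _ := by
        have := mul_le_mul_of_nonneg_right hle h3
        linarith
  calc ∑ ω, ∑ a, p ω a * X a ω
      ≤ ∑ ω, ∑ a, (exp (X a ω) / M + p ω a * (log M - 1)) :=
        Finset.sum_le_sum fun ω _ => Finset.sum_le_sum fun a _ => h1 ω a
    _ = (∑ a, ∑ ω, exp (X a ω)) / M + Fintype.card Ω * (log M - 1) := by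
      simp only [Finset.sum_add_distrib, ← Finset.sum_mul, hp1, ← Finset.sum_div]
      rw [Finset.sum_comm]
      simp
    _ ≤ Fintype.card Ω + Fintype.card Ω * (log M - 1) := by
      gcongr
      rw [div_le_iff₀ hM, mul_comm]
      exact hX
    _ = _ := by ring

theorem exp_le_one_add_sq {x : ℝ} (h : |x| ≤ 1) : exp x ≤ 1 + x + x ^ 2 := by
  have := abs_le.1 (abs_exp_sub_one_sub_id_le h)
  linarith [this.2]

/-- The differences `u (b + 1) - u b` sum to zero because `b ↦ b + 1` is a permutation; the
first-order term vanishes and only `t ^ 2` remains. -/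
theorem sum_exp_mul_sub_le {F : Type*} [Field F] [Fintype F] (u : F → ℝ)
    (h0 : ∀ b, 0 ≤ u b) (h1 : ∀ b, u b ≤ 1) {t : ℝ} (ht : 0 ≤ t) (ht1 : t ≤ 1) :
    ∑ b, exp (t * (u (b + 1) - u b)) ≤ Fintype.card F * exp (t ^ 2) := by
  have hsum : ∑ b : F, (u (b + 1) - u b) = 0 := by
    rw [Finset.sum_sub_distrib, sub_eq_zero]
    exact Fintype.sum_equiv (Equiv.addRight 1) _ _ fun b => rfl
  have hb : ∀ b, |u (b + 1) - u b| ≤ 1 := fun b => by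
    rw [abs_le]
    constructor <;> linarith [h0 b, h1 b, h0 (b + 1), h1 (b + 1)]
  calc ∑ b, exp (t * (u (b + 1) - u b))
      ≤ ∑ b, (1 + t * (u (b + 1) - u b) + t ^ 2) := by
        refine Finset.sum_le_sum fun b _ => (exp_le_one_add_sq ?_).trans ?_
        · rw [abs_mul, abs_of_nonneg ht]
          exact mul_le_one₀ ht1 (abs_nonneg _) (hb b)
        · rw [mul_pow]
          have : (u (b + 1) - u b) ^ 2 ≤ 1 := by
            rw [sq_le_one_iff_abs_le_one]; exact hb b
          nlinarith [sq_nonneg t]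
    _ = Fintype.card F * (1 + t ^ 2) := by
      rw [Finset.sum_add_distrib, Finset.sum_add_distrib, ← Finset.mul_sum, hsum]
      simp; ring
    _ ≤ _ := by
      gcongr
      linarith [add_one_le_exp (t ^ 2)]

theorem sum_prod_eq_prod_sum {K B : Type*} [Fintype K] [DecidableEq K] [Fintype B]
    (f : K → B → ℝ) : ∑ β : K → B, ∏ k, f k (β k) = ∏ k, ∑ b, f k b := by
  rw [Finset.prod_univ_sum, Fintype.piFinset_univ]

/-- A state `a` of small memory cannot tell a random string `H` from the string that is shifted by
`f a` at a random position, not even when shown the symbol at that position. -/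
theorem hiding_bound_one_sided {F K V A : Type*} [Field F] [Fintype F] [Fintype K]
    [DecidableEq K] [AddCommGroup V]
    [Module F V] [Fintype V] [Fintype A] [Nonempty A] (p : (K → V) → A → ℝ)
    (hp : ∀ H a, 0 ≤ p H a) (hp1 : ∀ H, ∑ a, p H a = 1) (f : A → V)
    (φ : A → K → V → (K → V) → ℝ) (h0 : ∀ a k v H, 0 ≤ φ a k v H) (h1 : ∀ a k v H, φ a k v H ≤ 1)
    (hinv : ∀ a k v H (β : K → F), φ a k v (H + fun k => β k • f a) = φ a k v H)
    {t : ℝ} (ht : 0 < t) (ht1 : t ≤ 1) :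
    ∑ H, ∑ a, p H a * ∑ k, (φ a k (H k + f a) H - φ a k (H k) H) ≤
      Fintype.card (K → V) * ((log (Fintype.card A) + t ^ 2 * Fintype.card K) / t) := by
  set X : A → (K → V) → ℝ := fun a H => ∑ k, (φ a k (H k + f a) H - φ a k (H k) H) with hX
  -- For fixed `a` the sum over `H` is unchanged by the translations `k ↦ β k • f a`, so it may be
  -- averaged over `β`. By `hinv` the last argument of `φ` does not feel them; hence the exponential
  -- becomes a product over `k` of functions of the independent scalars `β k`.
  have hmgf : ∀ a, ∑ H, exp (t * X a H) ≤ exp (t ^ 2 * Fintype.card K) * Fintype.card (K → V) := by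
    intro a
    have hshift : ∀ β : K → F, ∑ H, exp (t * X a H) =
        ∑ H : K → V, exp (t * X a (H + fun k => β k • f a)) := fun β =>
      (Fintype.sum_equiv (Equiv.addRight fun k => β k • f a) _ _ fun H => rfl).symm
    have hcard : (0 : ℝ) < Fintype.card (K → F) := by exact_mod_cast Fintype.card_pos
    refine le_of_mul_le_mul_left ?_ hcard
    calc Fintype.card (K → F) * ∑ H, exp (t * X a H)
        = ∑ β : K → F, ∑ H : K → V, exp (t * X a (H + fun k => β k • f a)) := by
          rw [← Finset.sum_congr rfl fun β _ => hshift β]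
          simp
      _ = ∑ H : K → V, ∑ β : K → F, exp (t * X a (H + fun k => β k • f a)) := Finset.sum_comm
      _ ≤ ∑ _H : K → V, (Fintype.card (K → F) : ℝ) * exp (t ^ 2 * Fintype.card K) := by
        refine Finset.sum_le_sum fun H _ => ?_
        have e1 : ∀ β : K → F, exp (t * X a (H + fun k => β k • f a)) =
            ∏ k, exp (t * (φ a k (H k + (β k + 1) • f a) H - φ a k (H k + β k • f a) H)) := by
          intro β
          rw [← exp_sum, ← Finset.mul_sum]
          congr 2
          refine Finset.sum_congr rfl fun k _ => ?_
          rw [hinv, hinv, Pi.add_apply, add_smul, one_smul, add_assoc]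
        simp only [e1]
        rw [sum_prod_eq_prod_sum
          fun k b => exp (t * (φ a k (H k + (b + 1) • f a) H - φ a k (H k + b • f a) H))]
        calc _ ≤ ∏ _k : K, (Fintype.card F * exp (t ^ 2)) := by
              refine Finset.prod_le_prod (fun k _ => by positivity) fun k _ => ?_
              exact sum_exp_mul_sub_le (fun b => φ a k (H k + b • f a) H) (fun b => h0 _ _ _ _)
                (fun b => h1 _ _ _ _) ht.le ht1
          _ = _ := by
            rw [Finset.prod_const, mul_pow, ← exp_nat_mul, Finset.card_univ]
            simp [mul_comm]
      _ = _ := by simp; ring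
  have hA : (0 : ℝ) < Fintype.card A := by exact_mod_cast Fintype.card_pos
  -- The factor `|A|` in `M` pays for the dependence of `a` on `H`.
  have key := sum_mul_le_log p hp hp1 (fun a H => t * X a H)
    (M := Fintype.card A * exp (t ^ 2 * Fintype.card K)) (by positivity) (by
      calc _ ≤ ∑ _a : A, exp (t ^ 2 * Fintype.card K) * Fintype.card (K → V) :=
            Finset.sum_le_sum fun a _ => hmgf a
        _ = _ := by simp; ring)
  rw [log_mul hA.ne' (exp_pos _).ne', log_exp] at key
  rw [← mul_div_assoc, le_div_iff₀ ht]
  calc _ = ∑ H, ∑ a, p H a * (t * X a H) := by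
        rw [Finset.sum_mul]
        refine Finset.sum_congr rfl fun H _ => ?_
        rw [Finset.sum_mul]
        exact Finset.sum_congr rfl fun a _ => by ring
    _ ≤ _ := key

theorem hiding_bound {F K V A : Type*} [Field F] [Fintype F] [Fintype K]
    [DecidableEq K] [AddCommGroup V]
    [Module F V] [Fintype V] [Fintype A] [Nonempty A] (p : (K → V) → A → ℝ)
    (hp : ∀ H a, 0 ≤ p H a) (hp1 : ∀ H, ∑ a, p H a = 1) (f : A → V)
    (φ : A → K → V → (K → V) → ℝ) (h0 : ∀ a k v H, 0 ≤ φ a k v H) (h1 : ∀ a k v H, φ a k v H ≤ 1)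
    (hinv : ∀ a k v H (β : K → F), φ a k v (H + fun k => β k • f a) = φ a k v H)
    {t : ℝ} (ht : 0 < t) (ht1 : t ≤ 1) :
    |∑ H, ∑ a, p H a * ∑ k, (φ a k (H k + f a) H - φ a k (H k) H)| ≤
      Fintype.card (K → V) * ((log (Fintype.card A) + t ^ 2 * Fintype.card K) / t) := by
  rw [abs_le']
  refine ⟨hiding_bound_one_sided p hp hp1 f φ h0 h1 hinv ht ht1, ?_⟩
  -- The hypotheses are symmetric under `φ ↦ 1 - φ`, which reverses the sign.
  have := hiding_bound_one_sided (F := F) p hp hp1 f (fun a k v H => 1 - φ a k v H)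
    (fun a k v H => by linarith [h1 a k v H]) (fun a k v H => by linarith [h0 a k v H])
    (fun a k v H β => by rw [hinv]) ht ht1
  refine le_trans (le_of_eq ?_) this
  rw [← Finset.sum_neg_distrib]
  refine Finset.sum_congr rfl fun H _ => ?_
  rw [← Finset.sum_neg_distrib]
  refine Finset.sum_congr rfl fun a _ => ?_
  rw [← mul_neg, ← Finset.sum_neg_distrib]
  congr 1
  exact Finset.sum_congr rfl fun k _ => by ring

open Classical in
/-- Number of correct predictions that a small memory makes about a random string. -/
theorem predictions_le {F R A : Type*} [DecidableEq R] [Fintype F] [Nonempty F] [Fintype R]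
    [Fintype A]
    [Nonempty A] (p : (R → F) → A → ℝ)
    (hp : ∀ y a, 0 ≤ p y a) (hp1 : ∀ y, ∑ a, p y a = 1) (v : A → R → F) (B : A → Finset R) {K : ℕ}
    (hB : ∀ a, (B a).card ≤ K) :
    (∑ y, ∑ a, p y a * ∑ r ∈ B a, if y r = v a r then 1 else 0) * log (Fintype.card F) ≤
      Fintype.card (R → F) * (log (Fintype.card A) + K * log 2) := by
  have hq : (0 : ℝ) < Fintype.card F := by exact_mod_cast Fintype.card_pos
  -- For fixed `a` the symbols of `y` are independent. A position of `B a` contributes the factor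
  -- `|F|` with probability `1 / |F|` and `1` otherwise, hence less than `2` on average.
  have hmgf : ∀ a, ∑ y : R → F, exp (log (Fintype.card F) * ∑ r ∈ B a, if y r = v a r then 1 else 0)
      ≤ 2 ^ K * Fintype.card (R → F) := by
    intro a
    have e1 : ∀ y : R → F, exp (log (Fintype.card F) * ∑ r ∈ B a, if y r = v a r then 1 else 0) =
        ∏ r, if r ∈ B a ∧ y r = v a r then (Fintype.card F : ℝ) else 1 := by
      intro y
      rw [Finset.mul_sum, exp_sum, ← Finset.prod_filter_mul_prod_filter_not Finset.univ (· ∈ B a)]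
      rw [Finset.prod_eq_one (s := Finset.univ.filter (· ∉ B a))]
      · rw [mul_one, Finset.filter_mem_eq_inter, Finset.univ_inter]
        refine Finset.prod_congr rfl fun r hr => ?_
        by_cases h : y r = v a r <;> simp [h, hr, exp_log hq]
      · intro r hr
        rw [if_neg]
        exact fun h => (Finset.mem_filter.1 hr).2 h.1
    simp only [e1]
    rw [sum_prod_eq_prod_sum
      fun r b => if r ∈ B a ∧ b = v a r then (Fintype.card F : ℝ) else 1]
    calc _ ≤ ∏ r : R, (if r ∈ B a then 2 else 1) * (Fintype.card F : ℝ) := by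
          refine Finset.prod_le_prod
            (fun r _ => Finset.sum_nonneg fun b _ => by split_ifs <;> positivity) fun r _ => ?_
          by_cases hr : r ∈ B a
          · simp only [hr, true_and, if_true]
            calc _ ≤ ∑ b, ((if b = v a r then (Fintype.card F : ℝ) else 0) + 1) :=
                  Finset.sum_le_sum fun b _ => by split_ifs <;> simp
              _ = _ := by simp [Finset.sum_add_distrib]; ring
          · simp [hr]
      _ = 2 ^ (B a).card * Fintype.card (R → F) := by
        rw [Finset.prod_mul_distrib, Finset.prod_ite_mem, Finset.univ_inter, Finset.prod_const]
        simp
      _ ≤ _ := by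
        gcongr
        · norm_num
        · exact hB a
  have hA : (0 : ℝ) < Fintype.card A := by exact_mod_cast Fintype.card_pos
  have key := sum_mul_le_log p hp hp1
    (fun a y => log (Fintype.card F) * ∑ r ∈ B a, if y r = v a r then 1 else 0)
    (M := Fintype.card A * 2 ^ K) (by positivity) (by
      calc _ ≤ ∑ _a : A, (2 : ℝ) ^ K * Fintype.card (R → F) :=
            Finset.sum_le_sum fun a _ => hmgf a
        _ = _ := by simp; ring)
  rw [log_mul hA.ne' (by positivity), log_pow] at key
  refine le_trans (le_of_eq ?_) key
  rw [Finset.sum_mul]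
  refine Finset.sum_congr rfl fun y _ => ?_
  rw [Finset.sum_mul]
  exact Finset.sum_congr rfl fun a _ => by ring

theorem exists_subset_range {R : Type*} [Nonempty R] {K : ℕ} (G : Finset R) (h : G.card ≤ K) :
    ∃ b : Fin K → R, ∀ r ∈ G, r ∈ Set.range b := by
  classical
  refine ⟨fun k => if h : (k : ℕ) < G.card then (G.equivFin.symm ⟨k, h⟩ : R) else
    Classical.arbitrary R, fun r hr => ⟨⟨G.equivFin ⟨r, hr⟩, by omega⟩, ?_⟩⟩
  simp

open Classical in
/-- For a small memory `a` of a random string `y` there are few positions at which `y` can be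
guessed with probability more than `ε`, except with small probability. -/
theorem exists_guess_cover {F R A : Type*} [DecidableEq R] [Fintype F] [Nonempty F] [Fintype R]
    [Nonempty R]
    [Fintype A] [Nonempty A] (p : (R → F) → A → ℝ)
    (hp : ∀ y a, 0 ≤ p y a) (hp1 : ∀ y, ∑ a, p y a = 1) {K : ℕ} (hK : 0 < K) {ε : ℝ} (hε : 0 < ε)
    (hq : 1 < Fintype.card F) :
    ∃ b : A → Fin K → R, ∀ κ : A → R × F → ℝ, (∀ a x, 0 ≤ κ a x) → (∀ a, ∑ x, κ a x = 1) →
      ∑ y, ∑ a, p y a * ∑ x, κ a x * (if y x.1 = x.2 ∧ x.1 ∉ Set.range (b a) then 1 else 0) ≤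
        Fintype.card (R → F) * (ε + (log (Fintype.card A) + K * log 2) /
          (ε * K * log (Fintype.card F))) := by
  set w : A → ℝ := fun a => ∑ y, p y a with hw
  set g : A → R → F → ℝ := fun a r v => ∑ y, p y a * if y r = v then 1 else 0 with hg
  -- The positions at which some value has conditional probability more than `ε` given `a`. If there
  -- are at most `K`, then `b a` covers them; otherwise `a` is exceptional.
  set G : A → Finset R := fun a => Finset.univ.filter fun r => ∃ v, ε * w a < g a r v with hG
  have hw0 : ∀ a, 0 ≤ w a := fun a => Finset.sum_nonneg fun y _ => hp y a
  have hv : ∀ a r, ∃ v, r ∈ G a → ε * w a < g a r v := fun a r => by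
    by_cases h : r ∈ G a
    · obtain ⟨v, hv⟩ := (Finset.mem_filter.1 h).2
      exact ⟨v, fun _ => hv⟩
    · exact ⟨Classical.arbitrary F, fun h' => absurd h' h⟩
  choose v hv using hv
  have hb : ∀ a, ∃ b : Fin K → R, (G a).card ≤ K → ∀ r ∈ G a, r ∈ Set.range b := fun a => by
    by_cases h : (G a).card ≤ K
    · obtain ⟨b, hb⟩ := exists_subset_range (G a) h
      exact ⟨b, fun _ => hb⟩
    · exact ⟨fun _ => Classical.arbitrary R, fun h' => absurd h' h⟩
  choose b hb using hb
  have hB : ∀ a, ∃ B ⊆ G a, B.card ≤ K ∧ (K < (G a).card → B.card = K) := fun a => by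
    by_cases h : K < (G a).card
    · obtain ⟨B, h1, h2⟩ := Finset.exists_subset_card_eq h.le
      exact ⟨B, h1, h2.le, fun _ => h2⟩
    · exact ⟨∅, by simp, by simp, fun h' => absurd h' h⟩
  choose B hBG hBK hB using hB
  -- Total weight of the exceptional states. Such a state yields `K` predictions, each correct with
  -- probability more than `ε`, which `predictions_le` allows only if the weight is small.
  set β : ℝ := ∑ a, if K < (G a).card then w a else 0 with hβ
  have hlog : 0 < log (Fintype.card F) := log_pos (by exact_mod_cast hq)
  have hKr : (0 : ℝ) < K := by exact_mod_cast hK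
  have hβle : β ≤ Fintype.card (R → F) * ((log (Fintype.card A) + K * log 2) /
      (ε * K * log (Fintype.card F))) := by
    have h1 := predictions_le p hp hp1 v B hBK
    have h2 : ε * K * β ≤ ∑ y, ∑ a, p y a * ∑ r ∈ B a, if y r = v a r then 1 else 0 := by
      rw [Finset.sum_comm, hβ, Finset.mul_sum]
      refine Finset.sum_le_sum fun a _ => ?_
      have e1 : ∑ y, p y a * (∑ r ∈ B a, if y r = v a r then (1 : ℝ) else 0) =
          ∑ r ∈ B a, g a r (v a r) := by
        simp only [Finset.mul_sum, hg]
        rw [Finset.sum_comm]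
      rw [e1]
      split_ifs with h
      · calc ε * K * w a = ∑ r ∈ B a, ε * w a := by
              rw [Finset.sum_const, hB a h, nsmul_eq_mul]; ring
          _ ≤ _ := Finset.sum_le_sum fun r hr => (hv a r (hBG a hr)).le
      · rw [mul_zero]
        exact Finset.sum_nonneg fun r _ => Finset.sum_nonneg fun y _ =>
          mul_nonneg (hp _ _) (by split_ifs <;> norm_num)
    rw [← mul_div_assoc, le_div_iff₀ (by positivity)]
    calc β * (ε * K * log (Fintype.card F)) = (ε * K * β) * log (Fintype.card F) := by ring
      _ ≤ _ := mul_le_mul_of_nonneg_right h2 hlog.le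
      _ ≤ _ := h1
  refine ⟨b, fun κ hκ hκ1 => ?_⟩
  have hgw : ∀ a r e, g a r e ≤ w a := fun a r e => Finset.sum_le_sum fun y _ =>
    mul_le_of_le_one_right (hp _ _) (by split_ifs <;> norm_num)
  have hterm : ∀ a, ∀ x : R × F, x.1 ∉ Set.range (b a) →
      g a x.1 x.2 ≤ ε * w a + if K < (G a).card then w a else 0 := by
    intro a x hx
    split_ifs with h
    · have := hgw a x.1 x.2
      have := mul_nonneg hε.le (hw0 a)
      linarith
    · rw [add_zero]
      by_contra! hlt
      exact hx (hb a (not_lt.1 h) x.1 (by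
        simp only [hG, Finset.mem_filter]
        exact ⟨Finset.mem_univ _, x.2, hlt⟩))
  calc ∑ y, ∑ a, p y a * ∑ x, κ a x * (if y x.1 = x.2 ∧ x.1 ∉ Set.range (b a) then 1 else 0)
      = ∑ a, ∑ x, κ a x * (if x.1 ∉ Set.range (b a) then g a x.1 x.2 else 0) := by
        rw [Finset.sum_comm]
        refine Finset.sum_congr rfl fun a _ => ?_
        simp only [Finset.mul_sum]
        rw [Finset.sum_comm]
        refine Finset.sum_congr rfl fun x _ => ?_
        by_cases hx : x.1 ∈ Set.range (b a)
        · simp [hx]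
        · simp only [hx, not_false_eq_true, and_true, if_true, hg, Finset.mul_sum]
          exact Finset.sum_congr rfl fun y _ => by ring
    _ ≤ ∑ a, ∑ x, κ a x * (ε * w a + if K < (G a).card then w a else 0) := by
        refine Finset.sum_le_sum fun a _ => Finset.sum_le_sum fun x _ =>
          mul_le_mul_of_nonneg_left ?_ (hκ a x)
        by_cases hx : x.1 ∈ Set.range (b a)
        · simp only [hx, not_true_eq_false, if_false]
          have := mul_nonneg hε.le (hw0 a)
          split_ifs
          · linarith [hw0 a]
          · linarith
        · simp only [hx, not_false_eq_true, if_true]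
          exact hterm a x hx
    _ = ε * ∑ a, w a + β := by
        simp only [← Finset.sum_mul, hκ1, one_mul, Finset.sum_add_distrib, ← Finset.mul_sum, hβ]
    _ = Fintype.card (R → F) * ε + β := by
        rw [hw, Finset.sum_comm]
        simp [hp1, mul_comm]
    _ ≤ _ := by rw [mul_add]; linarith

end moments

end Streaming

namespace Streaming

/-! ### The protocol -/

open Polynomial

/-- Parameters of the protocol: the string is arranged in a grid with `d ^ m` points, which is
embedded in `F ^ m`. -/
structure Params (F : Type u) (n : ℕ) where
  m : ℕ
  d : ℕ
  d_pos : 0 < d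
  node : Fin d ↪ F
  pts : Fin n ↪ (Fin m → Fin d)
  target : F

variable {F : Type u} [Field F] [Fintype F] {n : ℕ}

namespace Params

variable (p : Params F n)

instance : Nonempty (Fin p.d) := ⟨⟨0, p.d_pos⟩⟩

/-- Bound on the degrees of the polynomials. -/
abbrev deg : ℕ := p.m * p.d

/-- Points of `F ^ m`. -/
abbrev Point : Type u := Fin p.m → F

/-- Points of the grid. -/
abbrev Grid : Type := Fin p.m → Fin p.d

/-- Masks: a polynomial without constant coefficient for each point of the grid. -/
abbrev Mask : Type u := p.Grid → Fin p.deg → F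

/-- Number of symbols of the first part of the setup. -/
abbrev keyLen : ℕ := Fintype.card p.Point

/-- Number of symbols of the second part of the setup. -/
abbrev maskLen : ℕ := Fintype.card (p.Grid × Fin p.deg)

/-- Length of the setup, minus one. -/
abbrev len : ℕ := p.keyLen + p.maskLen - 1

theorem len_add_one : p.len + 1 = p.keyLen + p.maskLen :=
  Nat.sub_add_cancel (Nat.le_add_right_of_le Fintype.card_pos)

/-- The order of the symbols of the setup. -/
def setupEquiv : p.Point ⊕ (p.Grid × Fin p.deg) ≃ Fin (p.len + 1) :=
  ((Fintype.equivFin _).sumCongr (Fintype.equivFin _)).trans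
    (finSumFinEquiv.trans (finCongr p.len_add_one.symm))

/-- The keys in a setup. -/
def keyOf (t : Fin (p.len + 1) → F) : p.Point → F := fun r => t (p.setupEquiv (.inl r))

/-- The masks in a setup. -/
def maskOf (t : Fin (p.len + 1) → F) : p.Mask := fun κ l => t (p.setupEquiv (.inr (κ, l)))

/-- The symbols of the setup that carry the keys. -/
def keyList (y : p.Point → F) : List F :=
  List.ofFn fun k : Fin p.keyLen => y ((Fintype.equivFin _).symm k)

/-- The symbols of the setup that carry the masks. -/
def maskList (H : p.Mask) : List F :=
  List.ofFn fun k : Fin p.maskLen => Function.uncurry H ((Fintype.equivFin _).symm k)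

@[simp] theorem length_keyList (y : p.Point → F) : (p.keyList y).length = p.keyLen := by
  simp [keyList]

@[simp] theorem length_maskList (H : p.Mask) : (p.maskList H).length = p.maskLen := by
  simp [maskList]

theorem ofFn_setup (t : Fin (p.len + 1) → F) :
    List.ofFn t = p.keyList (p.keyOf t) ++ p.maskList (p.maskOf t) := by
  apply List.ext_getElem
  · simp [p.len_add_one]
  · intro k h1 h2
    rw [List.getElem_append]
    split_ifs with h
    · simp only [List.getElem_ofFn]
      simp [keyList, keyOf, setupEquiv]
    · have h' : Fintype.card F ^ p.m ≤ k := by simpa using h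
      simp only [List.getElem_ofFn, maskList, maskOf, setupEquiv, Function.uncurry]
      congr 1
      ext
      simp
      omega

/-- Pairs of keys and masks, and setups. -/
def tablesEquiv : (Fin (p.len + 1) → F) ≃ (p.Point → F) × p.Mask :=
  (Equiv.arrowCongr p.setupEquiv.symm (Equiv.refl F)).trans
    ((Equiv.sumArrowEquivProdArrow _ _ _).trans
      ((Equiv.refl _).prodCongr (Equiv.curry _ _ _)))

theorem tablesEquiv_apply (t : Fin (p.len + 1) → F) :
    p.tablesEquiv t = (p.keyOf t, p.maskOf t) := rfl

/-- The commitment of the prover to the coefficients of a polynomial, at the point `k`. -/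
def commit (g : p.Point → F[X]) (H : p.Mask) (w k : p.Point) (i : ℕ) : F :=
  (g w).coeff (i + 1) +
    ∑ κ, ∑ l : Fin p.deg, H κ l * if (l : ℕ) = i then lag p.node κ k else 0

open Classical in
/-- The reply of the prover to the message `b`, if the verifier knows the key. -/
def reply (ok : p.Point → F → Prop) (H : p.Mask) (a : p.Point) (w k : p.Point)
    (b : Fin (p.m + 2) → F) (i : ℕ) : F :=
  if ok (a + b 0 • w) (b 1) then
    ∑ κ, ∑ l : Fin p.deg, H κ l *
      (b 0 ^ ((l : ℕ) + 1) * (lagLine p.node κ k fun i => b i.succ.succ).coeff i)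
  else 0

/-- The schedule of the protocol. -/
def schedule : Schedule where
  setup := p.len + 1
  interactive := interSchedule p.m p.deg

/-- The number of messages in the interactive stage. -/
abbrev interLen : ℕ := p.m + p.m + p.deg + (p.m + 2) + (p.deg + 1)

/-- A point of the grid, as a point of `F ^ m`. -/
def point (j : Fin n) : p.Point := p.node ∘ p.pts j

/-- The low-degree extension of a string, on lines through `a`. -/
def line (x : Fin n → F) (a w : p.Point) : F[X] := ldeLine p.node p.pts x a w

/-- The symbol of an event. -/
def symbol : Event F (IndexSymbol F n) → IndexSymbol F n
  | .prover g => .inl g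
  | .input a => a
  | .verifier g => .inl g

/-- The value of a symbol. -/
def value : IndexSymbol F n → F := Sum.elim id 0

/-- The point announced in a symbol. -/
def pointOf : Option (IndexSymbol F n) → p.Point
  | some (.inr j) => p.point j
  | _ => 0

/-- Law of the prover's next symbol, given the symbols so far. -/
def proverLaw (l : List (IndexSymbol F n)) : PMF F :=
  let τ := tape (l.map value)
  let t : Fin (p.len + 1) → F := fun k => τ k
  let a := p.pointOf (l[p.len + 1 + n]?)
  if l.length < p.len + 1 then PMF.uniformOfFintype F
  else interLaw p.m p.deg p.node
    (p.commit (p.line (fun i => τ (p.len + 1 + i)) a) (p.maskOf t))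
    (p.reply (fun r e => e = p.keyOf t r) (p.maskOf t) a)
    (l.length - (p.len + 1 + (n + 1))) (fun k => τ (p.len + 1 + (n + 1) + k))

/-- The honest prover. -/
def prover : Prover F (IndexSymbol F n) := fun h => p.proverLaw (h.map symbol)

/-- A strategy whose state is the list of all symbols so far. -/
def symbolStrategy {Q : Type} (law : List (IndexSymbol F n) → PMF F) :
    Strategy F (IndexSymbol F n) Q (List (IndexSymbol F n)) where
  law _ l := law l
  upd _ _ l e := l ++ [symbol e]

omit [Field F] [Fintype F] in
-- The schedule already determines who sent which symbol, so the history may be replaced by the bare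
-- list of symbols.
theorem game_symbolStrategy {Q : Type} (law : List (IndexSymbol F n) → PMF F)
    (P : Prover F (IndexSymbol F n)) (hP : ∀ h, P h = law (h.map symbol))
    (B : Player F (IndexSymbol F n) Q) (l : List (Slot (IndexSymbol F n))) (i : ℕ) (q : Q)
    (h : List (Event F (IndexSymbol F n))) :
    (game B (proverStrategy P) i q h l).map (fun o => o.1) =
      (game B (symbolStrategy law) i q (h.map symbol) l).map fun o => o.1 := by
  induction l generalizing i q h with
  | nil => simp [game, PMF.pure_map]
  | cons b l ih =>
    cases b <;>
      simp only [game, proverStrategy_law, proverStrategy_upd, PMF.map_bind, ih, List.map_append,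
        List.map_cons, List.map_nil, hP] <;> rfl

omit [Fintype F] in
theorem tape_append_left (l l' : List F) (k : ℕ) (h : k < l.length) :
    tape (l ++ l') k = tape l k := by
  simp [tape, List.getD_eq_getElem?_getD, List.getElem?_append, h]

omit [Fintype F] in
theorem tape_append_right (l l' : List F) (k a : ℕ) (h : a = l.length) :
    tape (l ++ l') (a + k) = tape l' k := by
  subst h
  simp [tape, List.getD_eq_getElem?_getD, List.getElem?_append]

omit [Fintype F] in
theorem tape_ofFn {N : ℕ} (t : Fin N → F) (k : Fin N) : tape (List.ofFn t) k = t k := by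
  simp [tape, List.getD_eq_getElem?_getD]

omit [Field F] [Fintype F] in
theorem length_indexStream (x : IndexInstance F n) : (indexStream F n x).length = n + 1 := by
  simp [indexStream]

theorem proverLaw_interactive (t : Fin (p.len + 1) → F) (x : IndexInstance F n) (gs : List F) :
    p.proverLaw ((List.ofFn t).map Sum.inl ++ indexStream F n x ++ gs.map Sum.inl) =
      interLaw p.m p.deg p.node
        (p.commit (p.line x.1 (p.point x.2)) (p.maskOf t))
        (p.reply (fun r e => e = p.keyOf t r) (p.maskOf t) (p.point x.2)) gs.length (tape gs) := by
  -- The announced coordinate occupies one cell of the tape, with value `0`; this is the extra cell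
  -- in the offset `n + 1`.
  have hmap : ((List.ofFn t).map Sum.inl ++ indexStream F n x ++ gs.map Sum.inl).map value =
      List.ofFn t ++ (List.ofFn x.1 ++ ([0] ++ gs)) := by
    simp [indexStream, value, Function.comp_def]
  have h1 : (fun k : Fin (p.len + 1) =>
      tape (List.ofFn t ++ (List.ofFn x.1 ++ ([0] ++ gs))) k) = t := by
    ext k
    rw [tape_append_left _ _ _ (by simpa using k.2), tape_ofFn]
  have h2 : (fun i : Fin n =>
      tape (List.ofFn t ++ (List.ofFn x.1 ++ ([0] ++ gs))) (p.len + 1 + i)) = x.1 := by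
    ext k
    rw [tape_append_right _ _ _ _ (by simp), tape_append_left _ _ _ (by simp), tape_ofFn]
  have h3 : (fun k => tape (List.ofFn t ++ (List.ofFn x.1 ++ ([0] ++ gs)))
      (p.len + 1 + (n + 1) + k)) = tape gs := by
    ext k
    rw [add_assoc, tape_append_right _ _ _ _ (by simp), add_assoc,
      tape_append_right _ _ _ _ (by simp), tape_append_right _ _ _ _ (by simp)]
  have h4 : ((List.ofFn t).map Sum.inl ++ indexStream F n x ++ gs.map Sum.inl)[p.len + 1 + n]? =
      some (Sum.inr x.2) := by
    rw [List.append_assoc, List.getElem?_append_right (by simp), indexStream, List.append_assoc,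
      List.getElem?_append_right (by simp)]
    simp
  have h5 : ((List.ofFn t).map Sum.inl ++ indexStream F n x ++ gs.map Sum.inl).length =
      p.len + 1 + (n + 1) + gs.length := by
    simp [length_indexStream]; omega
  simp only [proverLaw, hmap, h1, h2, h3, h4, h5, pointOf]
  rw [if_neg (by omega)]
  simp

theorem schedule_slots {A : Type u} (xs : List A) :
    p.schedule.slots xs = List.replicate (p.len + 1) Slot.prover ++ xs.map Slot.input ++
      (interSchedule p.m p.deg).map fun
        | Party.prover => Slot.prover
        | Party.verifier => Slot.verifier := rfl

/-- The setup is a uniform string `t`, and apart from the challenge the honest prover is a function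
of `t` and of what it hears. The right-hand side is shaped so as to match `game_simSpec`. -/
theorem game_prover {Q : Type} (B : Player F (IndexSymbol F n) Q) (q : Q)
    (x : IndexInstance F n) :
    (game B (proverStrategy p.prover) 0 q [] (p.schedule.slots (indexStream F n x))).map
        (fun o => o.1) =
      (PMF.uniformOfFintype (Fin (p.len + 1) → F)).bind fun t =>
        (hears B 0 q (p.keyList (p.keyOf t))).bind fun q₁ =>
          (hears B p.keyLen q₁ (p.maskList (p.maskOf t))).bind fun q₂ =>
            (reads B (p.len + 1) q₂ (indexStream F n x)).bind fun q₃ =>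
              inter B p.m p.deg p.node
                (p.commit (p.line x.1 (p.point x.2)) (p.maskOf t))
                (p.reply (fun r e => e = p.keyOf t r) (p.maskOf t) (p.point x.2))
                (p.len + 1 + (n + 1)) q₃ := by
  have := game_symbolStrategy p.proverLaw p.prover (fun _ => rfl) B
    (p.schedule.slots (indexStream F n x)) 0 q []
  refine this.trans ?_
  rw [schedule_slots, game_append, game_append]
  have h1 := game_hear B (symbolStrategy p.proverLaw) (p.len + 1) 0
    (fun gs _ => gs.map Sum.inl) (fun _ => (PMF.uniformOfFintype F).map id)
    (fun gs q hgs => by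
      rw [PMF.map_id]
      simp only [symbolStrategy, proverLaw, List.length_map]
      rw [if_pos hgs])
    (fun gs g q q' _ => by simp [symbolStrategy, symbol]) q
  rw [List.map_nil] at h1 ⊢
  rw [h1, blockLaw_uniform]
  simp only [PMF.bind_map, PMF.map_bind, PMF.bind_bind, Function.comp_def, id]
  congr 1; ext1 t
  rw [p.ofFn_setup t, hears_append, PMF.bind_bind, ← p.ofFn_setup t, length_keyList, zero_add]
  congr 1; ext1 q₁
  congr 1; ext1 q₂
  have h2 := game_read B (symbolStrategy p.proverLaw) (indexStream F n x) (p.len + 1)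
    (fun as _ => (List.ofFn t).map Sum.inl ++ as)
    (fun l a q q' _ => by simp [symbolStrategy, symbol]) q₂
  rw [List.append_nil] at h2
  rw [List.length_replicate, zero_add, h2, PMF.bind_map]
  congr 1; ext1 q₃
  rw [Function.comp_apply]
  have h3 := game_inter B (symbolStrategy p.proverLaw) p.m p.deg p.node
    (p.commit (p.line x.1 (p.point x.2)) (p.maskOf t))
    (p.reply (fun r e => e = p.keyOf t r) (p.maskOf t) (p.point x.2)) (p.len + 1 + (n + 1))
    (fun gs => (List.ofFn t).map Sum.inl ++ indexStream F n x ++ gs.map Sum.inl)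
    (fun gs _ => by rw [← proverLaw_interactive]; rfl)
    (fun gs g q _ => by simp [symbolStrategy, symbol])
    (fun gs g q _ => by simp [symbolStrategy, symbol]) q₃
  rw [← h3]
  simp only [List.map_nil, List.append_nil, List.length_append, List.length_map,
    List.length_replicate, length_indexStream, zero_add]

end Params

end Streaming

namespace Streaming
open Polynomial
variable {F : Type u} [Field F] [Fintype F] {n : ℕ}
namespace Params
variable (p : Params F n) {s K : ℕ}

/-! ### The simulator -/

/-- State of the simulator: the memory of the verifier after the keys, the low-degree extension of
the input at `K` points, the point announced in the input, and the messages of the interactive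
stage. -/
abbrev SimMemory (s K : ℕ) : Type u :=
  Memory s × (Fin K → F) × p.Point × (Fin p.interLen → F)

open Classical in
/-- A polynomial that takes the value `target` at `0` and agrees with the values `z` at the points
`b` on the line `a + X w`. -/
def fakeLine (a : p.Point) (b : Fin K → p.Point) (z : Fin K → F) (w : p.Point) : F[X] :=
  -- The default `0` is never reached on instances of the language, by `fakeLine_spec`.
  if h : ∃ g : F[X], g.natDegree ≤ p.deg ∧ g.eval 0 = p.target ∧
      ∀ k ρ, a + ρ • w = b k → g.eval ρ = z k then h.choose else 0

/-- The messages, as a tape. -/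
def tapeOf (c : Fin p.interLen → F) : ℕ → F := fun k => if h : k < p.interLen then c ⟨k, h⟩ else 0

/-- The coefficient of a mask symbol in the prover's symbol at position `k` of the interactive
stage. -/
def maskCoeff (τ : ℕ → F) (k : ℕ) (κ : p.Grid) (l : Fin p.deg) : F :=
  if k < p.m + p.m + p.deg then
    if (l : ℕ) = k - (p.m + p.m) then lag p.node κ (slice τ p.m p.m) else 0
  else
    slice τ (p.m + p.m + p.deg) (p.m + 2) 0 ^ ((l : ℕ) + 1) *
      (lagLine p.node κ (slice τ p.m p.m) fun i =>
        slice τ (p.m + p.m + p.deg) (p.m + 2) i.succ.succ).coeff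
        (k - (p.m + p.m + p.deg + (p.m + 2)))

open Classical in
/-- The simulator: it answers like the prover, but knows the low-degree extension of the input only
at the points `b`, which depend on the memory of the verifier after the keys. -/
abbrev simSpec (b : Memory s → Fin K → p.Point) (m₀ : Memory s) :
    SimSpec F (IndexSymbol F n) s (p.SimMemory s K) (F × F) where
  len := p.len
  init := (m₀, 0, 0, 0)
  contrib i x k g :=
    -- In the setup the sweep over `t` just fetches the symbol to be sent. Later its two components
    -- collect the key at the point that the verifier claims to hold, and the masks' share of the
    -- prover's symbol.
    if i < p.len + 1 then (if (k : ℕ) = i then g else 0, 0)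
    else
      let τ := p.tapeOf x.2.2.2
      (if k = p.setupEquiv (.inl (x.2.2.1 +
            slice τ (p.m + p.m + p.deg) (p.m + 2) 0 • slice τ 0 p.m)) then g else 0,
        match p.setupEquiv.symm k with
        | .inl _ => 0
        | .inr c => g * p.maskCoeff τ (i - (p.len + 1 + (n + 1))) c.1 c.2)
  law i x acc :=
    if i < p.len + 1 then PMF.pure acc.1
    else
      let τ := p.tapeOf x.2.2.2
      let k := i - (p.len + 1 + (n + 1))
      if k < p.m + p.m then (PMF.uniformOfFintype (Fin p.d)).map p.node
      else if k < p.m + p.m + p.deg then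
        PMF.pure ((p.fakeLine x.2.2.1 (b x.1) x.2.1 (slice τ 0 p.m)).coeff
          (k - (p.m + p.m) + 1) + acc.2)
      else
        PMF.pure (if slice τ (p.m + p.m + p.deg) (p.m + 2) 1 = acc.1 ∧
            x.2.2.1 + slice τ (p.m + p.m + p.deg) (p.m + 2) 0 • slice τ 0 p.m ∈ Set.range (b x.1)
          then acc.2 else 0)
  upd i m' x e :=
    -- The verifier's memory is copied up to the last key and frozen from then on; it selects the
    -- points `b` before the input arrives.
    if i < p.keyLen then (m', x.2)
    else if i < p.len + 1 then x
    else if i < p.len + 1 + (n + 1) then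
      match e with
      | .input (.inl a) => (x.1, fun k => x.2.1 k +
          if h : i - (p.len + 1) < n then a * lag p.node (p.pts ⟨i - (p.len + 1), h⟩) (b x.1 k)
          else 0, x.2.2)
      | .input (.inr j) => (x.1, x.2.1, p.point j, x.2.2.2)
      | _ => x
    else
      (x.1, x.2.1, x.2.2.1, fun k =>
        if (k : ℕ) = i - (p.len + 1 + (n + 1)) then value (symbol e) else x.2.2.2 k)

theorem sum_setup {M : Type*} [AddCommMonoid M] (f : Fin (p.len + 1) → M) :
    ∑ k, f k = ∑ r, f (p.setupEquiv (.inl r)) + ∑ κ, ∑ l, f (p.setupEquiv (.inr (κ, l))) := by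
  rw [← Fintype.sum_equiv p.setupEquiv _ _ fun _ => rfl, Fintype.sum_sum_type]
  congr 1
  exact Fintype.sum_prod_type _

/-- The dependence of commitments and replies on the masks is linear, so one sweep with a single
accumulator evaluates each of them without storing the masks. -/
theorem simSpec_law_interactive (b : Memory s → Fin K → p.Point) (m₀ : Memory s)
    (t : Fin (p.len + 1) → F) (m : Memory s) (z : Fin K → F) (a : p.Point)
    (c : Fin p.interLen → F) (k : ℕ) :
    (p.simSpec b m₀).law (p.len + 1 + (n + 1) + k) (m, z, a, c)
        (∑ i, (p.simSpec b m₀).contrib (p.len + 1 + (n + 1) + k) (m, z, a, c) i (t i)) =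
      interLaw p.m p.deg p.node
        (p.commit (p.fakeLine a (b m) z) (p.maskOf t))
        (p.reply (fun r e => e = p.keyOf t r ∧ r ∈ Set.range (b m)) (p.maskOf t) a) k
        (p.tapeOf c) := by
  have h1 : ¬ p.len + 1 + (n + 1) + k < p.len + 1 := by omega
  have h2 : p.len + 1 + (n + 1) + k - (p.len + 1 + (n + 1)) = k := by omega
  set τ := p.tapeOf c with hτ
  have hc : ∀ i, (p.simSpec b m₀).contrib (p.len + 1 + (n + 1) + k) (m, z, a, c) i (t i) =
      (if i = p.setupEquiv (.inl (a +
          slice τ (p.m + p.m + p.deg) (p.m + 2) 0 • slice τ 0 p.m)) then t i else 0,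
        match p.setupEquiv.symm i with
        | .inl _ => (0 : F)
        | .inr c => t i * p.maskCoeff τ k c.1 c.2) := fun i => by
    simp only [if_neg h1, h2]; rfl
  have hacc : (∑ i, (p.simSpec b m₀).contrib (p.len + 1 + (n + 1) + k) (m, z, a, c) i (t i)) =
      (p.keyOf t (a + slice τ (p.m + p.m + p.deg) (p.m + 2) 0 • slice τ 0 p.m),
        ∑ κ, ∑ l, p.maskOf t κ l * p.maskCoeff τ k κ l) := by
    rw [Finset.sum_congr rfl fun i _ => hc i]
    refine Prod.ext ?_ ?_
    · rw [Prod.fst_sum, Finset.sum_ite_eq' Finset.univ]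
      simp [keyOf]
    · rw [Prod.snd_sum]
      refine (sum_setup p _).trans ?_
      simp [maskOf]
  rw [hacc]
  simp only [if_neg h1, h2, interLaw, ← hτ]
  split_ifs with hk hk' h
  · rfl
  · simp only [commit, maskCoeff, if_pos hk']
  · simp only [reply, maskCoeff, if_neg hk']
    rw [if_pos h]
  · simp only [reply]
    rw [if_neg h]

theorem tapeOf_tape (gs : List F) (h : gs.length ≤ p.interLen) :
    p.tapeOf (fun k => tape gs k) = tape gs := by
  ext k
  rw [tapeOf]
  split_ifs with hk
  · rfl
  · simp [tape, List.getD_eq_getElem?_getD, List.getElem?_eq_none (by omega : gs.length ≤ k)]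

theorem tape_concat (gs : List F) (g : F) (k : ℕ) :
    tape (gs ++ [g]) k = if k = gs.length then g else tape gs k := by
  simp only [tape, List.getD_eq_getElem?_getD]
  rcases lt_trichotomy k gs.length with h | h | h
  · rw [List.getElem?_append_left h, if_neg h.ne]
  · subst h; simp
  · rw [if_neg h.ne', List.getElem?_eq_none (by simp; omega), List.getElem?_eq_none h.le]

/-- The point announced in a list of symbols. -/
def announced (l : List (IndexSymbol F n)) : p.Point :=
  l.foldl (fun a c => Sum.elim (fun _ => a) p.point c) 0

/-- The low-degree extension at `a` of the values in a list of symbols. -/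
def listLde (l : List (IndexSymbol F n)) (a : p.Point) : F :=
  lde p.node p.pts (fun i => tape (l.map value) i) a

theorem listLde_concat_inl (l : List (IndexSymbol F n)) (c : F) (a : p.Point) :
    p.listLde (l ++ [.inl c]) a = p.listLde l a +
      if h : l.length < n then c * lag p.node (p.pts ⟨l.length, h⟩) a else 0 := by
  have h0 : tape (l.map value) l.length = 0 := by
    simp [tape, List.getD_eq_getElem?_getD]
  have h1 : ∀ i : ℕ, tape ((l ++ [(Sum.inl c : IndexSymbol F n)]).map value) i =
      tape (l.map value) i + if i = l.length then c else 0 := fun i => by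
    rw [List.map_append, List.map_singleton, tape_concat, List.length_map]
    split_ifs with h
    · rw [h, h0, zero_add]; rfl
    · rw [add_zero]
  simp only [listLde, lde, h1, add_mul, Finset.sum_add_distrib]
  congr 1
  split_ifs with h
  · rw [Finset.sum_eq_single ⟨l.length, h⟩]
    · simp
    · intro i _ hi
      rw [if_neg fun h' => hi (Fin.ext h'), zero_mul]
    · exact fun h => absurd (Finset.mem_univ _) h
  · refine Finset.sum_eq_zero fun i _ => ?_
    rw [if_neg (by omega), zero_mul]

theorem listLde_concat_inr (l : List (IndexSymbol F n)) (j : Fin n) (a : p.Point) :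
    p.listLde (l ++ [.inr j]) a = p.listLde l a := by
  simp only [listLde, lde]
  refine Finset.sum_congr rfl fun i _ => ?_
  congr 1
  rw [List.map_append, List.map_singleton, tape_concat]
  split_ifs with h
  · simp [tape, List.getD_eq_getElem?_getD, value, h]
  · rfl

theorem listLde_indexStream (x : IndexInstance F n) (a : p.Point) :
    p.listLde (indexStream F n x) a = lde p.node p.pts x.1 a := by
  rw [listLde]
  congr 1
  ext i
  rw [indexStream, List.map_append, tape_append_left _ _ _ (by simp), List.map_ofFn]
  exact tape_ofFn _ i

theorem announced_indexStream (x : IndexInstance F n) :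
    p.announced (indexStream F n x) = p.point x.2 := by
  simp [announced, indexStream, List.foldl_append]

theorem simSpec_law_setup (b : Memory s → Fin K → p.Point) (m₀ : Memory s)
    (t : Fin (p.len + 1) → F) (x : p.SimMemory s K) (i : ℕ) (hi : i < p.len + 1) :
    (p.simSpec b m₀).law i x (∑ k, (p.simSpec b m₀).contrib i x k (t k)) =
      PMF.pure (tape (List.ofFn t) i) := by
  have hc : ∀ k, (p.simSpec b m₀).contrib i x k (t k) = (if (k : ℕ) = i then t k else 0, 0) :=
    fun k => by simp only [if_pos hi]
  rw [Finset.sum_congr rfl fun k _ => hc k]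
  simp only [if_pos hi]
  congr 1
  rw [Prod.fst_sum, Finset.sum_eq_single ⟨i, hi⟩]
  · simpa using (tape_ofFn t ⟨i, hi⟩).symm
  · intro k _ hk
    rw [if_neg fun h => hk (Fin.ext h)]
  · exact fun h => absurd (Finset.mem_univ _) h

/-- The simulated execution differs from `game_prover` in two places only: the polynomial committed
to, and the extra condition for a reply. Both depend on the memory `q₁.1` after the keys. -/
theorem game_simSpec {s' : ℕ} (B : Player F (IndexSymbol F n) (Memory s × Memory s'))
    (b : Memory s → Fin K → p.Point) (q : Memory s × Memory s')
    (t : Fin (p.len + 1) → F) (x : IndexInstance F n) :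
    (game B ((p.simSpec b q.1).strategy t) 0 q (p.simSpec b q.1).init
        (p.schedule.slots (indexStream F n x))).map (fun o => o.1) =
      (hears B 0 q (p.keyList (p.keyOf t))).bind fun q₁ =>
        (hears B p.keyLen q₁ (p.maskList (p.maskOf t))).bind fun q₂ =>
          (reads B (p.len + 1) q₂ (indexStream F n x)).bind fun q₃ =>
            inter B p.m p.deg p.node
              (p.commit (p.fakeLine (p.point x.2) (b q₁.1) fun k =>
                lde p.node p.pts x.1 (b q₁.1 k)) (p.maskOf t))
              (p.reply (fun r e => e = p.keyOf t r ∧ r ∈ Set.range (b q₁.1)) (p.maskOf t)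
                (p.point x.2))
              (p.len + 1 + (n + 1)) q₃ := by
  have hlen := p.len_add_one
  have htape : List.ofFn (fun k : Fin p.keyLen => tape (List.ofFn t) k) =
      p.keyList (p.keyOf t) := by
    apply List.ext_getElem (by simp)
    intro k h1 h2
    rw [List.getElem_ofFn]
    refine (congrArg (fun l => tape l k) (p.ofFn_setup t)).trans ?_
    rw [tape_append_left _ _ _ h2]
    simp [tape, List.getD_eq_getElem?_getD, List.getElem?_eq_getElem h2]
  have htape' : List.ofFn (fun k : Fin p.maskLen => tape (List.ofFn t) (p.keyLen + k)) =
      p.maskList (p.maskOf t) := by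
    apply List.ext_getElem (by simp)
    intro k h1 h2
    rw [List.getElem_ofFn]
    refine (congrArg (fun l => tape l (p.keyLen + k)) (p.ofFn_setup t)).trans ?_
    rw [tape_append_right _ _ _ _ (by simp)]
    simp [tape, List.getD_eq_getElem?_getD, List.getElem?_eq_getElem h2]
  rw [schedule_slots, game_append, game_append, hlen, List.replicate_add, game_append]
  have h1 := game_hear B ((p.simSpec b q.1).strategy t) p.keyLen 0
    (fun _ q => (q.1, 0, 0, 0)) (fun gs => PMF.pure (tape (List.ofFn t) gs.length))
    (fun gs q hgs => by
      rw [zero_add]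
      exact p.simSpec_law_setup b _ t _ _ (by omega))
    (fun gs g q q' hgs => by
      simp only [SimSpec.strategy, simSpec, zero_add]
      rw [if_pos hgs]) q
  have hinit : (p.simSpec b q.1).init = (q.1, 0, 0, 0) := rfl
  rw [hinit, h1, blockLaw_pure, PMF.pure_bind, htape]
  simp only [PMF.bind_map, PMF.map_bind, PMF.bind_bind, Function.comp_def]
  congr 1; ext1 q₁
  have h2 := game_hear B ((p.simSpec b q.1).strategy t) p.maskLen p.keyLen
    (fun _ _ => (q₁.1, 0, 0, 0)) (fun gs => PMF.pure (tape (List.ofFn t) (p.keyLen + gs.length)))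
    (fun gs q hgs => p.simSpec_law_setup b _ t _ _ (by omega))
    (fun gs g q q' hgs => by
      simp only [SimSpec.strategy, simSpec]
      rw [if_neg (by omega), if_pos (by omega)]) q₁
  rw [List.length_replicate, zero_add, h2,
    blockLaw_pure (fun k => tape (List.ofFn t) (p.keyLen + k)), PMF.pure_bind, htape', PMF.bind_map]
  congr 1; ext1 q₂
  have h3 := game_read B ((p.simSpec b q.1).strategy t) (indexStream F n x)
    (p.keyLen + p.maskLen)
    (fun as _ => (q₁.1, (fun k => p.listLde as (b q₁.1 k)), p.announced as, 0))
    (fun l a q q' hl => by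
      rw [length_indexStream] at hl
      simp only [SimSpec.strategy, simSpec]
      rw [if_neg (by omega), if_neg (by omega), if_pos (by omega)]
      have : p.keyLen + p.maskLen + l.length - (p.len + 1) = l.length := by omega
      cases a with
      | inl c => simp only [this, listLde_concat_inl]; simp [announced]
      | inr j => simp only [listLde_concat_inr]; simp [announced]) q₂
  have hl0 : (fun k => p.listLde [] (b q₁.1 k)) = (0 : Fin K → F) := by
    ext k; simp [listLde, lde, tape]
  have ha0 : p.announced [] = 0 := rfl
  rw [hl0, ha0] at h3
  simp only [Function.comp_apply, List.length_append, List.length_replicate, zero_add]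
  rw [h3, PMF.bind_map]
  congr 1; ext1 q₃
  rw [Function.comp_apply, announced_indexStream]
  simp only [listLde_indexStream]
  have h4 := game_inter B ((p.simSpec b q.1).strategy t) p.m p.deg p.node
    (p.commit (p.fakeLine (p.point x.2) (b q₁.1) fun k =>
      lde p.node p.pts x.1 (b q₁.1 k)) (p.maskOf t))
    (p.reply (fun r e => e = p.keyOf t r ∧ r ∈ Set.range (b q₁.1)) (p.maskOf t) (p.point x.2))
    (p.len + 1 + (n + 1))
    (fun gs => (q₁.1, (fun k => lde p.node p.pts x.1 (b q₁.1 k)), p.point x.2,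
      fun k => tape gs k))
    (fun gs hgs => by
      have := p.simSpec_law_interactive b q.1 t q₁.1
        (fun k => lde p.node p.pts x.1 (b q₁.1 k)) (p.point x.2) (fun k => tape gs k) gs.length
      rw [p.tapeOf_tape gs hgs.le] at this
      exact this)
    (fun gs g q hgs => by
      simp only [SimSpec.strategy, simSpec]
      rw [if_neg (by omega), if_neg (by omega), if_neg (by omega)]
      simp [tape_concat, symbol, value])
    (fun gs g q hgs => by
      simp only [SimSpec.strategy, simSpec]
      rw [if_neg (by omega), if_neg (by omega), if_neg (by omega)]
      simp [tape_concat, symbol, value]) q₃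
  have hz : (fun k : Fin p.interLen => tape ([] : List F) k) = 0 := by
    ext k; simp [tape]
  rw [hz, hlen] at h4
  rw [← h4, List.length_map, length_indexStream]

end Params
end Streaming

namespace Streaming

/-! ### Finite expectations -/

section expectation

variable {α β : Type*} [Fintype α] [Fintype β]

/-- Expectation of a function on a finite type. -/
def ev (μ : PMF α) (f : α → ℝ) : ℝ := ∑ a, (μ a).toReal * f a

theorem sum_toReal (μ : PMF α) : ∑ a, (μ a).toReal = 1 := by
  rw [← ENNReal.toReal_sum fun a _ => μ.apply_ne_top a, ← tsum_fintype (L := .unconditional _),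
    μ.tsum_coe, ENNReal.toReal_one]

theorem ev_bind (μ : PMF α) (k : α → PMF β) (f : β → ℝ) :
    ev (μ.bind k) f = ev μ fun a => ev (k a) f := by
  simp only [ev, PMF.bind_apply, tsum_fintype, Finset.mul_sum]
  rw [Finset.sum_comm]
  refine Finset.sum_congr rfl fun b _ => ?_
  rw [ENNReal.toReal_sum fun a _ => ENNReal.mul_ne_top (μ.apply_ne_top a) ((k a).apply_ne_top b),
    Finset.sum_mul]
  refine Finset.sum_congr rfl fun a _ => ?_
  rw [ENNReal.toReal_mul, mul_assoc]

theorem ev_pure (a : α) (f : α → ℝ) : ev (PMF.pure a) f = f a := by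
  classical
  rw [ev, Finset.sum_eq_single a]
  · simp
  · intro b _ hb
    simp [PMF.pure_apply, hb]
  · simp

theorem ev_map (μ : PMF α) (g : α → β) (f : β → ℝ) : ev (μ.map g) f = ev μ fun a => f (g a) := by
  simp only [← PMF.bind_pure_comp, ev_bind, Function.comp_apply, ev_pure]

theorem ev_uniform [Nonempty α] (f : α → ℝ) :
    ev (PMF.uniformOfFintype α) f = (∑ a, f a) / Fintype.card α := by
  simp [ev, ← Finset.mul_sum, div_eq_inv_mul]

theorem ev_const (μ : PMF α) (c : ℝ) : ev μ (fun _ => c) = c := by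
  rw [ev, ← Finset.sum_mul, sum_toReal, one_mul]

theorem ev_mono (μ : PMF α) {f g : α → ℝ} (h : ∀ a, f a ≤ g a) : ev μ f ≤ ev μ g :=
  Finset.sum_le_sum fun a _ => mul_le_mul_of_nonneg_left (h a) ENNReal.toReal_nonneg

theorem ev_nonneg (μ : PMF α) {f : α → ℝ} (h : ∀ a, 0 ≤ f a) : 0 ≤ ev μ f :=
  Finset.sum_nonneg fun a _ => mul_nonneg ENNReal.toReal_nonneg (h a)

theorem ev_le_const (μ : PMF α) {f : α → ℝ} {c : ℝ} (h : ∀ a, f a ≤ c) : ev μ f ≤ c :=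
  (ev_mono μ h).trans_eq (ev_const μ c)

theorem abs_ev_sub_le (μ : PMF α) {f g h : α → ℝ} (H : ∀ a, |f a - g a| ≤ h a) :
    |ev μ f - ev μ g| ≤ ev μ h := by
  rw [ev, ev, ← Finset.sum_sub_distrib]
  refine (Finset.abs_sum_le_sum_abs _ _).trans (Finset.sum_le_sum fun a _ => ?_)
  rw [← mul_sub, abs_mul, abs_of_nonneg ENNReal.toReal_nonneg]
  exact mul_le_mul_of_nonneg_left (H a) ENNReal.toReal_nonneg

/-- Indicator of acceptance. -/
def indicator (φ : α → Bool) (a : α) : ℝ := if φ a then 1 else 0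

theorem indicator_nonneg (φ : α → Bool) (a : α) : 0 ≤ indicator φ a := by
  rw [indicator]; split_ifs <;> norm_num

theorem indicator_le_one (φ : α → Bool) (a : α) : indicator φ a ≤ 1 := by
  rw [indicator]; split_ifs <;> norm_num

theorem toReal_map_true (μ : PMF α) (φ : α → Bool) :
    ((μ.map φ) true).toReal = ev μ (indicator φ) := by
  rw [PMF.map_apply, tsum_fintype, ENNReal.toReal_sum]
  · refine Finset.sum_congr rfl fun a _ => ?_
    rw [indicator]
    by_cases h : φ a = true <;> simp [h, eq_comm]
  · intro a _
    split_ifs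
    exacts [μ.apply_ne_top a, ENNReal.zero_ne_top]

end expectation

open Polynomial

variable {F : Type u} [Field F] [Fintype F] {n : ℕ}

namespace Params

variable (p : Params F n) {s K : ℕ}

/-! ### Zero knowledge -/

/-- At a grid point the extension of the masks is the mask itself, so a commitment is a one-time pad
with pad `H κ`. -/
theorem commit_node (g : p.Point → F[X]) (H : p.Mask) (w : p.Point) (κ : p.Grid)
    (i : Fin p.deg) : p.commit g H w (p.node ∘ κ) i = (g w).coeff (i + 1) + H κ i := by
  rw [commit]
  congr 1
  simp only [lag_node, Fin.val_inj]
  rw [Finset.sum_eq_single κ, Finset.sum_eq_single i] <;> simp +contextual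

/-- A reply sees each mask only through its value at the parameter `b 0`, hence not at all the
multiples of a polynomial that vanishes there. -/
theorem reply_add_mask (ok : p.Point → F → Prop) (H : p.Mask) (a w k : p.Point)
    (b : Fin (p.m + 2) → F) (i : ℕ) (f : Fin p.deg → F) (β : p.Grid → F)
    (hf : ok (a + b 0 • w) (b 1) → ∑ l, f l * b 0 ^ ((l : ℕ) + 1) = 0) :
    p.reply ok (H + fun κ => β κ • f) a w k b i = p.reply ok H a w k b i := by
  rw [reply, reply]
  split_ifs with h
  · refine Finset.sum_congr rfl fun κ _ => ?_
    simp only [Pi.add_apply, Pi.smul_apply, smul_eq_mul, add_mul, Finset.sum_add_distrib]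
    rw [add_eq_left]
    have := hf h
    calc _ = β κ * (lagLine p.node κ k fun i => b i.succ.succ).coeff i *
          ∑ l, f l * b 0 ^ ((l : ℕ) + 1) := by
          rw [Finset.mul_sum]
          exact Finset.sum_congr rfl fun l _ => by ring
      _ = 0 := by rw [this, mul_zero]
  · rfl

theorem line_natDegree (x : Fin n → F) (a w : p.Point) : (p.line x a w).natDegree ≤ p.deg :=
  natDegree_ldeLine _ _ _ _ _

theorem line_eval (x : Fin n → F) (a w : p.Point) (t : F) :
    (p.line x a w).eval t = lde p.node p.pts x (a + t • w) := eval_ldeLine _ _ _ _ _ _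

theorem line_eval_zero (x : Fin n → F) (j : Fin n) (w : p.Point) :
    (p.line x (p.point j) w).eval 0 = x j := by
  rw [line_eval, zero_smul, add_zero, point, lde_node _ p.pts.injective]

/-- The true restriction of the low-degree extension is a witness, because its value at `0` is
`x_j`. -/
theorem fakeLine_spec (x : IndexInstance F n) (hx : x.1 x.2 = p.target) (b : Fin K → p.Point)
    (w : p.Point) :
    let g := p.fakeLine (p.point x.2) b (fun k => lde p.node p.pts x.1 (b k)) w
    g.natDegree ≤ p.deg ∧ g.eval 0 = p.target ∧
      ∀ k ρ, p.point x.2 + ρ • w = b k → g.eval ρ = lde p.node p.pts x.1 (b k) := by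
  have h : ∃ g : F[X], g.natDegree ≤ p.deg ∧ g.eval 0 = p.target ∧
      ∀ k ρ, p.point x.2 + ρ • w = b k → g.eval ρ = lde p.node p.pts x.1 (b k) :=
    ⟨p.line x.1 (p.point x.2) w, p.line_natDegree _ _ _, by rw [line_eval_zero, hx],
      fun k ρ h => by rw [line_eval, h]⟩
  simp only [fakeLine]
  rw [dif_pos h]
  exact h.choose_spec

variable {Q : Type} [Fintype Q]

/-- Expected outcome after the challenge of the prover has been drawn. -/
def finish (B : Player F (IndexSymbol F n) Q) (acc : Q → ℝ) (q : Q) (κ : p.Grid)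
    (c : Fin p.deg → F) (uf : (Fin (p.m + 2) → F) → ℕ → F) : ℝ :=
  let i := p.len + 1 + (n + 1)
  ev (hears B (i + p.m) q (List.ofFn (p.node ∘ κ))) fun q₁ =>
    ev (hears B (i + p.m + p.m) q₁ (List.ofFn c)) fun q₂ =>
      ev (sends B (i + p.m + p.m + p.deg) q₂ (p.m + 2)) fun o =>
        ev (hears B (i + p.m + p.m + p.deg + (p.m + 2)) o.2
          (List.ofFn fun k : Fin (p.deg + 1) => uf o.1 k)) acc

/-- Memory after the keys, and the first message and memory of the player. -/
def transcript (B : Player F (IndexSymbol F n) Q) {M : Type} (π : Q → M) (x : IndexInstance F n)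
    (q : Q) (y : p.Point → F) (H : p.Mask) : PMF (M × (p.Point × Q)) :=
  (hears B 0 q (p.keyList y)).bind fun q₁ =>
    (hears B p.keyLen q₁ (p.maskList H)).bind fun q₂ =>
      (reads B (p.len + 1) q₂ (indexStream F n x)).bind fun q₃ =>
        (sends B (p.len + 1 + (n + 1)) q₃ p.m).map fun o => (π q₁, o)

theorem ev_game [DecidableEq F] {M : Type} [Fintype M] (B : Player F (IndexSymbol F n) Q)
    (π : Q → M)
    (x : IndexInstance F n) (q : Q) (acc : Q → ℝ)
    (g : M → p.Point → F[X]) (ok : M → (p.Point → F) → p.Point → F → Prop) :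
    ev ((PMF.uniformOfFintype (Fin (p.len + 1) → F)).bind fun t =>
        (hears B 0 q (p.keyList (p.keyOf t))).bind fun q₁ =>
          (hears B p.keyLen q₁ (p.maskList (p.maskOf t))).bind fun q₂ =>
            (reads B (p.len + 1) q₂ (indexStream F n x)).bind fun q₃ =>
              inter B p.m p.deg p.node (p.commit (g (π q₁)) (p.maskOf t))
                (p.reply (ok (π q₁) (p.keyOf t)) (p.maskOf t) (p.point x.2))
                (p.len + 1 + (n + 1)) q₃) acc =
      (∑ y, (∑ H, ev (p.transcript B π x q y H) fun a =>
        ((∑ κ, p.finish B acc a.2.2 κ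
          (fun i => (g a.1 a.2.1).coeff (i + 1) + H κ i)
          (p.reply (ok a.1 y) H (p.point x.2) a.2.1 (p.node ∘ κ))) /
            Fintype.card p.Grid)) / Fintype.card p.Mask) / Fintype.card (p.Point → F) := by
  rw [ev_bind, ev_uniform]
  have hcard : (Fintype.card (Fin (p.len + 1) → F) : ℝ) =
      Fintype.card p.Mask * Fintype.card (p.Point → F) := by
    rw [Fintype.card_congr p.tablesEquiv, Fintype.card_prod]
    push_cast
    ring
  rw [hcard, ← Finset.sum_div, div_div, ← Fintype.sum_prod_type']
  congr 1
  refine Fintype.sum_equiv p.tablesEquiv _ _ fun t => ?_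
  rw [tablesEquiv_apply]
  simp only [transcript, inter, ev_bind, ev_map, ev_uniform, finish, commit_node]

/-- The random symbols and the message from which the verifier's key is read off. -/
def guess (B : Player F (IndexSymbol F n) Q) (x : IndexInstance F n) (g : p.Point → F[X])
    (H : p.Mask) (q : Q) : PMF (p.Point × F) :=
  let i := p.len + 1 + (n + 1)
  (hears B p.keyLen q (p.maskList H)).bind fun q₂ =>
    (reads B (p.len + 1) q₂ (indexStream F n x)).bind fun q₃ =>
      (sends B (p.len + 1 + (n + 1)) q₃ p.m).bind fun o =>
        (PMF.uniformOfFintype p.Grid).bind fun κ =>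
          (hears B (i + p.m) o.2 (List.ofFn (p.node ∘ κ))).bind fun q₄ =>
            (hears B (i + p.m + p.m) q₄
              (List.ofFn fun i : Fin p.deg => (g o.1).coeff (i + 1) + H κ i)).bind fun q₅ =>
              (sends B (i + p.m + p.m + p.deg) q₅ (p.m + 2)).map fun o' =>
                (p.point x.2 + o'.1 0 • o.1, o'.1 1)

/-- The claimed key is produced by the verifier alone. Therefore the memory of the distinguisher,
which may be much larger, does not enter the number of points at which keys can be guessed. -/
theorem guess_proj {Q' : Type} [Fintype Q'] (B : Player F (IndexSymbol F n) Q)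
    (B' : Player F (IndexSymbol F n) Q') (π : Q → Q')
    (h₁ : ∀ i q g, (B.hear i q g).map π = B'.hear i (π q) g)
    (h₂ : ∀ i q g, (B.read i q g).map π = B'.read i (π q) g)
    (h₃ : ∀ i q, (B.send i q).map (fun o => (o.1, π o.2)) = B'.send i (π q))
    (x : IndexInstance F n) (g : p.Point → F[X]) (H : p.Mask) (q : Q) :
    p.guess B x g H q = p.guess B' x g H (π q) := by
  rw [guess, guess]
  refine hears_bind_congr B B' π h₁ _ _ _ _ _ fun q => ?_
  refine reads_bind_congr B B' π h₂ _ _ _ _ _ fun q => ?_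
  refine sends_bind_congr B B' π h₃ _ _ _ _ _ fun w q => ?_
  refine congrArg _ (funext fun κ => ?_)
  refine hears_bind_congr B B' π h₁ _ _ _ _ _ fun q => ?_
  refine hears_bind_congr B B' π h₁ _ _ _ _ _ fun q => ?_
  rw [← PMF.bind_pure_comp, ← PMF.bind_pure_comp]
  exact sends_bind_congr B B' π h₃ _ _ _ _ _ fun b q => rfl

theorem finish_nonneg (B : Player F (IndexSymbol F n) Q) {acc : Q → ℝ} (h : ∀ q, 0 ≤ acc q)
    (q : Q) (κ : p.Grid) (c : Fin p.deg → F) (uf : (Fin (p.m + 2) → F) → ℕ → F) :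
    0 ≤ p.finish B acc q κ c uf :=
  ev_nonneg _ fun _ => ev_nonneg _ fun _ => ev_nonneg _ fun _ => ev_nonneg _ h

theorem finish_le_one (B : Player F (IndexSymbol F n) Q) {acc : Q → ℝ} (h : ∀ q, acc q ≤ 1)
    (q : Q) (κ : p.Grid) (c : Fin p.deg → F) (uf : (Fin (p.m + 2) → F) → ℕ → F) :
    p.finish B acc q κ c uf ≤ 1 :=
  ev_le_const _ fun _ => ev_le_const _ fun _ => ev_le_const _ fun _ => ev_le_const _ h

theorem abs_finish_sub_le (B : Player F (IndexSymbol F n) Q) {acc : Q → ℝ}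
    (h0 : ∀ q, 0 ≤ acc q) (h1 : ∀ q, acc q ≤ 1) (q : Q) (κ : p.Grid) (c : Fin p.deg → F)
    (uf uf' : (Fin (p.m + 2) → F) → ℕ → F) (bad : (Fin (p.m + 2) → F) → ℝ)
    (hbad : ∀ b, 0 ≤ bad b) (h : ∀ b, uf b = uf' b ∨ bad b = 1) :
    |p.finish B acc q κ c uf - p.finish B acc q κ c uf'| ≤
      ev (hears B (p.len + 1 + (n + 1) + p.m) q (List.ofFn (p.node ∘ κ))) fun q₁ =>
        ev (hears B (p.len + 1 + (n + 1) + p.m + p.m) q₁ (List.ofFn c)) fun q₂ =>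
          ev (sends B (p.len + 1 + (n + 1) + p.m + p.m + p.deg) q₂ (p.m + 2)) fun o =>
            bad o.1 := by
  refine abs_ev_sub_le _ fun q₁ => abs_ev_sub_le _ fun q₂ => abs_ev_sub_le _ fun o => ?_
  rcases h o.1 with h | h
  · rw [h, sub_self, abs_zero]
    exact hbad _
  · rw [h, abs_sub_le_iff]
    have a1 := ev_nonneg (hears B (p.len + 1 + (n + 1) + p.m + p.m + p.deg + (p.m + 2)) o.2
      (List.ofFn fun k : Fin (p.deg + 1) => uf o.1 k)) h0
    have a2 := ev_le_const (hears B (p.len + 1 + (n + 1) + p.m + p.m + p.deg + (p.m + 2)) o.2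
      (List.ofFn fun k : Fin (p.deg + 1) => uf o.1 k)) h1
    have a3 := ev_nonneg (hears B (p.len + 1 + (n + 1) + p.m + p.m + p.deg + (p.m + 2)) o.2
      (List.ofFn fun k : Fin (p.deg + 1) => uf' o.1 k)) h0
    have a4 := ev_le_const (hears B (p.len + 1 + (n + 1) + p.m + p.m + p.deg + (p.m + 2)) o.2
      (List.ofFn fun k : Fin (p.deg + 1) => uf' o.1 k)) h1
    constructor <;> linarith

/-- Expected outcome of the game, given the keys and the masks. -/
def outcome {M : Type} [Fintype M] (B : Player F (IndexSymbol F n) Q) (π : Q → M)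
    (x : IndexInstance F n) (q : Q) (acc : Q → ℝ)
    (g : M → p.Point → F[X]) (ok : M → p.Point → F → Prop) (y : p.Point → F) (H : p.Mask) : ℝ :=
  ev (p.transcript B π x q y H) fun a =>
    (∑ κ, p.finish B acc a.2.2 κ (fun i => (g a.1 a.2.1).coeff (i + 1) + H κ i)
      (p.reply (ok a.1) H (p.point x.2) a.2.1 (p.node ∘ κ))) / Fintype.card p.Grid

open Classical in
-- The two games coincide up to the second message of the verifier, and also after it unless the two
-- conditions disagree on the key that it contains.
theorem abs_outcome_sub_le_guess {M : Type} [Fintype M] (B : Player F (IndexSymbol F n) Q)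
    (π : Q → M) (x : IndexInstance F n) (q : Q) {acc : Q → ℝ}
    (h0 : ∀ q, 0 ≤ acc q) (h1 : ∀ q, acc q ≤ 1)
    (g : p.Point → F[X]) (ok ok' : M → p.Point → F → Prop) (y : p.Point → F) (H : p.Mask) :
    |p.outcome B π x q acc (fun _ => g) ok y H - p.outcome B π x q acc (fun _ => g) ok' y H| ≤
      ev (hears B 0 q (p.keyList y)) fun q₁ => ev (p.guess B x g H q₁) fun z =>
        if ok (π q₁) z.1 z.2 ↔ ok' (π q₁) z.1 z.2 then 0 else 1 := by
  simp only [outcome, transcript, guess, ev_bind, ev_map, ← ev_uniform]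
  refine abs_ev_sub_le _ fun q₁ => abs_ev_sub_le _ fun q₂ => abs_ev_sub_le _ fun q₃ =>
    abs_ev_sub_le _ fun o => abs_ev_sub_le _ fun κ => ?_
  refine p.abs_finish_sub_le B h0 h1 _ _ _ _ _ (fun b =>
    if ok (π q₁) (p.point x.2 + b 0 • o.1) (b 1) ↔ ok' (π q₁) (p.point x.2 + b 0 • o.1) (b 1)
      then 0 else 1)
    (fun b => by split_ifs <;> norm_num) fun b => ?_
  by_cases h : ok (π q₁) (p.point x.2 + b 0 • o.1) (b 1) ↔
    ok' (π q₁) (p.point x.2 + b 0 • o.1) (b 1)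
  · left
    ext i
    simp only [reply, h]
  · right
    rw [if_neg h]

/-- The game with the true line is the game with the fake one in which the pad at the challenge is
shifted by the difference `f a` of their coefficients. This difference is determined by `a`, which
is known before the challenge, and replies are blind to it; so `hiding_bound` applies with the grid
points as positions. -/
theorem abs_outcome_sub_le_hiding [DecidableEq F] (B : Player F (IndexSymbol F n) Q) {M : Type}
    [Fintype M] [Nonempty M] [Nonempty Q] (π : Q → M)
    (x : IndexInstance F n) (hx : x.1 x.2 = p.target) (q : Q) {acc : Q → ℝ}
    (h0 : ∀ q, 0 ≤ acc q) (h1 : ∀ q, acc q ≤ 1) (b : M → Fin K → p.Point)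
    (ok : M → p.Point → F → Prop) (hok : ∀ a r e, ok a r e → r ∈ Set.range (b a))
    (y : p.Point → F) {t : ℝ} (ht : 0 < t) (ht1 : t ≤ 1) :
    |∑ H, (p.outcome B π x q acc (fun _ => p.line x.1 (p.point x.2)) ok y H -
      p.outcome B π x q acc (fun a => p.fakeLine (p.point x.2) (b a)
        fun k => lde p.node p.pts x.1 (b a k)) ok y H)| ≤
      Fintype.card p.Mask *
        ((Real.log (Fintype.card (M × (p.Point × Q))) + t ^ 2 * Fintype.card p.Grid) /
          (t * Fintype.card p.Grid)) := by
  set g' : M → p.Point → F[X] := fun a => p.fakeLine (p.point x.2) (b a)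
    fun k => lde p.node p.pts x.1 (b a k) with hg'
  set f : M × (p.Point × Q) → Fin p.deg → F := fun a i =>
    (p.line x.1 (p.point x.2) a.2.1).coeff (i + 1) - (g' a.1 a.2.1).coeff (i + 1) with hf
  -- Both polynomials equal `target` at `0`, and by `hok` a reply is granted only where they agree;
  -- so the difference of their nonconstant parts vanishes at `ρ`.
  have hzero : ∀ a ρ e, ok a.1 (p.point x.2 + ρ • a.2.1) e →
      ∑ l, f a l * ρ ^ ((l : ℕ) + 1) = 0 := by
    intro a ρ e h
    obtain ⟨k, hk⟩ := hok _ _ _ h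
    obtain ⟨s1, s2, s3⟩ := p.fakeLine_spec x hx (b a.1) a.2.1
    have e1 := s3 k ρ hk.symm
    rw [hk, ← p.line_eval, eval_eq_coeff_zero_add (p.line_natDegree _ _ _),
      eval_eq_coeff_zero_add s1] at e1
    rw [← coeff_zero_eq_eval_zero] at s2
    have e2 := p.line_eval_zero x.1 x.2 a.2.1
    rw [hx, ← coeff_zero_eq_eval_zero] at e2
    rw [s2, e2] at e1
    simp only [hf, sub_mul, Finset.sum_sub_distrib]
    rw [← add_left_cancel e1]
    exact sub_self _
  have key := hiding_bound (F := F) (fun H a => (p.transcript B π x q y H a).toReal)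
    (fun H a => ENNReal.toReal_nonneg) (fun H => sum_toReal _) f
    (fun a κ v H => p.finish B acc a.2.2 κ (fun i => (g' a.1 a.2.1).coeff (i + 1) + v i)
      (p.reply (ok a.1) H (p.point x.2) a.2.1 (p.node ∘ κ)))
    (fun a κ v H => p.finish_nonneg B h0 _ _ _ _) (fun a κ v H => p.finish_le_one B h1 _ _ _ _)
    (fun a κ v H β => by
      congr 1
      ext b' i
      exact p.reply_add_mask _ _ _ _ _ _ _ _ _ fun h => hzero a _ _ h) ht ht1
  have hN : (0 : ℝ) < Fintype.card p.Grid := by exact_mod_cast Fintype.card_pos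
  have hterm : ∀ H, p.outcome B π x q acc (fun _ => p.line x.1 (p.point x.2)) ok y H -
      p.outcome B π x q acc g' ok y H =
      (∑ a, (p.transcript B π x q y H a).toReal * ∑ κ,
        (p.finish B acc a.2.2 κ (fun i => (g' a.1 a.2.1).coeff (i + 1) + (H κ + f a) i)
          (p.reply (ok a.1) H (p.point x.2) a.2.1 (p.node ∘ κ)) -
        p.finish B acc a.2.2 κ (fun i => (g' a.1 a.2.1).coeff (i + 1) + H κ i)
          (p.reply (ok a.1) H (p.point x.2) a.2.1 (p.node ∘ κ)))) / Fintype.card p.Grid := by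
    intro H
    rw [outcome, outcome, ev, ev, ← Finset.sum_sub_distrib, Finset.sum_div]
    refine Finset.sum_congr rfl fun a _ => ?_
    rw [← mul_sub, ← sub_div, ← Finset.sum_sub_distrib, mul_div_assoc]
    congr 2
    refine Finset.sum_congr rfl fun κ _ => ?_
    congr 2
    ext i
    simp only [Pi.add_apply, hf]
    ring
  rw [Finset.sum_congr rfl fun H _ => hterm H, ← Finset.sum_div, abs_div, abs_of_pos hN,
    div_le_iff₀ hN]
  refine key.trans (le_of_eq ?_)
  field_simp

/-- The points `b` are chosen before the distinguisher and the instance, since the simulator may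
depend on the verifier only. -/
theorem zero_knowledge [DecidableEq F] (V : Verifier F (IndexSymbol F n) s) (hK : 0 < K) {ε : ℝ}
    (hε : 0 < ε) :
    ∃ b : Memory s → Fin K → p.Point, ∀ (s' : ℕ) (D : Distinguisher F (IndexSymbol F n) s')
      (x : IndexInstance F n), x.1 x.2 = p.target → ∀ t : ℝ, 0 < t → t ≤ 1 →
      |ev ((PMF.uniformOfFintype (Fin (p.len + 1) → F)).bind fun t =>
        (hears (viewPlayer V D) 0 (V.init, D.init) (p.keyList (p.keyOf t))).bind fun q₁ =>
          (hears (viewPlayer V D) p.keyLen q₁ (p.maskList (p.maskOf t))).bind fun q₂ =>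
            (reads (viewPlayer V D) (p.len + 1) q₂ (indexStream F n x)).bind fun q₃ =>
              inter (viewPlayer V D) p.m p.deg p.node
                (p.commit (p.line x.1 (p.point x.2)) (p.maskOf t))
                (p.reply (fun r e => e = p.keyOf t r) (p.maskOf t) (p.point x.2))
                (p.len + 1 + (n + 1)) q₃) (indicator fun q => D.accept q.2) -
        ev ((PMF.uniformOfFintype (Fin (p.len + 1) → F)).bind fun t =>
        (hears (viewPlayer V D) 0 (V.init, D.init) (p.keyList (p.keyOf t))).bind fun q₁ =>
          (hears (viewPlayer V D) p.keyLen q₁ (p.maskList (p.maskOf t))).bind fun q₂ =>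
            (reads (viewPlayer V D) (p.len + 1) q₂ (indexStream F n x)).bind fun q₃ =>
              inter (viewPlayer V D) p.m p.deg p.node
                (p.commit (p.fakeLine (p.point x.2) (b q₁.1) fun k =>
                  lde p.node p.pts x.1 (b q₁.1 k)) (p.maskOf t))
                (p.reply (fun r e => e = p.keyOf t r ∧ r ∈ Set.range (b q₁.1)) (p.maskOf t)
                  (p.point x.2))
                (p.len + 1 + (n + 1)) q₃) (indicator fun q => D.accept q.2)| ≤
      (ε + (Real.log (Fintype.card (Memory s)) + K * Real.log 2) /
          (ε * K * Real.log (Fintype.card F))) +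
        (Real.log (Fintype.card (Memory s × (p.Point × (Memory s × Memory s')))) +
          t ^ 2 * Fintype.card p.Grid) / (t * Fintype.card p.Grid) := by
  classical
  obtain ⟨b, hb⟩ := exists_guess_cover (F := F) (R := p.Point)
    (fun y m => (hears (verifierPlayer V) 0 V.init (p.keyList y) m).toReal)
    (fun y m => ENNReal.toReal_nonneg) (fun y => sum_toReal _) hK hε Fintype.one_lt_card
  refine ⟨b, fun s' D x hx t ht ht1 => ?_⟩
  set B := viewPlayer V D
  set acc : Memory s × Memory s' → ℝ := indicator fun q => D.accept q.2
  have a0 : ∀ q, 0 ≤ acc q := indicator_nonneg _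
  have a1 : ∀ q, acc q ≤ 1 := indicator_le_one _
  set g : p.Point → F[X] := p.line x.1 (p.point x.2) with hg
  set g' : Memory s → p.Point → F[X] := fun a => p.fakeLine (p.point x.2) (b a)
    fun k => lde p.node p.pts x.1 (b a k) with hg'
  have r1 := p.ev_game B Prod.fst x (V.init, D.init) acc (fun _ => g)
    (fun _ y r e => e = y r)
  have r2 := p.ev_game B Prod.fst x (V.init, D.init) acc g'
    (fun a y r e => e = y r ∧ r ∈ Set.range (b a))
  rw [r1, r2]
  set Y : ℝ := (Fintype.card (p.Point → F) : ℝ)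
  set N : ℝ := (Fintype.card p.Mask : ℝ)
  have hY : 0 < Y := Nat.cast_pos.2 Fintype.card_pos
  have hN : 0 < N := Nat.cast_pos.2 Fintype.card_pos
  set o₁ : (p.Point → F) → p.Mask → ℝ := fun y H =>
    p.outcome B Prod.fst x (V.init, D.init) acc (fun _ => g) (fun _ r e => e = y r) y H
  -- The hybrid: still the true line, but replies only at the points `b`.
  set o₂ : (p.Point → F) → p.Mask → ℝ := fun y H =>
    p.outcome B Prod.fst x (V.init, D.init) acc (fun _ => g)
      (fun a r e => e = y r ∧ r ∈ Set.range (b a)) y H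
  set o₃ : (p.Point → F) → p.Mask → ℝ := fun y H =>
    p.outcome B Prod.fst x (V.init, D.init) acc g'
      (fun a r e => e = y r ∧ r ∈ Set.range (b a)) y H
  set E₁ : ℝ := ε + (Real.log (Fintype.card (Memory s)) + K * Real.log 2) /
          (ε * K * Real.log (Fintype.card F))
  set E₂ : ℝ := (Real.log (Fintype.card (Memory s × (p.Point × (Memory s × Memory s')))) +
          t ^ 2 * Fintype.card p.Grid) / (t * Fintype.card p.Grid)
  have hyb1 : |∑ y, ∑ H, (o₁ y H - o₂ y H)| ≤ N * Y * E₁ := by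
    have step : ∀ y H, |o₁ y H - o₂ y H| ≤
        ∑ m, (hears (verifierPlayer V) 0 V.init (p.keyList y) m).toReal *
          ∑ z, (p.guess (verifierPlayer V) x g H m z).toReal *
            (if y z.1 = z.2 ∧ z.1 ∉ Set.range (b m) then 1 else 0) := by
      intro y H
      refine (p.abs_outcome_sub_le_guess B Prod.fst x _ a0 a1 g _ _ y H).trans (le_of_eq ?_)
      have proj1 : ∀ i (q : Memory s × Memory s') (c : F), (B.hear i q c).map Prod.fst =
          (verifierPlayer V).hear i q.1 c := fun i q c => by
        simp only [B, viewPlayer_hear, verifierPlayer_hear, PMF.map_bind, PMF.map_comp,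
          Function.comp_def]
        rw [← PMF.bind_pure_comp]
        exact congrArg _ (funext fun r => PMF.map_const _ _)
      have proj2 : ∀ i (q : Memory s × Memory s') c, (B.read i q c).map Prod.fst =
          (verifierPlayer V).read i q.1 c := fun i q c => by
        simp only [B, viewPlayer_read, verifierPlayer_read, PMF.map_bind, PMF.map_comp,
          Function.comp_def]
        rw [← PMF.bind_pure_comp]
        exact congrArg _ (funext fun r => PMF.map_const _ _)
      have proj3 : ∀ i (q : Memory s × Memory s'), (B.send i q).map (fun o => (o.1, o.2.1)) =
          (verifierPlayer V).send i q.1 := fun i q => by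
        simp only [B, viewPlayer_send, verifierPlayer_send, PMF.map_bind, PMF.map_comp,
          Function.comp_def]
        rw [← PMF.bind_pure_comp]
        exact congrArg _ (funext fun r => PMF.map_const _ _)
      have hl := hears_bind_congr B (verifierPlayer V) Prod.fst proj1 0 (V.init, D.init)
        (p.keyList y) (fun q₁ => (p.guess B x g H q₁).map fun z => (q₁.1, z))
        (fun m => (p.guess (verifierPlayer V) x g H m).map fun z => (m, z))
        (fun q => by rw [p.guess_proj B (verifierPlayer V) Prod.fst proj1 proj2 proj3])
      have := congrArg (fun μ => ev μ fun c : Memory s × (p.Point × F) =>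
        if (c.2.2 = y c.2.1 ↔ c.2.2 = y c.2.1 ∧ c.2.1 ∈ Set.range (b c.1)) then (0 : ℝ) else 1) hl
      simp only [ev_bind, ev_map] at this
      refine Eq.trans (by congr!) (this.trans ?_)
      refine Finset.sum_congr rfl fun m _ => ?_
      congr 1
      refine Finset.sum_congr rfl fun z _ => ?_
      congr 1
      by_cases h1 : z.2 = y z.1
      · by_cases h2 : z.1 ∈ Set.range (b m) <;> simp [h1, h2]
      · have h1' : ¬ y z.1 = z.2 := fun h => h1 h.symm
        simp [h1, h1']
    -- For the first hybrid the masks are fixed and the keys are random; for the second one it is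
    -- the other way round.
    rw [Finset.sum_comm]
    refine (Finset.abs_sum_le_sum_abs _ _).trans ?_
    calc _ ≤ ∑ _H : p.Mask, Y * E₁ := by
          refine Finset.sum_le_sum fun H _ => ?_
          refine (Finset.abs_sum_le_sum_abs _ _).trans ?_
          refine (Finset.sum_le_sum fun y _ => step y H).trans ?_
          refine le_trans (le_of_eq ?_) (hb
            (fun m z => (p.guess (verifierPlayer V) x g H m z).toReal)
            (fun _ _ => ENNReal.toReal_nonneg) (fun m => sum_toReal _))
          congr!
      _ = N * Y * E₁ := by
        rw [Finset.sum_const, Finset.card_univ, nsmul_eq_mul, mul_assoc]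
  have hyb2 : |∑ y, ∑ H, (o₂ y H - o₃ y H)| ≤ N * Y * E₂ := by
    refine (Finset.abs_sum_le_sum_abs _ _).trans ?_
    calc _ ≤ ∑ _y : p.Point → F, N * E₂ := by
          refine Finset.sum_le_sum fun y _ => ?_
          exact p.abs_outcome_sub_le_hiding B Prod.fst x hx _ a0 a1 b _ (fun a r e h => h.2) y
            ht ht1
      _ = N * Y * E₂ := by
        rw [Finset.sum_const, Finset.card_univ, nsmul_eq_mul]; ring
  have e0 : (∑ y, (∑ H, o₁ y H) / N) / Y - (∑ y, (∑ H, o₃ y H) / N) / Y =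
      ((∑ y, ∑ H, (o₁ y H - o₂ y H)) + ∑ y, ∑ H, (o₂ y H - o₃ y H)) / (N * Y) := by
    simp only [← Finset.sum_div, Finset.sum_sub_distrib]
    field_simp
    ring
  refine (congrArg abs e0).trans_le ?_
  rw [abs_div, abs_of_pos (mul_pos hN hY), div_le_iff₀ (mul_pos hN hY)]
  refine (abs_add_le _ _).trans ?_
  linarith

end Params
end Streaming

namespace Streaming

/-! ### The honest verifier -/

theorem map_uniform_equiv {α β : Type*} [Fintype α] [Fintype β] [Nonempty α] [Nonempty β]
    (e : α ≃ β) : (PMF.uniformOfFintype α).map e = PMF.uniformOfFintype β := by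
  classical
  ext b
  rw [PMF.map_apply, tsum_eq_single (e.symm b)]
  · simp [Fintype.card_congr e]
  · intro a ha
    rw [if_neg]
    rintro rfl
    exact ha (by simp)

theorem sum_lt_succ {M : Type*} [AddCommMonoid M] {N : ℕ} (f : Fin N → M) (k : Fin N) :
    (∑ l : Fin N, if (l : ℕ) < k + 1 then f l else 0) =
      (∑ l : Fin N, if (l : ℕ) < k then f l else 0) + f k := by
  have : ∀ l : Fin N, (if (l : ℕ) < k + 1 then f l else 0) =
      (if (l : ℕ) < k then f l else 0) + if l = k then f l else 0 := fun l => by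
    rcases lt_trichotomy (l : ℕ) k with h | h | h
    · rw [if_pos (by omega), if_pos h, if_neg (by rintro rfl; omega), add_zero]
    · rw [if_pos (by omega), if_neg (by omega), if_pos (Fin.ext h), zero_add]
    · rw [if_neg (by omega), if_neg (by omega), if_neg (by rintro rfl; omega), add_zero]
  rw [Finset.sum_congr rfl fun l _ => this l, Finset.sum_add_distrib]
  simp

/-! ### Deterministic blocks, and executions with an arbitrary prover -/

section deterministic

variable {Γ A : Type u} {Q : Type}

theorem hears_pure (B : Player Γ A Q) {N : ℕ} (i : ℕ) (gs : Fin N → Γ) (σ : ℕ → Q)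
    (h : ∀ k : Fin N, B.hear (i + k) (σ k) (gs k) = PMF.pure (σ (k + 1))) :
    hears B i (σ 0) (List.ofFn gs) = PMF.pure (σ N) := by
  induction N generalizing i σ with
  | zero => simp [hears]
  | succ N ih =>
    rw [List.ofFn_succ, hears]
    have h0 := h 0
    simp only [Fin.val_zero, add_zero, zero_add] at h0
    rw [h0, PMF.pure_bind]
    refine ih (i + 1) (fun k => gs k.succ) (fun k => σ (k + 1)) fun k => ?_
    have := h k.succ
    rw [Fin.val_succ, ← add_assoc, add_right_comm] at this
    exact this

theorem reads_pure (B : Player Γ A Q) {N : ℕ} (i : ℕ) (gs : Fin N → A) (σ : ℕ → Q)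
    (h : ∀ k : Fin N, B.read (i + k) (σ k) (gs k) = PMF.pure (σ (k + 1))) :
    reads B i (σ 0) (List.ofFn gs) = PMF.pure (σ N) := by
  induction N generalizing i σ with
  | zero => simp [reads]
  | succ N ih =>
    rw [List.ofFn_succ, reads]
    have h0 := h 0
    simp only [Fin.val_zero, add_zero, zero_add] at h0
    rw [h0, PMF.pure_bind]
    refine ih (i + 1) (fun k => gs k.succ) (fun k => σ (k + 1)) fun k => ?_
    have := h k.succ
    rw [Fin.val_succ, ← add_assoc, add_right_comm] at this
    exact this

theorem reads_append (B : Player Γ A Q) (l₁ l₂ : List A) (i : ℕ) (q : Q) :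
    reads B i q (l₁ ++ l₂) = (reads B i q l₁).bind fun q' => reads B (i + l₁.length) q' l₂ := by
  induction l₁ generalizing i q with
  | nil => simp [reads]
  | cons g l ih =>
    have h : i + 1 + l.length = i + (g :: l).length := by simp; omega
    simp only [List.cons_append, reads, ih, PMF.bind_bind, h]

theorem sends_pure (B : Player Γ A Q) {N : ℕ} (i : ℕ) (q : Q) (gs : Fin N → Γ)
    (h : ∀ k : Fin N, B.send (i + k) q = PMF.pure (gs k, q)) :
    sends B i q N = PMF.pure (gs, q) := by
  induction N generalizing i with
  | zero => simp only [sends]; congr 2; ext k; exact k.elim0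
  | succ N ih =>
    have h0 := h 0
    simp only [Fin.val_zero, add_zero] at h0
    have h1 := ih (i + 1) (fun k => gs k.succ) fun k => by
      have := h k.succ
      rwa [Fin.val_succ, ← add_assoc, add_right_comm] at this
    simp only [sends, h0, PMF.pure_bind, h1, PMF.pure_map]
    congr 2
    ext k
    refine Fin.cases ?_ (fun k => ?_) k <;> simp

/-- Law of the next `n` symbols of a prover, after the history `h`. -/
def speak (P : Prover Γ A) (h : List (Event Γ A)) (n : ℕ) : PMF (Fin n → Γ) :=
  blockLaw (fun gs => P (h ++ gs.map Event.prover)) n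

theorem game_speak (B : Player Γ A Q) (P : Prover Γ A) (n i : ℕ) (q : Q)
    (h : List (Event Γ A)) :
    game B (proverStrategy P) i q h (List.replicate n Slot.prover) =
      (speak P h n).bind fun gs => (hears B i q (List.ofFn gs)).map fun q' =>
        (q', h ++ (List.ofFn gs).map Event.prover) := by
  have := game_hear B (proverStrategy P) n i (fun gs _ => h ++ gs.map Event.prover)
    (fun gs => P (h ++ gs.map Event.prover)) (fun _ _ _ => rfl)
    (fun gs g q q' _ => by rw [proverStrategy_upd]; simp) q
  simpa [speak] using this

theorem game_listen (B : Player Γ A Q) (P : Prover Γ A) (as : List A) (i : ℕ) (q : Q)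
    (h : List (Event Γ A)) :
    game B (proverStrategy P) i q h (as.map Slot.input) =
      (reads B i q as).map fun q' => (q', h ++ as.map Event.input) := by
  have := game_read B (proverStrategy P) as i (fun l _ => h ++ l.map Event.input)
    (fun l a q q' _ => by rw [proverStrategy_upd]; simp) q
  simpa using this

theorem game_answer (B : Player Γ A Q) (P : Prover Γ A) (n i : ℕ) (q : Q)
    (h : List (Event Γ A)) :
    game B (proverStrategy P) i q h (List.replicate n Slot.verifier) =
      (sends B i q n).map fun o => (o.2, h ++ (List.ofFn o.1).map Event.verifier) := by
  have := game_send B (proverStrategy P) n i (fun l => h ++ l.map Event.verifier)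
    (fun l a q _ => by rw [proverStrategy_upd]; simp) q
  simpa using this

end deterministic

open Polynomial

variable {F : Type u} [Field F] [Fintype F] [DecidableEq F] {n : ℕ}

namespace Params

variable (p : Params F n) {s : ℕ}

/-- State of the honest verifier: the secret point, which is later replaced by the direction
of the line to it, the same for the second secret point, the two secret parameters, the
key, and the two checks. -/
@[ext]
structure HonestState where
  a : p.Point
  b : p.Point
  ρ : F
  τ : F
  e : F
  h : F
  z : F

instance : Nonempty p.HonestState := ⟨⟨0, 0, 0, 0, 0, 0, 0⟩⟩

/-- The random choices of the honest verifier. -/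
abbrev Seed : Type u := p.Point × Fˣ × p.Point × Fˣ

/-- The initial state of the honest verifier. -/
abbrev start (ω : p.Seed) : p.HonestState := ⟨ω.1, ω.2.2.1, ω.2.1, ω.2.2.2, 0, 0, p.target⟩

variable {p}

namespace HonestState

/-- The coefficient of a symbol of the setup in the key. -/
def keyWeight (t : p.HonestState) (c : p.Point ⊕ (p.Grid × Fin p.deg)) : F :=
  Sum.elim (fun r => if r = t.a then 1 else 0) 0 c

/-- The coefficient of a symbol of the setup in the check of the reply. -/
def maskWeight (t : p.HonestState) (c : p.Point ⊕ (p.Grid × Fin p.deg)) : F :=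
  Sum.elim 0 (fun c => t.ρ ^ ((c.2 : ℕ) + 1) * lag p.node c.1 t.b) c

def hear (i : ℕ) (t : p.HonestState) (g : F) : p.HonestState :=
  if hi : i < p.len + 1 then
    { t with
      e := t.e + g * t.keyWeight (p.setupEquiv.symm ⟨i, hi⟩)
      h := t.h + g * t.maskWeight (p.setupEquiv.symm ⟨i, hi⟩) }
  else
    let k := i - (p.len + 1 + (n + 1))
    -- A symbol heard here is coordinate `k - p.m` of the challenge. Coordinate by coordinate, the
    -- second secret point is turned into the direction of the line from the challenge to it.
    if k < p.m + p.m then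
      { t with b := fun l => if (l : ℕ) = k - p.m then t.τ⁻¹ * (t.b l - g) else t.b l }
    else if k < p.m + p.m + p.deg then { t with z := t.z + g * t.ρ ^ (k - (p.m + p.m) + 1) }
    else
      let l := k - (p.m + p.m + p.deg + (p.m + 2))
      { t with
        h := t.h - g * t.τ ^ l
        z := t.z - if l = 0 then g else 0 }

def read (i : ℕ) (t : p.HonestState) : IndexSymbol F n → p.HonestState
  | .inl v => { t with
      z := t.z - if hi : i - (p.len + 1) < n then
        v * lag p.node (p.pts ⟨i - (p.len + 1), hi⟩) t.a else 0 }
  | .inr j => { t with a := t.ρ⁻¹ • (t.a - p.point j) }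

/-- The second message of the honest verifier. -/
def message (t : p.HonestState) : Fin (p.m + 2) → F := Fin.cons t.ρ (Fin.cons t.e t.b)

def send (i : ℕ) (t : p.HonestState) : F :=
  let k := i - (p.len + 1 + (n + 1))
  if hk : k < p.m then t.a ⟨k, hk⟩
  else if hk : k - (p.m + p.m + p.deg) < p.m + 2 then t.message ⟨k - (p.m + p.m + p.deg), hk⟩
  else 0

end HonestState

variable (p)

/-- The random choices of the verifier, as one symbol. -/
def seedEquiv : Fin (Fintype.card p.Seed - 1 + 1) ≃ p.Seed :=
  (finCongr (Nat.sub_add_cancel Fintype.card_pos)).trans (Fintype.equivFin _).symm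

/-- The honest verifier, with respect to an encoding of its states. -/
abbrev verifier (enc : p.HonestState → Memory s) (dec : Memory s → p.HonestState) :
    Verifier F (IndexSymbol F n) s where
  coins := Fintype.card p.Seed - 1
  -- Irrelevant: the setup has at least one symbol, and at tick `0` the state is replaced by one
  -- made from a fresh seed.
  init := enc (Classical.arbitrary _)
  hear i m r g := enc ((if i = 0 then p.start (p.seedEquiv r) else dec m).hear i g)
  read i m _ a := enc ((dec m).read i a)
  send i m _ := ((dec m).send i, m)
  accept m := (dec m).h = 0 ∧ (dec m).z = 0

variable {enc : p.HonestState → Memory s} {dec : Memory s → p.HonestState}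

theorem verifier_hear_zero (m : Memory s) (g : F) :
    (verifierPlayer (p.verifier enc dec)).hear 0 m g =
      (PMF.uniformOfFintype p.Seed).map fun ω => enc ((p.start ω).hear 0 g) := by
  rw [verifierPlayer_hear, ← map_uniform_equiv p.seedEquiv, PMF.map_comp]
  rfl

theorem verifier_hear (hdec : ∀ x, dec (enc x) = x) {i : ℕ} (hi : i ≠ 0) (t : p.HonestState)
    (g : F) : (verifierPlayer (p.verifier enc dec)).hear i (enc t) g =
      PMF.pure (enc (t.hear i g)) := by
  rw [verifierPlayer_hear]
  simp only [if_neg hi, hdec]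
  exact PMF.map_const _ _

theorem verifier_read (hdec : ∀ x, dec (enc x) = x) (i : ℕ) (t : p.HonestState)
    (g : IndexSymbol F n) : (verifierPlayer (p.verifier enc dec)).read i (enc t) g =
      PMF.pure (enc (t.read i g)) := by
  rw [verifierPlayer_read]
  simp only [hdec]
  exact PMF.map_const _ _

theorem verifier_send (hdec : ∀ x, dec (enc x) = x) (i : ℕ) (t : p.HonestState) :
    (verifierPlayer (p.verifier enc dec)).send i (enc t) = PMF.pure (t.send i, enc t) := by
  rw [verifierPlayer_send]
  simp only [hdec]
  exact PMF.map_const _ _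

/-- The value of a table of masks, with the secret parameter `ρ`, at the point `k`. -/
def maskValue (H : p.Mask) (ρ : F) (k : p.Point) : F :=
  ∑ κ, ∑ l : Fin p.deg, H κ l * (ρ ^ ((l : ℕ) + 1) * lag p.node κ k)

/-- State of the verifier after the setup. -/
def afterSetup (ω : p.Seed) (t : Fin (p.len + 1) → F) : p.HonestState :=
  { p.start ω with e := p.keyOf t ω.1, h := p.maskValue (p.maskOf t) ω.2.1 ω.2.2.1 }

theorem hears_setup (hdec : ∀ x, dec (enc x) = x) (t : Fin (p.len + 1) → F) :
    hears (verifierPlayer (p.verifier enc dec)) 0 (p.verifier enc dec).init (List.ofFn t) =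
      (PMF.uniformOfFintype p.Seed).map fun ω => enc (p.afterSetup ω t) := by
  set S : p.Seed → ℕ → p.HonestState := fun ω k =>
    { p.start ω with
      e := ∑ l : Fin (p.len + 1),
        if (l : ℕ) < k then t l * (p.start ω).keyWeight (p.setupEquiv.symm l) else 0
      h := ∑ l : Fin (p.len + 1),
        if (l : ℕ) < k then t l * (p.start ω).maskWeight (p.setupEquiv.symm l) else 0 } with hS
  have hstep : ∀ ω (k : Fin (p.len + 1)), (S ω k).hear k (t k) = S ω (k + 1) := fun ω k => by
    rw [HonestState.hear, dif_pos k.2]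
    simp only [hS, sum_lt_succ]
    rfl
  have h0 : ∀ ω, S ω 0 = p.start ω := fun ω => by simp [hS, start]
  have hend : ∀ ω, S ω (p.len + 1) = p.afterSetup ω t := fun ω => by
    simp only [hS, afterSetup, Fin.is_lt, if_true]
    congr 1
    · rw [sum_setup]
      simp only [HonestState.keyWeight, Equiv.symm_apply_apply, Sum.elim_inl, Sum.elim_inr, keyOf,
        Pi.zero_apply, mul_zero, Finset.sum_const_zero, add_zero]
      rw [Finset.sum_eq_single ω.1]
      · rw [if_pos rfl, mul_one]
      · intro r _ hr
        rw [if_neg hr, mul_zero]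
      · simp
    · rw [sum_setup]
      simp [HonestState.maskWeight, maskOf, maskValue]
  rw [List.ofFn_succ, hears, verifier_hear_zero, PMF.bind_map, ← PMF.bind_pure_comp]
  congr 1; ext1 ω
  rw [Function.comp_apply, Function.comp_apply, ← h0, ← hend]
  have h1 := hstep ω 0
  rw [Fin.val_zero] at h1
  rw [h1]
  exact hears_pure _ _ _ (fun k => enc (S ω (k + 1))) fun k => by
    have h2 := hstep ω k.succ
    rw [Fin.val_succ] at h2
    rw [p.verifier_hear hdec (by omega), ← h2, zero_add, add_comm 1]

theorem reads_stream (hdec : ∀ x, dec (enc x) = x) (t : p.HonestState) (x : IndexInstance F n) :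
    reads (verifierPlayer (p.verifier enc dec)) (p.len + 1) (enc t) (indexStream F n x) =
      PMF.pure (enc { t with
        a := t.ρ⁻¹ • (t.a - p.point x.2)
        z := t.z - lde p.node p.pts x.1 t.a }) := by
  set S : ℕ → p.HonestState := fun k => { t with
      z := t.z - ∑ l : Fin n, if (l : ℕ) < k then x.1 l * lag p.node (p.pts l) t.a else 0 } with hS
  have h0 : S 0 = t := by simp [hS]
  have hend : S n = { t with z := t.z - lde p.node p.pts x.1 t.a } := by simp [hS, lde]
  rw [indexStream, reads_append]
  have h1 := reads_pure (verifierPlayer (p.verifier enc dec)) (p.len + 1)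
    (fun i : Fin n => (Sum.inl (x.1 i) : IndexSymbol F n)) (fun k => enc (S k)) fun k => by
      rw [p.verifier_read hdec, HonestState.read]
      have : p.len + 1 + (k : ℕ) - (p.len + 1) < n := by omega
      simp only [this, dif_pos]
      congr 2
      simp only [hS, sum_lt_succ, sub_sub]
      congr 4
      simp
  rw [h0] at h1
  rw [h1, PMF.pure_bind, reads, p.verifier_read hdec, PMF.pure_bind, hend]
  rfl

theorem sends_first (hdec : ∀ x, dec (enc x) = x) (t : p.HonestState) :
    sends (verifierPlayer (p.verifier enc dec)) (p.len + 1 + (n + 1)) (enc t) p.m =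
      PMF.pure (t.a, enc t) := by
  refine sends_pure _ _ _ _ fun k => ?_
  rw [p.verifier_send hdec, HonestState.send]
  simp

theorem sends_second (hdec : ∀ x, dec (enc x) = x) (t : p.HonestState) :
    sends (verifierPlayer (p.verifier enc dec))
      (p.len + 1 + (n + 1) + p.m + p.m + p.deg) (enc t) (p.m + 2) =
      PMF.pure (t.message, enc t) := by
  refine sends_pure _ _ _ _ fun k => ?_
  rw [p.verifier_send hdec, HonestState.send]
  have h1 : p.len + 1 + (n + 1) + p.m + p.m + p.deg + k - (p.len + 1 + (n + 1)) =
    p.m + p.m + p.deg + k := by omega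
  simp only [h1]
  rw [dif_neg (by omega), dif_pos (by omega)]
  congr 3
  ext
  simp

theorem hears_challenge (hdec : ∀ x, dec (enc x) = x) (t : p.HonestState) (k : p.Point) :
    hears (verifierPlayer (p.verifier enc dec)) (p.len + 1 + (n + 1) + p.m) (enc t)
        (List.ofFn k) = PMF.pure (enc { t with b := t.τ⁻¹ • (t.b - k) }) := by
  set S : ℕ → p.HonestState := fun i => { t with
      b := fun l => if (l : ℕ) < i then t.τ⁻¹ * (t.b l - k l) else t.b l } with hS
  have h0 : S 0 = t := by simp [hS]
  have hend : S p.m = { t with b := t.τ⁻¹ • (t.b - k) } := by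
    simp only [hS, Fin.is_lt, if_true]
    rfl
  have h1 := hears_pure (verifierPlayer (p.verifier enc dec)) (p.len + 1 + (n + 1) + p.m) k
    (fun i => enc (S i)) fun i => by
      rw [p.verifier_hear hdec (by omega), HonestState.hear, dif_neg (by omega)]
      have h2 : p.len + 1 + (n + 1) + p.m + i - (p.len + 1 + (n + 1)) = p.m + i := by omega
      simp only [h2]
      rw [if_pos (by omega)]
      congr 2
      simp only [hS]
      congr 1
      ext l
      rcases lt_trichotomy (l : ℕ) i with h | h | h
      · rw [if_neg (by omega), if_pos h, if_pos (by omega)]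
      · rw [if_pos (by omega), if_neg (by omega), if_pos (by omega), Fin.ext h]
      · rw [if_neg (by omega), if_neg (by omega), if_neg (by omega)]
  rw [h0, hend] at h1
  exact h1

theorem hears_commit (hdec : ∀ x, dec (enc x) = x) (t : p.HonestState) (c : Fin p.deg → F) :
    hears (verifierPlayer (p.verifier enc dec)) (p.len + 1 + (n + 1) + p.m + p.m) (enc t)
        (List.ofFn c) =
      PMF.pure (enc { t with z := t.z + ∑ i, c i * t.ρ ^ ((i : ℕ) + 1) }) := by
  set S : ℕ → p.HonestState := fun k => { t with
      z := t.z + ∑ i : Fin p.deg, if (i : ℕ) < k then c i * t.ρ ^ ((i : ℕ) + 1) else 0 } with hS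
  have h0 : S 0 = t := by simp [hS]
  have hend : S p.deg = { t with z := t.z + ∑ i, c i * t.ρ ^ ((i : ℕ) + 1) } := by
    simp only [hS, Fin.is_lt, if_true]
  have h1 := hears_pure (verifierPlayer (p.verifier enc dec)) (p.len + 1 + (n + 1) + p.m + p.m) c
    (fun i => enc (S i)) fun i => by
      rw [p.verifier_hear hdec (by omega), HonestState.hear, dif_neg (by omega)]
      have h2 : p.len + 1 + (n + 1) + p.m + p.m + i - (p.len + 1 + (n + 1)) = p.m + p.m + i := by
        omega
      simp only [h2]
      rw [if_neg (by omega), if_pos (by omega)]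
      congr 2
      simp only [hS, sum_lt_succ, add_assoc]
      congr 6
      omega
  rw [h0, hend] at h1
  exact h1

theorem hears_reply (hdec : ∀ x, dec (enc x) = x) (t : p.HonestState) (u : Fin (p.deg + 1) → F) :
    hears (verifierPlayer (p.verifier enc dec))
        (p.len + 1 + (n + 1) + p.m + p.m + p.deg + (p.m + 2)) (enc t) (List.ofFn u) =
      PMF.pure (enc { t with
        h := t.h - ∑ i, u i * t.τ ^ (i : ℕ)
        z := t.z - u 0 }) := by
  set S : ℕ → p.HonestState := fun k => { t with
      h := t.h - ∑ i : Fin (p.deg + 1), if (i : ℕ) < k then u i * t.τ ^ (i : ℕ) else 0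
      z := t.z - ∑ i : Fin (p.deg + 1), if (i : ℕ) < k then (if (i : ℕ) = 0 then u i else 0)
        else 0 } with hS
  have h0 : S 0 = t := by simp [hS]
  have hend : S (p.deg + 1) = { t with
        h := t.h - ∑ i, u i * t.τ ^ (i : ℕ)
        z := t.z - u 0 } := by
    simp only [hS, Fin.is_lt, if_true]
    congr 2
    rw [Finset.sum_eq_single 0]
    · simp
    · intro i _ hi
      exact if_neg fun h => hi (Fin.ext h)
    · simp
  have h1 := hears_pure (verifierPlayer (p.verifier enc dec))
    (p.len + 1 + (n + 1) + p.m + p.m + p.deg + (p.m + 2)) u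
    (fun i => enc (S i)) fun i => by
      rw [p.verifier_hear hdec (by omega), HonestState.hear, dif_neg (by omega)]
      have h2 : p.len + 1 + (n + 1) + p.m + p.m + p.deg + (p.m + 2) + i -
          (p.len + 1 + (n + 1)) = p.m + p.m + p.deg + (p.m + 2) + i := by omega
      have h3 : p.m + p.m + p.deg + (p.m + 2) + i - (p.m + p.m + p.deg + (p.m + 2)) = i := by
        omega
      simp only [h2, h3]
      rw [if_neg (by omega), if_neg (by omega)]
      congr 2
      simp only [hS, sum_lt_succ, sub_sub]
  rw [h0, hend] at h1
  exact h1

end Params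
end Streaming

namespace Streaming

open Polynomial

section expectation

variable {α β γ δ : Type*} [Fintype α] [Fintype β] [Fintype γ] [Fintype δ]

theorem ev_comm (μ : PMF α) (ν : PMF β) (f : α → β → ℝ) :
    (ev μ fun a => ev ν fun b => f a b) = ev ν fun b => ev μ fun a => f a b := by
  simp only [ev, Finset.mul_sum]
  rw [Finset.sum_comm]
  exact Finset.sum_congr rfl fun b _ => Finset.sum_congr rfl fun a _ => by ring

theorem ev_comm₃ (μ : PMF α) (ν : PMF β) (ξ : PMF γ) (o : PMF δ) (f : α → β → γ → δ → ℝ) :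
    (ev μ fun a => ev ν fun b => ev ξ fun c => ev o fun d => f a b c d) =
      ev o fun d => ev μ fun a => ev ν fun b => ev ξ fun c => f a b c d := by
  simp only [ev_comm ξ o, ev_comm ν o, ev_comm μ o]

theorem ev_add (μ : PMF α) (f g : α → ℝ) : (ev μ fun a => f a + g a) = ev μ f + ev μ g := by
  simp only [ev, mul_add, Finset.sum_add_distrib]

theorem ev_uniform_equiv [Nonempty α] [Nonempty β] (e : α ≃ β) (f : β → ℝ) :
    (ev (PMF.uniformOfFintype α) fun a => f (e a)) = ev (PMF.uniformOfFintype β) f := by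
  rw [← map_uniform_equiv e, ev_map]

theorem ev_uniform_prod [Nonempty α] [Nonempty β] (f : α × β → ℝ) :
    ev (PMF.uniformOfFintype (α × β)) f =
      ev (PMF.uniformOfFintype α) fun a => ev (PMF.uniformOfFintype β) fun b => f (a, b) := by
  simp only [ev_uniform, Fintype.sum_prod_type, Fintype.card_prod, ← Finset.sum_div]
  rw [div_div, Nat.cast_mul, mul_comm]

end expectation

variable {F : Type u} [Field F] [Fintype F] [DecidableEq F] {n : ℕ}

theorem ev_root_le {P : F[X]} {D : ℕ} (hP : P ≠ 0) (hD : P.natDegree ≤ D) :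
    (ev (PMF.uniformOfFintype Fˣ) fun τ => if P.eval (τ : F) = 0 then (1 : ℝ) else 0) ≤
      D / Fintype.card Fˣ := by
  rw [ev_uniform, Finset.sum_boole]
  gcongr
  have h1 : ((Finset.univ.filter fun τ : Fˣ => P.eval (τ : F) = 0).map
      ⟨Units.val, Units.val_injective⟩) ⊆ P.roots.toFinset := by
    intro a ha
    simp only [Finset.mem_map, Finset.mem_filter, Finset.mem_univ, true_and,
      Function.Embedding.coeFn_mk] at ha
    obtain ⟨τ, hτ, rfl⟩ := ha
    rw [Multiset.mem_toFinset, mem_roots hP]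
    exact hτ
  have h2 := Finset.card_le_card h1
  rw [Finset.card_map] at h2
  exact h2.trans ((Multiset.toFinset_card_le _).trans ((card_roots' P).trans hD))

namespace Params

variable (p : Params F n) {s : ℕ}
variable {enc : p.HonestState → Memory s} {dec : Memory s → p.HonestState}

/-! ### Completeness and soundness -/

/-- The restriction of the low-degree extension of the masks to the line `k + X w`. -/
def maskLine (H : p.Mask) (ρ : F) (k w : p.Point) : F[X] :=
  ∑ κ, ∑ l : Fin p.deg, C (H κ l * ρ ^ ((l : ℕ) + 1)) * lagLine p.node κ k w

theorem maskLine_natDegree (H : p.Mask) (ρ : F) (k w : p.Point) :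
    (p.maskLine H ρ k w).natDegree ≤ p.deg :=
  natDegree_sum_le_of_forall_le _ _ fun _ _ => natDegree_sum_le_of_forall_le _ _ fun _ _ =>
    (natDegree_C_mul_le _ _).trans (natDegree_lagLine _ _ _ _)

theorem maskLine_eval (H : p.Mask) (ρ : F) (k w : p.Point) (τ : F) :
    (p.maskLine H ρ k w).eval τ = p.maskValue H ρ (k + τ • w) := by
  simp only [maskLine, maskValue, eval_finsetSum, eval_mul, eval_C, eval_lagLine, mul_assoc]

/-- The decision of the honest verifier. -/
def Accepts (x : Fin n → F) (t : Fin (p.len + 1) → F) (ω : p.Seed) (c : Fin p.deg → F)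
    (u : Fin (p.deg + 1) → F) : Prop :=
  p.maskValue (p.maskOf t) ω.2.1 ω.2.2.1 - ∑ i, u i * (ω.2.2.2 : F) ^ (i : ℕ) = 0 ∧
    p.target - lde p.node p.pts x ω.1 + ∑ i, c i * (ω.2.1 : F) ^ ((i : ℕ) + 1) - u 0 = 0

/-- The direction of a line through `a`, in terms of one of its points. -/
abbrev direction (a : p.Point) (ρ : Fˣ) (r : p.Point) : p.Point := (ρ : F)⁻¹ • (r - a)

theorem add_smul_direction (a : p.Point) (ρ : Fˣ) (r : p.Point) :
    a + (ρ : F) • p.direction a ρ r = r := by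
  rw [direction, smul_smul, mul_inv_cancel₀ ρ.ne_zero, one_smul, add_sub_cancel]

/-- The second message of the honest verifier. -/
abbrev secondMessage (t : Fin (p.len + 1) → F) (ω : p.Seed) (k : p.Point) : Fin (p.m + 2) → F :=
  Fin.cons (ω.2.1 : F) (Fin.cons (p.keyOf t ω.1) (p.direction k ω.2.2.2 ω.2.2.1))

open Classical in
-- The honest reply is the restriction of the extended masks to a line whose point at `τ` is the
-- second secret point, so the first check holds. Its constant coefficient is the mask value at the
-- challenge, which cancels the mask in the commitment evaluated at `ρ`; what remains is the
-- identity between the low-degree extension at the first secret point and its restriction evaluated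
-- at `ρ`.
theorem complete (hdec : ∀ x, dec (enc x) = x) (x : IndexInstance F n)
    (hx : x.1 x.2 = p.target) :
    acceptProb p.schedule p.prover (p.verifier enc dec) (indexStream F n x) = 1 := by
  have f₁ := p.hears_setup (enc := enc) hdec
  have f₂ := p.reads_stream (enc := enc) hdec
  have f₃ := p.sends_first (enc := enc) hdec
  have f₄ := p.hears_challenge (enc := enc) hdec
  have f₅ := p.hears_commit (enc := enc) hdec
  have f₆ := p.sends_second (enc := enc) hdec
  have f₇ := p.hears_reply (enc := enc) hdec
  have hacc : ∀ st : p.HonestState, indicator (p.verifier enc dec).accept (enc st) =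
      if st.h = 0 ∧ st.z = 0 then 1 else 0 := fun st => by
    simp only [indicator, hdec, decide_eq_true_eq]
  generalize p.verifier enc dec = V at f₁ f₂ f₃ f₄ f₅ f₆ f₇ hacc ⊢
  have h1 : (game (verifierPlayer V) (proverStrategy p.prover) 0 V.init []
      (p.schedule.slots (indexStream F n x))).map (fun o => V.accept o.1) =
      ((game (verifierPlayer V) (proverStrategy p.prover) 0 V.init []
      (p.schedule.slots (indexStream F n x))).map fun o => o.1).map V.accept := by
    rw [PMF.map_comp]; rfl
  have h2 : ∀ (t : Fin (p.len + 1) → F) (f : Memory s → PMF (Memory s)),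
      ((hears (verifierPlayer V) 0 V.init (p.keyList (p.keyOf t))).bind fun q₁ =>
        (hears (verifierPlayer V) p.keyLen q₁ (p.maskList (p.maskOf t))).bind f) =
      (PMF.uniformOfFintype p.Seed).bind fun ω => f (enc (p.afterSetup ω t)) := fun t f => by
    have := f₁ t
    rw [p.ofFn_setup, hears_append, length_keyList, zero_add] at this
    rw [← PMF.bind_bind, this, PMF.bind_map]
    rfl
  rw [acceptProb_eq_game, h1, p.game_prover, toReal_map_true]
  simp only [h2, PMF.pure_bind, inter, f₂, f₃, f₄, f₅, f₆, f₇]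
  simp only [ev_bind, ev_pure, hacc]
  have h3 : ∀ (t : Fin (p.len + 1) → F) (ω : p.Seed) (κ : Fin p.m → Fin p.d),
      p.Accepts x.1 t ω
        (fun i => p.commit (p.line x.1 (p.point x.2)) (p.maskOf t)
          (p.direction (p.point x.2) ω.2.1 ω.1) (p.node ∘ κ) i)
        (fun i => p.reply (fun r e => e = p.keyOf t r) (p.maskOf t) (p.point x.2)
          (p.direction (p.point x.2) ω.2.1 ω.1) (p.node ∘ κ)
          (p.secondMessage t ω (p.node ∘ κ)) i) := by
    intro t ω κ
    set H := p.maskOf t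
    set k : p.Point := p.node ∘ κ
    set w := p.direction (p.point x.2) ω.2.1 ω.1 with hw
    have hok : p.secondMessage t ω k 1 =
        p.keyOf t (p.point x.2 + p.secondMessage t ω k 0 • w) := by
      have := p.add_smul_direction (p.point x.2) ω.2.1 ω.1
      rw [← hw] at this
      exact congrArg (p.keyOf t) this.symm
    have hu : ∀ i, p.reply (fun r e => e = p.keyOf t r) H (p.point x.2) w k
        (p.secondMessage t ω k) i =
        (p.maskLine H ω.2.1 k (p.direction k ω.2.2.2 ω.2.2.1)).coeff i := fun i => by
      rw [reply, if_pos hok]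
      simp only [maskLine, finsetSum_coeff, coeff_C_mul, mul_assoc]
      rfl
    have hsum := p.line_natDegree x.1 (p.point x.2) w
    have e1 := eval_eq_coeff_zero_add hsum (ω.2.1 : F)
    rw [p.line_eval, hw, p.add_smul_direction, ← hw, coeff_zero_eq_eval_zero,
      p.line_eval_zero, hx] at e1
    constructor
    · simp only [hu]
      rw [← eval_eq_coeff_sum (p.maskLine_natDegree _ _ _ _), maskLine_eval, add_smul_direction,
        sub_self]
    · simp only [hu]
      rw [Fin.val_zero, coeff_zero_eq_eval_zero, maskLine_eval, zero_smul, add_zero, e1]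
      have e2 : ∑ i : Fin p.deg, p.commit (p.line x.1 (p.point x.2)) H w k i *
          (ω.2.1 : F) ^ ((i : ℕ) + 1) =
          ∑ i : Fin p.deg, (p.line x.1 (p.point x.2) w).coeff (i + 1) *
            (ω.2.1 : F) ^ ((i : ℕ) + 1) + p.maskValue H ω.2.1 k := by
        rw [maskValue, Finset.sum_comm, ← Finset.sum_add_distrib]
        refine Finset.sum_congr rfl fun i _ => ?_
        rw [commit, add_mul, Finset.sum_mul]
        congr 1
        refine Finset.sum_congr rfl fun κ _ => ?_
        rw [Finset.sum_eq_single i]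
        · rw [if_pos rfl]; ring
        · intro l _ hl
          rw [if_neg fun h => hl (Fin.ext h), mul_zero]
        · simp
      rw [e2]
      ring
  refine (congrArg (ev _) (funext fun t => ?_)).trans (ev_const _ 1)
  refine (congrArg (ev _) (funext fun ω => ?_)).trans (ev_const _ 1)
  refine (congrArg (ev _) (funext fun κ => ?_)).trans (ev_const _ 1)
  exact if_pos (h3 t ω κ)

open Classical in
-- The form of the right-hand side is what soundness needs: challenge and commitment depend on the
-- seed only through the first direction, and the reply only through that direction and the second
-- message.
theorem acceptProb_verifier (hdec : ∀ x, dec (enc x) = x) (x : IndexInstance F n)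
    (P : Prover F (IndexSymbol F n)) :
    ∃ (μ₀ : PMF (Fin (p.len + 1) → F)) (μ₁ : (Fin (p.len + 1) → F) → p.Point → PMF p.Point)
      (μ₂ : (Fin (p.len + 1) → F) → p.Point → p.Point → PMF (Fin p.deg → F))
      (μ₃ : (Fin (p.len + 1) → F) → p.Point → p.Point → (Fin p.deg → F) →
        (Fin (p.m + 2) → F) → PMF (Fin (p.deg + 1) → F)),
      acceptProb p.schedule P (p.verifier enc dec) (indexStream F n x) =
        ev μ₀ fun t => ev (PMF.uniformOfFintype p.Seed) fun ω =>
          ev (μ₁ t (p.direction (p.point x.2) ω.2.1 ω.1)) fun k =>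
            ev (μ₂ t (p.direction (p.point x.2) ω.2.1 ω.1) k) fun c =>
              ev (μ₃ t (p.direction (p.point x.2) ω.2.1 ω.1) k c (p.secondMessage t ω k)) fun u =>
                if p.Accepts x.1 t ω c u then (1 : ℝ) else 0 := by
  have f₁ := p.hears_setup (enc := enc) hdec
  have f₂ := p.reads_stream (enc := enc) hdec
  have f₃ := p.sends_first (enc := enc) hdec
  have f₄ := p.hears_challenge (enc := enc) hdec
  have f₅ := p.hears_commit (enc := enc) hdec
  have f₆ := p.sends_second (enc := enc) hdec
  have f₇ := p.hears_reply (enc := enc) hdec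
  have hacc : ∀ st : p.HonestState, indicator (p.verifier enc dec).accept (enc st) =
      if st.h = 0 ∧ st.z = 0 then 1 else 0 := fun st => by
    simp only [indicator, hdec, decide_eq_true_eq]
  generalize p.verifier enc dec = V at f₁ f₂ f₃ f₄ f₅ f₆ f₇ hacc ⊢
  let h₁ : (Fin (p.len + 1) → F) → List (Event F (IndexSymbol F n)) := fun t =>
    (List.ofFn t).map Event.prover ++ (indexStream F n x).map Event.input
  let h₂ : (Fin (p.len + 1) → F) → p.Point → List (Event F (IndexSymbol F n)) := fun t w =>
    h₁ t ++ (List.ofFn w).map Event.verifier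
  let h₃ : (Fin (p.len + 1) → F) → p.Point → p.Point → List (Event F (IndexSymbol F n)) :=
    fun t w k => h₂ t w ++ (List.ofFn k).map Event.prover
  let h₄ : (Fin (p.len + 1) → F) → p.Point → p.Point → (Fin p.deg → F) →
      List (Event F (IndexSymbol F n)) := fun t w k c => h₃ t w k ++ (List.ofFn c).map Event.prover
  refine ⟨speak P [] _, fun t w => speak P (h₂ t w) _, fun t w k => speak P (h₃ t w k) _,
    fun t w k c b => speak P (h₄ t w k c ++ (List.ofFn b).map Event.verifier) _, ?_⟩
  have h1 : (game (verifierPlayer V) (proverStrategy P) 0 V.init []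
      (p.schedule.slots (indexStream F n x))).map (fun o => V.accept o.1) =
      ((game (verifierPlayer V) (proverStrategy P) 0 V.init []
      (p.schedule.slots (indexStream F n x))).map fun o => o.1).map V.accept := by
    rw [PMF.map_comp]; rfl
  rw [acceptProb_eq_game, h1, toReal_map_true, schedule_slots]
  simp only [game_append, interSchedule, List.map_append, List.map_replicate, game_speak,
    game_listen, game_answer, f₁, PMF.map_comp, PMF.bind_map, PMF.bind_bind,
    PMF.map_bind, PMF.pure_map, PMF.pure_bind, Function.comp_def, List.nil_append,
    List.length_replicate, List.length_append, List.length_map, length_indexStream, zero_add,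
    f₂, f₃, f₄, f₅, f₆, f₇]
  simp only [ev_bind, ev_pure, hacc]
  exact congrArg (ev _) (funext fun t => congrArg (ev _) (funext fun ω => congrArg (ev _)
    (funext fun k => congrArg (ev _) (funext fun c => congrArg (ev _)
      (funext fun u => if_congr Iff.rfl rfl rfl)))))

/-- The lines through `a` and a random point, with a random parameter. -/
theorem ev_direction (a : p.Point) (G : p.Point → Fˣ → p.Point → ℝ) :
    (ev (PMF.uniformOfFintype p.Point) fun r => ev (PMF.uniformOfFintype Fˣ) fun ρ =>
      G (p.direction a ρ r) ρ r) =
    ev (PMF.uniformOfFintype p.Point) fun w => ev (PMF.uniformOfFintype Fˣ) fun ρ =>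
      G w ρ (a + (ρ : F) • w) := by
  rw [ev_comm, ev_comm (PMF.uniformOfFintype p.Point)]
  refine congrArg (ev _) (funext fun ρ => ?_)
  -- For fixed nonzero `ρ`, direction and point determine each other, so a uniform point gives a
  -- uniform direction whatever `ρ` is.
  let e : p.Point ≃ p.Point :=
    { toFun := fun w => a + (ρ : F) • w
      invFun := fun r => p.direction a ρ r
      left_inv := fun w => by
        change (ρ : F)⁻¹ • (a + (ρ : F) • w - a) = w
        rw [add_sub_cancel_left, smul_smul, inv_mul_cancel₀ ρ.ne_zero, one_smul]
      right_inv := fun r => p.add_smul_direction a ρ r }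
  rw [← ev_uniform_equiv e]
  refine congrArg (ev _) (funext fun w => ?_)
  have h : p.direction a ρ (e w) = w := e.left_inv w
  rw [h]
  rfl

open Classical in
-- If the reply is the true restriction `M`, then `u 0` is the mask value at `k` and the second
-- check becomes the condition on the right. Otherwise the first check requires `τ` to be a root of
-- the nonzero polynomial `M - U`.
theorem ev_reply_le (t : Fin (p.len + 1) → F) (x : Fin n → F) (r k w : p.Point) (ρ : Fˣ)
    (c : Fin p.deg → F) (u : Fin (p.deg + 1) → F) :
    (ev (PMF.uniformOfFintype Fˣ) fun τ =>
      if p.Accepts x t (r, ρ, k + (τ : F) • w, τ) c u then (1 : ℝ) else 0) ≤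
    p.deg / Fintype.card Fˣ +
      if p.target - lde p.node p.pts x r + ∑ i, c i * (ρ : F) ^ ((i : ℕ) + 1) -
        p.maskValue (p.maskOf t) ρ k = 0 then 1 else 0 := by
  set U : F[X] := ∑ i : Fin (p.deg + 1), C (u i) * X ^ (i : ℕ) with hU
  set M := p.maskLine (p.maskOf t) ρ k w with hM
  have hUe : ∀ τ, U.eval τ = ∑ i, u i * τ ^ (i : ℕ) := fun τ => by
    simp [hU, eval_finsetSum]
  have hUd : U.natDegree ≤ p.deg := natDegree_sum_le_of_forall_le _ _ fun i _ =>
    (natDegree_C_mul_X_pow_le _ _).trans (by omega)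
  have hU0 : U.eval 0 = u 0 := by
    rw [hUe, Finset.sum_eq_single 0]
    · simp
    · intro i _ hi
      rw [zero_pow fun h => hi (Fin.ext h), mul_zero]
    · simp
  by_cases h : M = U
  · refine ev_le_const _ fun τ => ?_
    have h0 : (0 : ℝ) ≤ p.deg / Fintype.card Fˣ := by positivity
    by_cases hacc : p.Accepts x t (r, ρ, k + (τ : F) • w, τ) c u
    · have h2 := hacc.2
      have h3 := p.maskLine_eval (p.maskOf t) ρ k w 0
      rw [zero_smul, add_zero, ← hM, h, hU0] at h3
      rw [h3] at h2
      rw [if_pos hacc, if_pos h2]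
      linarith
    · rw [if_neg hacc]
      split_ifs <;> linarith
  · have h1 := ev_root_le (P := M - U) (sub_ne_zero.2 h)
      ((natDegree_sub_le _ _).trans (max_le (p.maskLine_natDegree _ _ _ _) hUd))
    refine (ev_mono _ fun τ => ?_).trans (h1.trans (le_add_of_nonneg_right ?_))
    · by_cases hacc : p.Accepts x t (r, ρ, k + (τ : F) • w, τ) c u
      · have h2 : (M - U).eval (τ : F) = 0 := by
          rw [eval_sub, hM, p.maskLine_eval, hUe]
          exact hacc.1
        rw [if_pos hacc, if_pos h2]
      · rw [if_neg hacc]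
        split_ifs <;> norm_num
    · split_ifs <;> norm_num

open Classical in
-- Commitment and masks contribute no constant term, so the condition is a polynomial in `ρ` whose
-- value at `0` is `target - x_j`, which is not zero.
theorem ev_commit_le (t : Fin (p.len + 1) → F) (x : IndexInstance F n) (hx : x.1 x.2 ≠ p.target)
    (k w : p.Point) (c : Fin p.deg → F) :
    (ev (PMF.uniformOfFintype Fˣ) fun ρ =>
      if p.target - lde p.node p.pts x.1 (p.point x.2 + (ρ : F) • w) +
        ∑ i, c i * (ρ : F) ^ ((i : ℕ) + 1) - p.maskValue (p.maskOf t) ρ k = 0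
      then (1 : ℝ) else 0) ≤ p.deg / Fintype.card Fˣ := by
  set G : F[X] := C p.target - p.line x.1 (p.point x.2) w +
    ∑ i : Fin p.deg, C (c i) * X ^ ((i : ℕ) + 1) -
    ∑ κ, ∑ l : Fin p.deg, C (p.maskOf t κ l * lag p.node κ k) * X ^ ((l : ℕ) + 1) with hG
  have hGe : ∀ ρ, G.eval ρ = p.target - lde p.node p.pts x.1 (p.point x.2 + ρ • w) +
      ∑ i, c i * ρ ^ ((i : ℕ) + 1) - p.maskValue (p.maskOf t) ρ k := fun ρ => by
    simp only [hG, eval_sub, eval_add, eval_C, p.line_eval, eval_finsetSum, eval_mul, eval_pow,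
      eval_X, maskValue]
    congr 1
    exact Finset.sum_congr rfl fun κ _ => Finset.sum_congr rfl fun l _ => by ring
  have hGd : G.natDegree ≤ p.deg := by
    have h1 : ∀ (v : F) (i : Fin p.deg), (C v * X ^ ((i : ℕ) + 1)).natDegree ≤ p.deg :=
      fun v i => (natDegree_C_mul_X_pow_le _ _).trans (by omega)
    refine (natDegree_sub_le _ _).trans (max_le ((natDegree_add_le _ _).trans (max_le
      ((natDegree_sub_le _ _).trans (max_le ?_ (p.line_natDegree _ _ _))) ?_)) ?_)
    · simp
    · exact natDegree_sum_le_of_forall_le _ _ fun i _ => h1 _ _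
    · exact natDegree_sum_le_of_forall_le _ _ fun κ _ =>
        natDegree_sum_le_of_forall_le _ _ fun i _ => h1 _ _
  have hG0 : G ≠ 0 := by
    intro h
    have h1 : G.eval 0 = p.target - x.1 x.2 := by
      rw [hG]
      simp [eval_finsetSum, p.line_eval_zero]
    rw [h, eval_zero] at h1
    exact hx (sub_eq_zero.1 h1.symm).symm
  refine le_of_eq_of_le ?_ (ev_root_le hG0 hGd)
  simp only [hGe]

theorem sound (hdec : ∀ x, dec (enc x) = x) (x : IndexInstance F n)
    (hx : x.1 x.2 ≠ p.target) (P : Prover F (IndexSymbol F n)) :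
    acceptProb p.schedule P (p.verifier enc dec) (indexStream F n x) ≤
      2 * (p.deg / Fintype.card Fˣ) := by
  classical
  obtain ⟨μ₀, μ₁, μ₂, μ₃, h⟩ := p.acceptProb_verifier hdec x P
  rw [h]
  refine ev_le_const _ fun t => ?_
  set a := p.point x.2
  rw [ev_uniform_prod]
  simp only [ev_uniform_prod]
  -- With the direction `w` as variable in place of the point, `ρ` is independent of everything sent
  -- before the second message; challenge and commitment can then be drawn, and fixed, before `ρ`.
  rw [p.ev_direction a fun w ρ r => ev (PMF.uniformOfFintype p.Point) fun r' =>
    ev (PMF.uniformOfFintype Fˣ) fun τ => ev (μ₁ t w) fun k => ev (μ₂ t w k) fun c =>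
      ev (μ₃ t w k c (p.secondMessage t (r, ρ, r', τ) k)) fun u =>
        if p.Accepts x.1 t (r, ρ, r', τ) c u then (1 : ℝ) else 0]
  refine ev_le_const _ fun w => ?_
  rw [ev_comm₃]
  refine ev_le_const _ fun k => ?_
  rw [ev_comm₃]
  refine ev_le_const _ fun c => ?_
  have key : ∀ ρ : Fˣ, (ev (PMF.uniformOfFintype p.Point) fun r' =>
      ev (PMF.uniformOfFintype Fˣ) fun τ =>
        ev (μ₃ t w k c (p.secondMessage t (a + (ρ : F) • w, ρ, r', τ) k)) fun u =>
          if p.Accepts x.1 t (a + (ρ : F) • w, ρ, r', τ) c u then (1 : ℝ) else 0) ≤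
      p.deg / Fintype.card Fˣ +
      if p.target - lde p.node p.pts x.1 (a + (ρ : F) • w) +
        ∑ i, c i * (ρ : F) ^ ((i : ℕ) + 1) - p.maskValue (p.maskOf t) ρ k = 0 then 1 else 0 := by
    intro ρ
    -- The same change of variables for the second secret: the reply depends on the direction `w'`
    -- but not on `τ`.
    refine le_of_eq_of_le (p.ev_direction k fun w' τ r' =>
      ev (μ₃ t w k c (Fin.cons (ρ : F) (Fin.cons (p.keyOf t (a + (ρ : F) • w)) w'))) fun u =>
        if p.Accepts x.1 t (a + (ρ : F) • w, ρ, r', τ) c u then (1 : ℝ) else 0) ?_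
    refine ev_le_const _ fun w' => ?_
    rw [ev_comm]
    refine ev_le_const _ fun u => ?_
    convert p.ev_reply_le t x.1 (a + (ρ : F) • w) k w' ρ c u
  refine (ev_mono _ key).trans ?_
  rw [ev_add, ev_const, two_mul]
  refine add_le_add le_rfl ?_
  convert p.ev_commit_le t x hx k w c

end Params
end Streaming

namespace Streaming

variable {F : Type u} [Field F] [Fintype F] {n : ℕ}

/-! ### The triplet, with explicit bounds -/

theorem abs_acceptProb_sub_le_one {Γ A : Type u} {s' : ℕ} (D : Distinguisher Γ A s')
    (μ ν : PMF (List (ViewSymbol Γ A))) : |D.acceptProb μ - D.acceptProb ν| ≤ 1 := by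
  have h : ∀ μ, 0 ≤ D.acceptProb μ ∧ D.acceptProb μ ≤ 1 := fun μ =>
    ⟨ENNReal.toReal_nonneg, ENNReal.toReal_mono ENNReal.one_ne_top (PMF.coe_le_one _ _)⟩
  rw [abs_sub_le_iff]
  constructor <;> linarith [(h μ).1, (h μ).2, (h ν).1, (h ν).2]

namespace Params

variable (p : Params F n)

/-- Number of states of the simulator. -/
abbrev simCard (s : ℕ) : ℕ :=
  Fintype.card (SimState s (p.SimMemory s s) (F × F) F p.len)

theorem mul_log_card_le {s : ℕ} (hs : Fintype.card F ^ (2 * p.m + 5) ≤ 2 ^ s) :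
    p.m * Real.log (Fintype.card F) ≤ s := by
  have hq : (1 : ℝ) ≤ Fintype.card F := by exact_mod_cast Fintype.card_pos
  have h1 : ((Fintype.card F : ℝ)) ^ (2 * p.m + 5) ≤ 2 ^ s := by exact_mod_cast hs
  have h2 := Real.log_le_log (by positivity) h1
  rw [Real.log_pow, Real.log_pow] at h2
  have h3 := Real.log_two_lt_d9
  have h4 := Real.log_nonneg hq
  push_cast at h2
  nlinarith [mul_nonneg (Nat.cast_nonneg (α := ℝ) p.m) h4, (Nat.cast_nonneg s : (0 : ℝ) ≤ s)]

/-- The error of `zero_knowledge` at `K = s`, `ε = 1 / √(log q)` and `t = 1 / √N`, where `N` is the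
size of the grid; these choices balance the two terms of each bound up to constants and the size of
the memory. -/
theorem bound_le {s s' : ℕ} (hs : 0 < s) (hN : (n : ℝ) ≤ Fintype.card p.Grid) (hn : (1 : ℝ) ≤ n)
    (hlog : p.m * Real.log (Fintype.card F) ≤ s) :
    (1 / √(Real.log (Fintype.card F)) + (Real.log (Fintype.card (Memory s)) + s * Real.log 2) /
        (1 / √(Real.log (Fintype.card F)) * s * Real.log (Fintype.card F))) +
      (Real.log (Fintype.card (Memory s × (p.Point × (Memory s × Memory s')))) +
        (1 / √(Fintype.card p.Grid)) ^ 2 * Fintype.card p.Grid) /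
        (1 / √(Fintype.card p.Grid) * Fintype.card p.Grid) ≤
    3 / √(Real.log (Fintype.card F)) + (3 * s + s' + 1) / √n := by
  have hl : 0 < Real.log (Fintype.card F) :=
    Real.log_pos (Nat.one_lt_cast.2 Fintype.one_lt_card)
  have hs' : (0 : ℝ) < s := by exact_mod_cast hs
  have hq : (0 : ℝ) < Fintype.card F := by exact_mod_cast Fintype.card_pos
  have h2 := Real.log_two_lt_d9
  have h2' := Real.log_two_gt_d9
  have c1 : Real.log (Fintype.card (Memory s)) = s * Real.log 2 := by
    simp [Memory]
  have c2 : Real.log (Fintype.card (Memory s × (p.Point × (Memory s × Memory s')))) =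
      s * Real.log 2 + (p.m * Real.log (Fintype.card F) + (s * Real.log 2 + s' * Real.log 2)) := by
    simp only [Fintype.card_prod, Fintype.card_fun, Fintype.card_fin, Fintype.card_bool,
      Nat.cast_mul, Nat.cast_pow, Nat.cast_ofNat]
    rw [Real.log_mul (by positivity) (by positivity), Real.log_mul (by positivity) (by positivity),
      Real.log_mul (by positivity) (by positivity)]
    simp only [Real.log_pow]
  rw [c1, c2]
  set N : ℝ := (Fintype.card p.Grid : ℝ)
  set ℓ := Real.log (Fintype.card F)
  have hN0 : 0 < N := by linarith
  have hr : 0 < √ℓ := Real.sqrt_pos.2 hl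
  have hr2 : √ℓ * √ℓ = ℓ := Real.mul_self_sqrt hl.le
  have hM : 0 < √N := Real.sqrt_pos.2 hN0
  have hM2 : √N * √N = N := Real.mul_self_sqrt hN0.le
  refine add_le_add ?_ ?_
  · have : (s * Real.log 2 + s * Real.log 2) / (1 / √ℓ * s * ℓ) = 2 * Real.log 2 / √ℓ := by
      rw [div_eq_div_iff (by positivity) hr.ne']
      field_simp
      nlinarith
    rw [this, ← add_div]
    gcongr
    linarith
  · have d1 : (1 / √N) ^ 2 * N = 1 := by
      rw [div_pow, one_pow, sq, hM2, one_div, inv_mul_cancel₀ hN0.ne']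
    have d2 : 1 / √N * N = √N := by
      rw [one_div, inv_mul_eq_iff_eq_mul₀ hM.ne', hM2]
    rw [d1, d2]
    have hs'' : (0 : ℝ) ≤ s' := Nat.cast_nonneg _
    refine div_le_div₀ (by positivity) ?_ (Real.sqrt_pos.2 (by linarith)) (Real.sqrt_le_sqrt hN)
    nlinarith

theorem exists_triplet {s σ : ℕ} (hs : Fintype.card F ^ (2 * p.m + 5) ≤ 2 ^ s)
    (hσ : p.simCard s ≤ 2 ^ σ) (hdeg : 6 * p.deg + 1 ≤ Fintype.card F) (hn : 0 < n) :
    ∃ Z : Triplet F (IndexSymbol F n) s σ, Z.schedule = p.schedule ∧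
      IsSIP (indexStream F n) (decisionIndex n p.target) Z.schedule Z.prover Z.verifier ∧
      ∀ s', Z.ZeroKnowledge (indexStream F n) (decisionIndex n p.target) s'
        (3 / √(Real.log (Fintype.card F)) + (3 * s + s' + 1) / √n) := by
  classical
  have : Inhabited F := ⟨0⟩
  have hq : 1 < Fintype.card F := Fintype.one_lt_card
  have hs0 : 0 < s := by
    rcases Nat.eq_zero_or_pos s with rfl | h
    · exact absurd hs (not_le.2 (by
        simpa only [pow_zero] using Nat.one_lt_pow (Nat.succ_ne_zero _) hq))
    · exact h
  obtain ⟨enc, dec, hdec⟩ := exists_encoding (T := p.HonestState)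
    -- Two points and five scalars: `2 * m + 5` field elements, whence the exponent in `hs`.
    (U := p.Point × p.Point × F × F × F × F × F)
    (fun t => (t.a, t.b, t.ρ, t.τ, t.e, t.h, t.z))
    (fun t t' h => by
      simp only [Prod.mk.injEq] at h
      obtain ⟨h1, h2, h3, h4, h5, h6, h7⟩ := h
      exact HonestState.ext h1 h2 h3 h4 h5 h6 h7)
    (s := s) (by
      refine le_of_eq_of_le ?_ hs
      simp only [Fintype.card_prod, Fintype.card_fun, Fintype.card_fin]
      ring)
  obtain ⟨enc', dec', hdec'⟩ := exists_encoding
    (T := SimState s (p.SimMemory s s) (F × F) F p.len) id Function.injective_id hσ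
  -- The only use of white-box access besides following the memory of `V`: the points `b` are a
  -- function of its strategy.
  choose b hb using fun V : Verifier F (IndexSymbol F n) s =>
    p.zero_knowledge V hs0 (ε := 1 / √(Real.log (Fintype.card F)))
      (by have := Real.log_pos (Nat.one_lt_cast.2 hq : (1 : ℝ) < Fintype.card F); positivity)
  refine ⟨⟨p.schedule, p.prover, p.verifier enc dec, fun V =>
    (p.simSpec (b V) V.init).toSimulator V enc' dec'⟩, rfl, ⟨fun x hx => ?_, fun x hx P => ?_⟩, ?_⟩
  · refine le_of_le_of_eq ?_ (p.complete hdec x hx).symm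
    norm_num
  · refine (p.sound hdec x hx P).trans ?_
    rw [Fintype.card_units]
    have h1 : ((Fintype.card F - 1 : ℕ) : ℝ) = Fintype.card F - 1 := by
      push_cast [Nat.cast_sub hq.le]; ring
    have h2 : (6 : ℝ) * p.deg + 1 ≤ Fintype.card F := by exact_mod_cast hdeg
    have h3 : (1 : ℝ) < Fintype.card F := by exact_mod_cast hq
    -- `6 * deg ≤ q - 1` is exactly `2 * deg / (q - 1) ≤ 1 / 3`.
    rw [h1, ← mul_div_assoc, div_le_iff₀ (by linarith)]
    linarith
  · intro s' V D x hx
    have e1 : D.acceptProb (view p.schedule p.prover V (indexStream F n x)) =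
        ev ((game (viewPlayer V D) (proverStrategy p.prover) 0 (V.init, D.init) []
          (p.schedule.slots (indexStream F n x))).map fun o => o.1)
          (indicator fun q => D.accept q.2) := by
      rw [distinguisher_acceptProb_view, ← toReal_map_true, PMF.map_comp]
      rfl
    have e2 : D.acceptProb (((p.simSpec (b V) V.init).toSimulator V enc' dec').view V.coins
        p.schedule (indexStream F n x)) =
        ev ((PMF.uniformOfFintype (Fin (p.len + 1) → F)).bind fun t =>
          (game (viewPlayer V D) ((p.simSpec (b V) V.init).strategy t) 0 (V.init, D.init)
            (p.simSpec (b V) V.init).init (p.schedule.slots (indexStream F n x))).map fun o => o.1)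
          (indicator fun q => D.accept q.2) := by
      rw [SimSpec.acceptProb_view (p.simSpec (b V) V.init) V enc' dec' hdec', ← toReal_map_true,
        PMF.map_bind]
      simp only [PMF.map_comp]
      rfl
    have e3 := fun t => p.game_simSpec (viewPlayer V D) (b V) (V.init, D.init) t x
    refine (congrArg₂ (fun a b => |a - b|) e1 (e2.trans (congrArg
      (fun μ => ev (PMF.bind _ μ) _) (funext e3)))).trans_le ?_
    rw [p.game_prover]
    have hN : (n : ℝ) ≤ Fintype.card p.Grid := by
      exact_mod_cast (Fintype.card_fin n).symm.le.trans (Fintype.card_le_of_embedding p.pts)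
    have hn' : (1 : ℝ) ≤ n := by exact_mod_cast hn
    refine (hb V s' D x hx (1 / √(Fintype.card p.Grid)) (by positivity) ?_).trans ?_
    · rw [div_le_one (by positivity), Real.one_le_sqrt]
      exact hn'.trans hN
    · exact p.bound_le hs0 hN hn' (p.mul_log_card_le hs)

end Params

/-! ### The trivial protocol -/

/-- The protocol without messages, in which the verifier stores its input. -/
theorem exists_trivial_triplet (F : Type u) [Fintype F] [Nonempty F] (n : ℕ) (α : F) :
    ∃ Z : Triplet F (IndexSymbol F n) (n * Nat.clog 2 (Fintype.card F) + 1) 0,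
      Z.schedule = ⟨0, []⟩ ∧
      IsSIP (indexStream F n) (decisionIndex n α) Z.schedule Z.prover Z.verifier := by
  classical
  obtain ⟨enc, dec, hdec⟩ := exists_encoding (T := (Fin n → F) × Bool) id Function.injective_id
    (s := n * Nat.clog 2 (Fintype.card F) + 1) (by
      rw [Fintype.card_prod, Fintype.card_fun, Fintype.card_fin, Fintype.card_bool, pow_succ,
        mul_comm n, pow_mul]
      gcongr
      exact Nat.le_pow_clog (by norm_num) _)
  obtain ⟨f₀⟩ := ‹Nonempty F›
  let V : Verifier F (IndexSymbol F n) (n * Nat.clog 2 (Fintype.card F) + 1) :=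
    { coins := 0
      init := enc (fun _ => f₀, false)
      hear := fun _ m _ _ => m
      read := fun i m _ a => enc (match a with
        | .inl v => (fun k => if (k : ℕ) = i then v else (dec m).1 k, (dec m).2)
        | .inr j => ((dec m).1, decide ((dec m).1 j = α)))
      send := fun _ m _ => (f₀, m)
      accept := fun m => (dec m).2 }
  have hread : ∀ i m a, (verifierPlayer V).read i m a = PMF.pure (V.read i m 0 a) :=
    fun i m a => by
      rw [verifierPlayer_read]
      exact PMF.map_const _ _
  have key : ∀ (P : Prover F (IndexSymbol F n)) (x : IndexInstance F n),
      acceptProb ⟨0, []⟩ P V (indexStream F n x) = if x.1 x.2 = α then 1 else 0 := by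
    intro P x
    have h1 : (⟨0, []⟩ : Schedule).slots (indexStream F n x) =
        (indexStream F n x).map Slot.input := by
      simp [Schedule.slots]
    set S : ℕ → (Fin n → F) × Bool := fun k =>
      (fun l => if (l : ℕ) < k then x.1 l else f₀, false) with hS
    have h2 := reads_pure (verifierPlayer V) 0
      (fun i : Fin n => (Sum.inl (x.1 i) : IndexSymbol F n)) (fun k => enc (S k)) fun k => by
        rw [hread]
        simp only [V, hdec, hS, zero_add]
        congr 3
        ext l
        rcases lt_trichotomy (l : ℕ) k with h | h | h
        · rw [if_neg (by omega), if_pos h, if_pos (by omega)]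
        · rw [if_pos h, if_pos (by omega), Fin.ext h]
        · rw [if_neg (by omega), if_neg (by omega), if_neg (by omega)]
    have h0 : V.init = enc (S 0) := by simp [V, hS]
    rw [acceptProb_eq_game, h1, game_listen, indexStream, reads_append, h0, h2, PMF.pure_bind,
      reads, hread, PMF.pure_bind, reads]
    simp only [PMF.pure_map, V, hdec, hS, Fin.is_lt, if_true]
    by_cases h : x.1 x.2 = α <;> simp [h]
  -- Any prover and simulator will do: there are no messages, and this protocol is used only with
  -- the vacuous error `1`.
  refine ⟨⟨⟨0, []⟩, fun _ => PMF.pure f₀, V, fun _ =>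
    ⟨0, 0, Fin.elim0, fun _ _ => 0, fun _ m _ => PMF.pure m, fun _ _ => f₀,
      fun _ m _ => PMF.pure m⟩⟩, rfl, ⟨fun x hx => ?_, fun x hx P => ?_⟩⟩
  · refine le_of_le_of_eq ?_ ((key _ x).trans (if_pos hx)).symm
    norm_num
  · refine ((key P x).trans (if_neg hx)).trans_le ?_
    norm_num

end Streaming

namespace Streaming

variable {F : Type u} [Field F] [Fintype F] {n : ℕ}

namespace Params

variable (p : Params F n)

/-! ### The protocol for each `n`, with its costs -/

theorem len_add_one_eq : p.len + 1 = Fintype.card F ^ p.m + p.d ^ p.m * p.deg := by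
  rw [len_add_one]
  simp only [keyLen, maskLen, Fintype.card_prod, Fintype.card_fun, Fintype.card_fin]

theorem simCard_le {s : ℕ} (hdeg : 6 * p.deg + 1 ≤ Fintype.card F) :
    p.simCard s ≤ 2 ^ (2 * s + Nat.clog 2 (Fintype.card F) * (s + 2 * p.m + p.interLen + 5)) := by
  have hq : 2 ≤ Fintype.card F := Fintype.one_lt_card
  have hd : p.d ≤ Fintype.card F := by
    simpa using Fintype.card_le_of_embedding p.node
  have hlen : p.len + 1 ≤ Fintype.card F ^ (p.m + 2) := by
    rw [len_add_one_eq]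
    calc _ ≤ Fintype.card F ^ p.m + Fintype.card F ^ p.m * Fintype.card F := by
          gcongr
          omega
      _ = Fintype.card F ^ p.m * (1 + Fintype.card F) := by ring
      _ ≤ Fintype.card F ^ p.m * (Fintype.card F ^ 2) := by
          gcongr
          nlinarith
      _ = _ := by ring
  have hc : p.simCard s = 2 ^ (2 * s) *
      (Fintype.card F ^ (s + p.m + p.interLen + 3) * (p.len + 1)) := by
    simp only [simCard, Fintype.card_prod, Fintype.card_fun, Fintype.card_fin, Fintype.card_bool]
    ring
  rw [hc]
  calc _ ≤ 2 ^ (2 * s) * (Fintype.card F ^ (s + p.m + p.interLen + 3) *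
        Fintype.card F ^ (p.m + 2)) := by gcongr
    _ = 2 ^ (2 * s) * Fintype.card F ^ (s + 2 * p.m + p.interLen + 5) := by ring
    _ ≤ 2 ^ (2 * s) * (2 ^ Nat.clog 2 (Fintype.card F)) ^ (s + 2 * p.m + p.interLen + 5) := by
        gcongr
        exact Nat.le_pow_clog (by norm_num) _
    _ = _ := by ring

end Params

/-- Admissible parameters. -/
structure Admissible (q n d m k : ℕ) : Prop where
  pos : 0 < n
  base : 0 < d
  grid : n ≤ d ^ m
  node : d ≤ q
  deg : 6 * (m * d) + 1 ≤ q
  card : q ≤ ((2 * m + 5) * Nat.clog 2 q + 2) ^ k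

/-- Costs and error are chosen before `α`, so they are uniform in it. Their values matter only in
the admissible range; elsewhere the trivial protocol keeps the unconditional clauses true. -/
theorem exists_protocol (F : Type u) [Field F] [Fintype F] (n d m k : ℕ) :
    ∃ (s σ c₁ c₂ : ℕ) (ε : ℕ → ℝ), σ ≤ (s + 2) ^ (k + 6) ∧
      (∀ α : F, ∃ Z : Triplet F (IndexSymbol F n) s σ,
        Z.schedule.setupBits F ≤ c₁ ∧ Z.schedule.interactiveBits F ≤ c₂ ∧
        IsSIP (indexStream F n) (decisionIndex n α) Z.schedule Z.prover Z.verifier ∧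
        ∀ s', Z.ZeroKnowledge (indexStream F n) (decisionIndex n α) s' (ε s')) ∧
      (Admissible (Fintype.card F) n d m k →
        s = (2 * m + 5) * Nat.clog 2 (Fintype.card F) ∧
        c₁ = (Fintype.card F ^ m + d ^ m * (m * d)) * Nat.clog 2 (Fintype.card F) ∧
        c₂ = (3 * m + 3 + 2 * (m * d)) * Nat.clog 2 (Fintype.card F) ∧
        ε = fun s' : ℕ => 3 / √(Real.log (Fintype.card F)) + (3 * s + s' + 1) / √n) := by
  by_cases h : Admissible (Fintype.card F) n d m k
  · set q := Fintype.card F with hq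
    have hq2 : 1 < q := Fintype.one_lt_card
    set Q := Nat.clog 2 q with hQ
    have hQ1 : 1 ≤ Q := Nat.clog_pos (by norm_num) hq2
    set s := (2 * m + 5) * Q with hs
    have hσ : 2 * s + Q * (s + 2 * m + (m + m + m * d + (m + 2) + (m * d + 1)) + 5) ≤
        (s + 2) ^ (k + 6) := by
      have h1 : Q ≤ s := Nat.le_mul_of_pos_left _ (by omega)
      have h2 : m ≤ s := by nlinarith
      -- The simulator stores all messages, about `q` symbols; `Admissible.card` makes this
      -- polynomial in `s`.
      have h3 : m * d ≤ (s + 2) ^ k := (by have := h.deg; omega : m * d ≤ q).trans h.card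
      have h4 : 1 ≤ (s + 2) ^ k := Nat.one_le_pow _ _ (by omega)
      have h5 : 2 ^ 4 ≤ (s + 2) ^ 4 := Nat.pow_le_pow_left (by omega) _
      calc _ ≤ 2 * s + s * (s + 2 * s + (s + s + (s + 2) ^ k + (s + 2) + ((s + 2) ^ k + 1)) + 5) :=
            by gcongr
        _ ≤ 2 ^ 4 * ((s + 2) ^ k * (s + 2) ^ 2) := by
            set S := (s + 2) ^ k
            nlinarith [Nat.zero_le (S * s), Nat.zero_le (S * s * s), Nat.mul_le_mul_right s h4,
              Nat.mul_le_mul_right (s * s) h4]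
        _ ≤ (s + 2) ^ 4 * ((s + 2) ^ k * (s + 2) ^ 2) := by gcongr
        _ = _ := by ring
    obtain ⟨node⟩ : Nonempty (Fin d ↪ F) :=
      Function.Embedding.nonempty_of_card_le (by simpa using h.node)
    obtain ⟨pts⟩ : Nonempty (Fin n ↪ (Fin m → Fin d)) :=
      Function.Embedding.nonempty_of_card_le (by simpa using h.grid)
    refine ⟨s, _, _, _, _, hσ, fun α => ?_, fun _ => ⟨rfl, rfl, rfl, rfl⟩⟩
    let p : Params F n := ⟨m, d, h.base, node, pts, α⟩
    obtain ⟨Z, h1, h2, h3⟩ := p.exists_triplet (s := s)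
      (σ := 2 * s + Q * (s + 2 * m + (m + m + m * d + (m + 2) + (m * d + 1)) + 5))
      (by
        rw [hs, mul_comm (2 * m + 5), pow_mul]
        exact Nat.pow_le_pow_left (Nat.le_pow_clog (by norm_num) q) _)
      (p.simCard_le h.deg) h.deg h.pos
    refine ⟨Z, ?_, ?_, h2, h3⟩
    · rw [h1, Schedule.setupBits]
      exact Nat.mul_le_mul_right _ p.len_add_one_eq.le
    · rw [h1, Schedule.interactiveBits]
      refine Nat.mul_le_mul_right _ (le_of_eq ?_)
      simp only [Params.schedule, interSchedule, List.length_append, List.length_replicate, p,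
        Params.deg]
      ring
  · refine ⟨n * Nat.clog 2 (Fintype.card F) + 1, 0, 0, 0, fun _ => 1, Nat.zero_le _, fun α => ?_,
      fun h' => absurd h' h⟩
    obtain ⟨Z, h1, h2⟩ := exists_trivial_triplet F n α
    refine ⟨Z, ?_, ?_, h2, fun s' V D x _ => abs_acceptProb_sub_le_one _ _ _⟩
    · simp [h1, Schedule.setupBits]
    · simp [h1, Schedule.interactiveBits]

end Streaming

namespace Streaming

/-! ### Choice of the parameters -/

open Real

/-- The side of the grid. -/
def side (β : ℝ) (n : ℕ) : ℕ := ⌈logb 2 n ^ β⌉₊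

/-- The dimension of the grid. -/
def dim (β : ℝ) (n : ℕ) : ℕ := Nat.clog (side β n) n

/-- The range of `n` in which the parameters are admissible. -/
structure Regime (q n : ℕ) (β c C : ℝ) : Prop where
  two_le : 2 ≤ β
  c_pos : 0 < c
  one_le_C : 1 ≤ C
  lower : c * logb 2 n ^ (1 + β) ≤ q
  upper : q ≤ C * logb 2 n ^ (1 + β)
  loglog : 1 ≤ logb 2 (logb 2 n)
  loglog_C : logb 2 C + 1 ≤ logb 2 (logb 2 n)
  loglog_c : 36 / c ≤ logb 2 (logb 2 n)
  log_c : 36 / c ≤ logb 2 n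
  log_pos : 2 ≤ logb 2 n
  pos : 1 < n

namespace Regime

variable {q n : ℕ} {β c C : ℝ} (h : Regime q n β c C)
include h

theorem loglog_le : logb 2 (logb 2 n) ≤ logb 2 n := by
  have h0 := h.log_pos
  have h1 := Real.log_le_sub_one_of_pos (Real.sqrt_pos.2 (by linarith : 0 < logb 2 n))
  have h2 := Real.log_two_gt_d9
  have h3 := Real.mul_self_sqrt (by linarith : 0 ≤ logb 2 n)
  rw [Real.log_sqrt (by linarith)] at h1
  rw [logb, div_le_iff₀ (by linarith)]
  nlinarith [sq_nonneg (√(logb 2 n) - 3 / 2)]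

theorem one_le_rpow : 1 ≤ logb 2 n ^ β :=
  Real.one_le_rpow (by linarith [h.log_pos]) (by linarith [h.two_le])

theorem rpow_one_add : logb 2 n ^ (1 + β) = logb 2 n * logb 2 n ^ β := by
  rw [rpow_add (by linarith [h.log_pos]), rpow_one]

theorem le_side : logb 2 n ^ β ≤ side β n := Nat.le_ceil _

theorem side_le : side β n ≤ 2 * logb 2 n ^ β := by
  have := Nat.ceil_lt_add_one (zero_le_one.trans h.one_le_rpow)
  have := h.one_le_rpow
  rw [side]
  linarith

theorem one_lt_side : 1 < side β n := by
  have h1 : (1 : ℝ) < side β n := lt_of_lt_of_le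
    (one_lt_rpow (by linarith [h.log_pos]) (by linarith [h.two_le])) h.le_side
  exact_mod_cast h1

theorem one_le_dim : 1 ≤ dim β n := Nat.clog_pos h.one_lt_side h.pos

theorem grid : n ≤ side β n ^ dim β n := Nat.le_pow_clog h.one_lt_side _

theorem side_pow_le : side β n ^ (dim β n - 1) ≤ n :=
  (Nat.pow_pred_clog_lt_self h.one_lt_side h.pos).le

theorem le_logb_side : β * logb 2 (logb 2 n) ≤ logb 2 (side β n) := by
  rw [← logb_rpow_eq_mul_logb_of_pos (by linarith [h.log_pos])]
  exact logb_le_logb_of_le (by norm_num) (by linarith [h.one_le_rpow]) h.le_side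

/-- The dimension is rounded up, so it is `side ^ (dim - 1)`, not `side ^ dim`, that is bounded by
`n`. -/
theorem dim_mul_le : ((dim β n : ℝ) - 1) * (β * logb 2 (logb 2 n)) ≤ logb 2 n := by
  have h1 : ((side β n : ℝ)) ^ (dim β n - 1) ≤ n := by exact_mod_cast h.side_pow_le
  have h0 : (0 : ℝ) < side β n := by linarith [h.one_le_rpow, h.le_side]
  have h2 := logb_le_logb_of_le (b := 2) (by norm_num) (by positivity) h1
  rw [logb_pow, Nat.cast_sub h.one_le_dim, Nat.cast_one] at h2
  have h3 : (1 : ℝ) ≤ dim β n := by exact_mod_cast h.one_le_dim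
  exact (mul_le_mul_of_nonneg_left h.le_logb_side (by linarith)).trans h2

/-- The degree is of order `log ^ (1 + β) n / log log n`; the factor `log log n` eventually absorbs
the constant `c` in the lower bound for `q`. The constant `36` leaves room for the rounding of side
and dimension. -/
theorem deg_le : 6 * (dim β n * side β n) + 1 ≤ q := by
  have h1 : (1 : ℝ) ≤ dim β n := by exact_mod_cast h.one_le_dim
  set L := logb 2 n
  set ℓ := logb 2 L
  set A := L ^ β
  set μ : ℝ := dim β n - 1 with hμ
  have hc := h.c_pos
  have hA : 1 ≤ A := h.one_le_rpow
  have hL : 36 ≤ L * c := (div_le_iff₀ hc).1 h.log_c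
  have hℓ : 36 ≤ ℓ * c := (div_le_iff₀ hc).1 h.loglog_c
  have hℓ0 : 1 ≤ ℓ := h.loglog
  have hm : 36 * μ ≤ c * L := by
    have h2 : μ * (β * ℓ) ≤ L := h.dim_mul_le
    have h3 : ℓ ≤ β * ℓ := by nlinarith [h.two_le]
    have h4 : μ * ℓ ≤ L := (mul_le_mul_of_nonneg_left h3 (by linarith)).trans h2
    nlinarith
  have hq : c * (L * A) ≤ q := by
    have := h.lower
    rwa [h.rpow_one_add] at this
  have hd := h.side_le
  have : (6 * (dim β n * side β n) + 1 : ℝ) ≤ q := by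
    have e1 : (dim β n : ℝ) * side β n ≤ (μ + 1) * (2 * A) := by
      rw [hμ, sub_add_cancel]
      exact mul_le_mul_of_nonneg_left hd (by linarith)
    have e2 : 36 * μ * A ≤ c * L * A := mul_le_mul_of_nonneg_right hm (by linarith)
    have e3 : 36 * A ≤ L * c * A := mul_le_mul_of_nonneg_right hL (by linarith)
    linarith
  exact_mod_cast this

theorem side_le_card : side β n ≤ q := by
  have := h.deg_le
  have := Nat.le_mul_of_pos_left (side β n) h.one_le_dim
  omega

theorem card_pos : (0 : ℝ) < q := by
  have := h.deg_le
  exact_mod_cast (by omega : 0 < q)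

theorem logb_card_le : logb 2 q ≤ logb 2 C + (1 + β) * logb 2 (logb 2 n) := by
  have h0 : 0 < logb 2 n := by linarith [h.log_pos]
  have h1 := logb_le_logb_of_le (b := 2) (by norm_num) h.card_pos h.upper
  rwa [logb_mul (by linarith [h.one_le_C]) (rpow_pos_of_pos h0 _).ne',
    logb_rpow_eq_mul_logb_of_pos h0] at h1

theorem clog_le : (Nat.clog 2 q : ℝ) ≤ (2 + β) * logb 2 (logb 2 n) := by
  have h1 : (1 : ℝ) ≤ q := by exact_mod_cast (by have := h.deg_le; omega : 1 ≤ q)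
  rw [← natCeil_logb_natCast]
  have h2 := Nat.ceil_lt_add_one (logb_nonneg (b := 2) (by norm_num) h1)
  have := h.logb_card_le
  have := h.loglog_C
  push_cast at h2 ⊢
  linarith

/-- A field element takes `O(log log n)` bits and the dimension is `O(log n / log log n)`; the
product is `O(log n)`. -/
theorem space_le :
    (((2 * dim β n + 5) * Nat.clog 2 q : ℕ) : ℝ) ≤ 8 * (2 + β) * logb 2 n := by
  have h1 := h.clog_le
  have h2 := h.dim_mul_le
  have h3 := h.loglog_le
  have h4 := h.loglog
  have h5 := h.two_le
  have h6 : (1 : ℝ) ≤ dim β n := by exact_mod_cast h.one_le_dim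
  set ℓ := logb 2 (logb 2 n)
  set L := logb 2 n
  push_cast
  calc (2 * (dim β n : ℝ) + 5) * Nat.clog 2 q ≤ (2 * (dim β n : ℝ) + 5) * ((2 + β) * ℓ) := by
        gcongr
    _ = (2 + β) * (((dim β n : ℝ) - 1) * (2 * ℓ) + 7 * ℓ) := by ring
    _ ≤ (2 + β) * (L + 7 * L) := by
        have : ((dim β n : ℝ) - 1) * (2 * ℓ) ≤ L :=
          (mul_le_mul_of_nonneg_left (mul_le_mul_of_nonneg_right h5 (by linarith))
            (by linarith)).trans h2
        gcongr
    _ = _ := by ring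

theorem le_space : logb 2 n ≤ ((2 * dim β n + 5) * Nat.clog 2 q : ℕ) := by
  have h1 : n ≤ 2 ^ ((2 * dim β n + 5) * Nat.clog 2 q) := by
    calc n ≤ side β n ^ dim β n := h.grid
      _ ≤ q ^ dim β n := Nat.pow_le_pow_left h.side_le_card _
      _ ≤ q ^ (2 * dim β n + 5) := Nat.pow_le_pow_right (by have := h.deg_le; omega) (by omega)
      _ ≤ (2 ^ Nat.clog 2 q) ^ (2 * dim β n + 5) :=
        Nat.pow_le_pow_left (Nat.le_pow_clog (by norm_num) _) _
      _ = _ := by rw [← pow_mul, mul_comm]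
  have h2 : (n : ℝ) ≤ 2 ^ ((2 * dim β n + 5) * Nat.clog 2 q) := by exact_mod_cast h1
  have h3 := logb_le_logb_of_le (b := 2) (by norm_num)
    (by exact_mod_cast (by have := h.pos; omega : 0 < n)) h2
  rwa [logb_pow, logb_self_eq_one (by norm_num), mul_one] at h3

theorem card_le_space : q ≤ ((2 * dim β n + 5) * Nat.clog 2 q + 2) ^ (⌈C⌉₊ + ⌈1 + β⌉₊) := by
  set s := (2 * dim β n + 5) * Nat.clog 2 q with hs
  have h1 : logb 2 n ≤ s := h.le_space
  have h2 : C ≤ ((s : ℝ) + 2) ^ ⌈C⌉₊ := by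
    calc C ≤ ⌈C⌉₊ := Nat.le_ceil _
      _ ≤ (2 : ℝ) ^ ⌈C⌉₊ := by exact_mod_cast Nat.lt_two_pow_self.le
      _ ≤ _ := by gcongr; linarith [(Nat.cast_nonneg s : (0 : ℝ) ≤ s)]
  have h3 : logb 2 n ^ (1 + β) ≤ ((s : ℝ) + 2) ^ ⌈1 + β⌉₊ := by
    rw [← rpow_natCast]
    have hs0 : (0 : ℝ) ≤ s := Nat.cast_nonneg s
    calc _ ≤ ((s : ℝ) + 2) ^ (1 + β) :=
          rpow_le_rpow (by linarith [h.log_pos]) (by linarith) (by linarith [h.two_le])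
      _ ≤ _ := rpow_le_rpow_of_exponent_le (by linarith) (Nat.le_ceil _)
  have : (q : ℝ) ≤ ((s : ℝ) + 2) ^ (⌈C⌉₊ + ⌈1 + β⌉₊) := by
    rw [pow_add]
    refine h.upper.trans (mul_le_mul h2 h3 (rpow_nonneg (by linarith [h.log_pos]) _) ?_)
    positivity
  exact_mod_cast this

theorem admissible : Admissible q n (side β n) (dim β n) (⌈C⌉₊ + ⌈1 + β⌉₊) where
  pos := by have := h.pos; omega
  base := by have := h.one_lt_side; omega
  grid := h.grid
  node := h.side_le_card
  deg := h.deg_le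
  card := h.card_le_space

/-- Up to constants `q` is `side ^ ((1 + β) / β)`, which would give the exponent `1 + δ / 2`. By
`hC` the constant `C` costs at most half a power of `log n`, that is, another `1 / (2 * β) = δ / 4`.
-/
theorem card_pow_le {δ : ℝ} (hδ : β * δ = 2) (hC : 2 * logb 2 C ≤ logb 2 (logb 2 n)) :
    (q : ℝ) ^ (dim β n - 1) ≤ (n : ℝ) ^ (1 + 3 / 4 * δ) := by
  have hn : (0 : ℝ) < n := by exact_mod_cast (by have := h.pos; omega : 0 < n)
  have hq := h.card_pos
  have h2 := h.dim_mul_le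
  have h6 : (1 : ℝ) ≤ dim β n := by exact_mod_cast h.one_le_dim
  have hδ0 : 0 < δ := by nlinarith [h.two_le]
  rw [← logb_le_logb (b := 2) (by norm_num) (by positivity) (by positivity), logb_pow,
    logb_rpow_eq_mul_logb_of_pos hn, Nat.cast_sub h.one_le_dim, Nat.cast_one]
  set ℓ := logb 2 (logb 2 n)
  set L := logb 2 n
  have hμ : 0 ≤ (dim β n : ℝ) - 1 := by linarith
  calc ((dim β n : ℝ) - 1) * logb 2 q ≤ ((dim β n : ℝ) - 1) * (logb 2 C + (1 + β) * ℓ) :=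
        mul_le_mul_of_nonneg_left h.logb_card_le hμ
    _ ≤ ((dim β n : ℝ) - 1) * (ℓ / 2 + (1 + β) * ℓ) :=
        mul_le_mul_of_nonneg_left (by linarith) hμ
    _ = ((dim β n : ℝ) - 1) * (β * ℓ) * (1 + 3 / 4 * δ) := by
        linear_combination (-(3 / 4) * ((dim β n : ℝ) - 1) * ℓ) * hδ
    _ ≤ L * (1 + 3 / 4 * δ) := mul_le_mul_of_nonneg_right h2 (by linarith)
    _ = _ := mul_comm _ _

theorem clog_le_card : Nat.clog 2 q ≤ q := Nat.clog_le_of_le_pow Nat.lt_two_pow_self.le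

theorem setup_le {δ : ℝ} (hδ : β * δ = 2) (hC : 2 * logb 2 C ≤ logb 2 (logb 2 n))
    (hq : (q : ℝ) ^ 3 ≤ (n : ℝ) ^ (δ / 4)) :
    (((q ^ dim β n + side β n ^ dim β n * (dim β n * side β n)) * Nat.clog 2 q : ℕ) : ℝ) ≤
      2 * (n : ℝ) ^ (1 + δ) := by
  have hn : (1 : ℝ) ≤ n := by exact_mod_cast h.pos.le
  have hδ0 : 0 < δ := by nlinarith [h.two_le]
  have hq1 : (1 : ℝ) ≤ q := by exact_mod_cast (by have := h.deg_le; omega : 1 ≤ q)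
  obtain ⟨μ, hμ⟩ : ∃ μ, dim β n = μ + 1 := ⟨dim β n - 1, by have := h.one_le_dim; omega⟩
  -- The rounding of the dimension, the degree and the bits per symbol each cost at most a factor
  -- `q`; together `q ^ 3`, which fits into the remaining `n ^ (δ / 4)`.
  have h1 : (q ^ dim β n + side β n ^ dim β n * (dim β n * side β n)) * Nat.clog 2 q ≤
      q ^ 3 * q ^ (dim β n - 1) + q ^ 3 * n := by
    calc _ ≤ (q ^ dim β n + (side β n ^ (dim β n - 1) * side β n) * q) * q := by
          gcongr
          · rw [← pow_succ, hμ, Nat.add_sub_cancel]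
          · have := h.deg_le; omega
          · exact h.clog_le_card
      _ ≤ (q ^ dim β n + (n * q) * q) * q := by
          gcongr
          · exact h.side_pow_le
          · exact h.side_le_card
      _ = q ^ 2 * q ^ (dim β n - 1) + q ^ 3 * n := by
          rw [hμ, Nat.add_sub_cancel]; ring
      _ ≤ _ := by
          gcongr
          · have := h.deg_le; omega
          · norm_num
  have h2 := h.card_pow_le hδ hC
  calc _ ≤ (q : ℝ) ^ 3 * (q : ℝ) ^ (dim β n - 1) + (q : ℝ) ^ 3 * n := by exact_mod_cast h1
    _ ≤ (n : ℝ) ^ (δ / 4) * (n : ℝ) ^ (1 + 3 / 4 * δ) + (n : ℝ) ^ (δ / 4) * n := by gcongr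
    _ = (n : ℝ) ^ (1 + δ) + (n : ℝ) ^ (δ / 4 + 1) := by
        rw [← rpow_add (by linarith), rpow_add_one (by linarith)]
        ring_nf
    _ ≤ (n : ℝ) ^ (1 + δ) + (n : ℝ) ^ (1 + δ) := by
        gcongr 1
        exact rpow_le_rpow_of_exponent_le hn (by linarith)
    _ = _ := by ring

theorem dim_le : (dim β n : ℝ) ≤ logb 2 n + 1 := by
  have h2 := h.dim_mul_le
  have h6 : (1 : ℝ) ≤ dim β n := by exact_mod_cast h.one_le_dim
  have h3 : 1 ≤ β * logb 2 (logb 2 n) := by nlinarith [h.two_le, h.loglog]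
  nlinarith

theorem interactive_le :
    (((3 * dim β n + 3 + 2 * (dim β n * side β n)) * Nat.clog 2 q : ℕ) : ℝ) ≤
      (9 + 2 * C) * C * logb 2 n ^ (2 * ⌈1 + β⌉₊) := by
  set K := ⌈1 + β⌉₊
  have hL := h.log_pos
  have hC := h.one_le_C
  have h1 : (q : ℝ) ≤ C * logb 2 n ^ K := by
    refine h.upper.trans ?_
    rw [← rpow_natCast]
    gcongr
    · linarith
    · exact Nat.le_ceil _
  have h2 : logb 2 n ≤ logb 2 n ^ K :=
    le_self_pow₀ (by linarith) (Nat.ceil_pos.2 (by linarith [h.two_le])).ne'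
  have h3 := h.dim_le
  have h4 : ((dim β n * side β n : ℕ) : ℝ) ≤ q := by
    exact_mod_cast (by have := h.deg_le; omega : dim β n * side β n ≤ q)
  have h5 : (Nat.clog 2 q : ℝ) ≤ q := by exact_mod_cast h.clog_le_card
  have hK : 0 ≤ logb 2 n ^ K := by linarith
  push_cast at h4 ⊢
  calc _ ≤ (9 * logb 2 n ^ K + 2 * (C * logb 2 n ^ K)) * (C * logb 2 n ^ K) := by
        refine mul_le_mul ?_ (h5.trans h1) (Nat.cast_nonneg _) (by positivity)
        linarith
    _ = _ := by rw [two_mul K, pow_add]; ring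

end Regime

/-! ### Asymptotics -/

theorem tendsto_logb_nat : Tendsto (fun n : ℕ => logb 2 (n : ℝ)) atTop atTop :=
  (tendsto_logb_atTop (by norm_num)).comp tendsto_natCast_atTop_atTop

theorem isLittleO_logb_rpow (a : ℝ) {r : ℝ} (hr : 0 < r) :
    (fun n : ℕ => logb 2 (n : ℝ) ^ a) =o[atTop] fun n : ℕ => (n : ℝ) ^ r := by
  have h := (isLittleO_log_rpow_rpow_atTop a hr).comp_tendsto tendsto_natCast_atTop_atTop
  refine (h.const_mul_left ((log 2 ^ a)⁻¹)).congr' ?_ EventuallyEq.rfl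
  filter_upwards [eventually_ge_atTop 1] with n hn
  have hn' : (1 : ℝ) ≤ n := by exact_mod_cast hn
  simp only [Function.comp_apply, logb]
  rw [div_rpow (log_nonneg hn') (log_nonneg (by norm_num)), div_eq_inv_mul]

theorem eventually_regime {q : ℕ → ℕ} {β : ℝ} (hβ : 2 ≤ β)
    (hq : (fun n => (q n : ℝ)) =Θ[atTop] fun n : ℕ => logb 2 n ^ (1 + β)) :
    ∃ c C : ℝ, ∀ᶠ n in atTop, Regime (q n) n β c C := by
  obtain ⟨C₀, hC₀⟩ := hq.1.bound
  obtain ⟨c₀, hc₀, hc⟩ := hq.2.exists_pos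
  have hc := hc.bound
  refine ⟨c₀⁻¹, max C₀ 1, ?_⟩
  have hL := tendsto_logb_nat
  have hℓ : Tendsto (fun n : ℕ => logb 2 (logb 2 (n : ℝ))) atTop atTop :=
    (tendsto_logb_atTop (by norm_num)).comp hL
  filter_upwards [hC₀, hc, hL.eventually_ge_atTop 2, hL.eventually_ge_atTop (36 / c₀⁻¹),
    hℓ.eventually_ge_atTop 1, hℓ.eventually_ge_atTop (logb 2 (max C₀ 1) + 1),
    hℓ.eventually_ge_atTop (36 / c₀⁻¹), eventually_gt_atTop 1] with n h1 h2 h3 h4 h5 h6 h7 h8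
  have hA : 0 ≤ logb 2 (n : ℝ) ^ (1 + β) := rpow_nonneg (by linarith) _
  rw [norm_of_nonneg (Nat.cast_nonneg _), norm_of_nonneg hA] at h1 h2
  refine ⟨hβ, inv_pos.2 hc₀, le_max_right _ _, ?_, ?_, h5, h6, h7, h4, h3, h8⟩
  · rwa [inv_mul_le_iff₀ hc₀]
  · exact h1.trans (mul_le_mul_of_nonneg_right (le_max_left _ _) hA)

end Streaming

/-! ### The main theorem -/

open Streaming in
theorem mainTheorem9 (δ : ℝ) (hδ : 0 < δ) (hδ' : δ ≤ 1)
    (F : ℕ → Type u) [∀ n, Field (F n)] [∀ n, Fintype (F n)]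
    (hq : (fun n : ℕ => (Fintype.card (F n) : ℝ)) =Θ[atTop]
      fun n : ℕ => Real.logb 2 n ^ (1 + 2 / δ)) :
    ∃ (s σ c₁ c₂ : ℕ → ℕ)
      (Z : ∀ n, F n → Triplet (F n) (IndexSymbol (F n) n) (s n) (σ n)),
      -- space of the verifier and of the simulator
      ((fun n => (s n : ℝ)) =O[atTop] fun n : ℕ => Real.logb 2 n) ∧
      (∃ k : ℕ, ∀ n, σ n ≤ (s n + 2) ^ k) ∧
      -- communication in the setup and in the interactive stage
      ((fun n => (c₁ n : ℝ)) =O[atTop] fun n : ℕ => (n : ℝ) ^ (1 + δ)) ∧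
      (∃ k : ℕ, (fun n => (c₂ n : ℝ)) =O[atTop] fun n : ℕ => Real.logb 2 n ^ k) ∧
      (∀ n (α : F n),
        (Z n α).schedule.setupBits (F n) ≤ c₁ n ∧
        (Z n α).schedule.interactiveBits (F n) ≤ c₂ n ∧
        IsSIP (indexStream (F n) n) (decisionIndex n α)
          (Z n α).schedule (Z n α).prover (Z n α).verifier) ∧
      -- security against all distinguishers of quasi-`log ^ (2 + 2 / δ)` space
      (∀ s' : ℕ → ℕ,
        (∃ k : ℕ, (fun n => (s' n : ℝ)) =O[atTop] fun n : ℕ =>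
          Real.logb 2 n ^ (2 + 2 / δ) * Real.logb 2 (Real.logb 2 n) ^ k) →
        ∃ ε : ℕ → ℝ, Tendsto ε atTop (𝓝 0) ∧
          ∀ n (α : F n),
            (Z n α).ZeroKnowledge (indexStream (F n) n) (decisionIndex n α) (s' n) (ε n)) := by
  have hβ : 2 ≤ 2 / δ := by rw [le_div_iff₀ hδ]; linarith
  have hβδ : 2 / δ * δ = 2 := div_mul_cancel₀ _ hδ.ne'
  set β := 2 / δ
  obtain ⟨c, C, hreg⟩ := eventually_regime hβ hq
  set k := ⌈C⌉₊ + ⌈1 + β⌉₊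
  choose s σ c₁ c₂ ε hσ hZ hval using fun n =>
    exists_protocol (F n) n (side β n) (dim β n) k
  choose Z hZ₁ hZ₂ hZ₃ hZ₄ using hZ
  have hL := tendsto_logb_nat
  have hℓ : Tendsto (fun n : ℕ => Real.logb 2 (Real.logb 2 (n : ℝ))) atTop atTop :=
    (Real.tendsto_logb_atTop (by norm_num)).comp hL
  have hs : (fun n => (s n : ℝ)) =O[atTop] fun n : ℕ => Real.logb 2 n := by
    refine IsBigO.of_bound (8 * (2 + β)) ?_
    filter_upwards [hreg] with n h
    rw [(hval n h.admissible).1, Real.norm_of_nonneg (Nat.cast_nonneg _),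
      Real.norm_of_nonneg (by linarith [h.log_pos])]
    exact h.space_le
  have hlittle : ∀ {r : ℝ}, 0 < r → (fun n => (Fintype.card (F n) : ℝ)) =o[atTop]
      fun n : ℕ => (n : ℝ) ^ r := fun hr => hq.1.trans_isLittleO (isLittleO_logb_rpow _ hr)
  refine ⟨s, σ, c₁, c₂, Z, hs, ⟨k + 6, hσ⟩, ?_, ⟨2 * ⌈1 + β⌉₊, ?_⟩,
    fun n α => ⟨hZ₁ n α, hZ₂ n α, hZ₃ n α⟩, fun s' ⟨k', hs'⟩ =>
      ⟨fun n => ε n (s' n), ?_, fun n α => hZ₄ n α (s' n)⟩⟩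
  · refine IsBigO.of_bound 2 ?_
    filter_upwards [hreg, hℓ.eventually_ge_atTop (2 * Real.logb 2 C),
      -- `δ / 12`, because `setup_le` asks for the cube of `q` to be at most `n ^ (δ / 4)`.
      (hlittle (by positivity : 0 < δ / 12)).bound one_pos] with n h h1 h2
    rw [(hval n h.admissible).2.1, Real.norm_of_nonneg (Nat.cast_nonneg _),
      Real.norm_of_nonneg (by positivity)]
    refine h.setup_le hβδ h1 ?_
    rw [Real.norm_of_nonneg (Nat.cast_nonneg _), Real.norm_of_nonneg (by positivity),
      one_mul] at h2
    calc _ ≤ ((n : ℝ) ^ (δ / 12)) ^ 3 := by gcongr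
      _ = _ := by
        rw [← Real.rpow_mul_natCast (Nat.cast_nonneg _)]
        congr 1
        push_cast
        ring
  · refine IsBigO.of_bound ((9 + 2 * C) * C) ?_
    filter_upwards [hreg] with n h
    rw [(hval n h.admissible).2.2.1, Real.norm_of_nonneg (Nat.cast_nonneg _),
      Real.norm_of_nonneg (pow_nonneg (by linarith [h.log_pos]) _)]
    exact h.interactive_le
  · have hε : (fun n => ε n (s' n)) =ᶠ[atTop] fun n =>
        3 / √(Real.log (Fintype.card (F n))) + (3 * s n + s' n + 1) / √n := by
      filter_upwards [hreg] with n h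
      rw [(hval n h.admissible).2.2.2]
    refine Tendsto.congr' hε.symm ?_
    have hcard : Tendsto (fun n => (Fintype.card (F n) : ℝ)) atTop atTop := by
      refine tendsto_atTop_mono' _ ?_ hL
      filter_upwards [hreg] with n h
      have h1 : Real.logb 2 n ≤ Real.logb 2 n ^ β :=
        Real.self_le_rpow_of_one_le (by linarith [h.log_pos]) (by linarith)
      exact h1.trans (h.le_side.trans (by exact_mod_cast h.side_le_card))
    have h1 : Tendsto (fun n => 3 / √(Real.log (Fintype.card (F n)))) atTop (𝓝 0) :=
      tendsto_const_nhds.div_atTop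
        (Real.tendsto_sqrt_atTop.comp (Real.tendsto_log_atTop.comp hcard))
    -- All that is needed of the distinguisher's space is that it is `o(√n)`; any power of `log n`
    -- qualifies.
    have h2 : (fun n : ℕ => (3 * s n + s' n + 1 : ℝ)) =o[atTop]
        fun n : ℕ => (n : ℝ) ^ (1 / 2 : ℝ) := by
      have hr : (0 : ℝ) < 1 / 2 := by norm_num
      refine ((IsLittleO.const_mul_left ?_ _).add ?_).add ?_
      · refine hs.trans_isLittleO ((isLittleO_logb_rpow 1 hr).congr_left fun n => ?_)
        exact Real.rpow_one _
      -- Powers of `log log n` are crudely replaced by powers of `log n`.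
      · have h3 : (fun n : ℕ =>
            Real.logb 2 n ^ (2 + β) * Real.logb 2 (Real.logb 2 n) ^ k') =O[atTop]
            fun n : ℕ => Real.logb 2 n ^ (2 + β + k') := by
          refine IsBigO.of_bound 1 ?_
          filter_upwards [hreg] with n h
          have e0 := h.log_pos
          have e1 := h.loglog
          rw [one_mul, Real.norm_of_nonneg (mul_nonneg (Real.rpow_nonneg (by linarith) _)
            (pow_nonneg (by linarith) _)), Real.norm_of_nonneg (Real.rpow_nonneg (by linarith) _),
            Real.rpow_add (by linarith) (2 + β) k', Real.rpow_natCast]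
          exact mul_le_mul_of_nonneg_left (pow_le_pow_left₀ (by linarith) h.loglog_le _)
            (Real.rpow_nonneg (by linarith) _)
        exact (hs'.trans h3).trans_isLittleO (isLittleO_logb_rpow _ hr)
      · refine ((isLittleO_logb_rpow 0 hr).congr_left fun n => ?_)
        exact Real.rpow_zero _
    have h3 := h2.tendsto_div_nhds_zero
    simp only [← Real.sqrt_eq_rpow] at h3
    simpa using h1.add h3

end
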